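/- **Construction.** Let $D:\mathbb R\to\mathbb R$ be continuous with exactly two zeros $x_-<0<x_+$ (turning points), $D>0$ on $(x_-,x_+)$ and $D<0$ outside $[x_-,x_+]$. Put $b:=-\frac1\pi\int_{x_-}^{x_+}\sqrt{D(x)}\,dx<0$ and define the Langer transformation $y=g(x)$ by $$\int_{2\sqrt{-b}}^{y}\sqrt{\left|\tfrac14 s^2+b\right|}\,ds=\int_{x_+}^{x}\sqrt{|D(s)|}\,ds ,\qquad x\in\mathbb R .$$ It is used below for $D=\det\mathbf B(\cdot;\lambda)$, where $\mathbf B$ is the coefficient matrix of a system $\epsilon\mathbf w'=\mathbf B\mathbf w$; we then write $g(x;\lambda)$, and primes denote $x$-derivatives. **(a) Schrödinger equation.** Let $\mathbf B=\begin{bmatrix}0&1\\ \mathcal V(x;\lambda)-\lambda&0\end{bmatrix}$, so $\det\mathbf B=\lambda-\mathcal V(x;\lambda)$. Let $\Lambda,\delta>0$ and suppose that for every $\lambda\in[0,\Lambda]$: $\mathcal V(\cdot;\lambda)\in C^5(\mathbb R)$, $\mathcal V(0;\lambda)=\mathcal V'(0;\lambda)=0$, $\mathcal V''(0;\lambda)>0$,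 and $\pm\mathcal V'(x;\lambda)>0$ for $\pm x>0$. Suppose that for some exponents $p_\pm\ge0$ and coefficients $\mathcal V_\pm=\mathcal V_\pm(\lambda)>0$ we have $\mathcal V(x;\lambda)=\mathcal V_\pm|x|^{p_\pm}(1+o(1))$ as $x\to\pm\infty$, uniformly in $\lambda\in[0,\Lambda]$, and that for every $r>0$, $\mathcal V'(x;\lambda)=O(|x|^{p_\pm-1})$ and $\mathcal V''(x;\lambda)=O(|x|^{p_\pm-2})$ uniformly for $\pm x\ge r$ and $\lambda\in[0,\Lambda]$. Finally suppose that for $m=0,1,2$ and $n=0,\dots,5$ the derivatives $\partial_\lambda^m\partial_x^n\mathcal V(x;\lambda)$ exist and are continuous on $(-\delta,\delta)\times[0,\Lambda]$. Then for all sufficiently small $\lambda_{\max}>0$ there is a constant $C>0$ such that for all $0<\lambda\le\lambda_{\max}$ the Langer transformation is well defined (there are exactly two turning points, $x_-<0<x_+$; $b<0$; $g(\cdot;\lambda)$ is a $C^3$ bijection of $\mathbb R$ with $g'>0$, $g'^2(\frac14g^2+b)=-\det\mathbf B$ and $g(x_\pm;\lambda)=\pm2\sqrt{-b}$), and $$Q(y;\lambda):=-\frac{3g''(x;\lambda)^2}{4g'(x;\lambda)^4}+\frac{g'''(x;\lambda)}{2g'(x;\lambda)^3},\qquad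 y=g(x;\lambda),$$ satisfies $|Q(y;\lambda)|\le \dfrac{C}{1+y^2}$ for all $y\in\mathbb R$. **(b) Zakharov–Shabat system.** Let $\mathbf B=\begin{bmatrix}-i(\lambda+\frac12S'(x))&A(x)\\A(x)&i(\lambda+\frac12S'(x))\end{bmatrix}$ with $A,S$ real-valued, $S$ differentiable, and put $r_\pm:=-\frac12S'\pm A$, $R_+(x;\lambda):=\lambda-r_-(x)$. Suppose that $r_\pm\in C^5(\mathbb R)$, that $-1\le r_-(x)\le\max r_-<\min r_+\le r_+(x)\le1$, that $r_\pm(x)\to\pm1$, $r_\pm'(x)=O(|x|^{-1})$ and $r_\pm''(x)=O(|x|^{-2})$ as $|x|\to\infty$, and that $r_+'(0)=0$, $r_+''(0)>0$ and $\pm r_+'(x)>0$ for $\pm x>0$. Then for each $\lambda_{\max}\in(\min r_+,1)$ there is a constant $C>0$ such that for all $\min r_+<\lambda\le\lambda_{\max}$ the Langer transformation is well defined in the same sense, and $$Q(y;\lambda):=-\frac{3g''(x;\lambda)^2}{4g'(x;\lambda)^4}+\frac{g'''(x;\lambda)}{2g'(x;\lambda)^3}-\frac1{g'(x;\lambda)^2}\left[-\frac{3R_+'(x;\lambda)^2}{4R_+(x;\lambda)^2}+\frac{R_+''(x;\lambda)}{2R_+(x;\lambda)}\right],\qquad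 y=g(x;\lambda),$$ satisfies $|Q(y;\lambda)|\le \dfrac{C}{1+y^2}$ for all $y\in\mathbb R$. -/

import Mathlib

open Set Filter Topology MeasureTheory Asymptotics

noncomputable section

namespace Weber

/-- Coefficient matrix of the Schrödinger system `ε w' = B w` with potential `V` and energy `l`. -/
def schrodingerB (V : ℝ → ℝ → ℝ) (l x : ℝ) : Matrix (Fin 2) (Fin 2) ℂ :=
  !![0, 1; ((V x l - l : ℝ) : ℂ), 0]

/-- Coefficient matrix of the (phase-reduced) selfadjoint Zakharov-Shabat system `ε w' = B w`,
with amplitude `A` and phase `S`. -/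
def zakharovShabatB (A S : ℝ → ℝ) (l x : ℝ) : Matrix (Fin 2) (Fin 2) ℂ :=
  !![-Complex.I * ((l + deriv S x / 2 : ℝ) : ℂ), (A x : ℂ);
     (A x : ℂ), Complex.I * ((l + deriv S x / 2 : ℝ) : ℂ)]

/-- The determinant of a coefficient matrix as a real function (it is real in both systems). -/
def detFun (B : ℝ → Matrix (Fin 2) (Fin 2) ℂ) (x : ℝ) : ℝ := (B x).det.re

/-- The turning point on the negative half-line: the negative zero of `D = det B`. -/
def leftTurningPoint (D : ℝ → ℝ) : ℝ := sSup {x | x < 0 ∧ D x = 0}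

/-- The turning point on the positive half-line: the positive zero of `D = det B`. -/
def rightTurningPoint (D : ℝ → ℝ) : ℝ := sInf {x | 0 < x ∧ D x = 0}

/-- The parameter `b = -(1/π) ∫_{x₋}^{x₊} √(det B)` of the Weber model `m(y) = y²/4 + b`. -/
def weberParam (D : ℝ → ℝ) : ℝ :=
  -(1 / Real.pi) * ∫ x in (leftTurningPoint D)..(rightTurningPoint D), √(D x)

/-- The Langer transformation: `y = g(x)` is the solution of
`∫_{2√(-b)}^y √|s²/4 + b| ds = ∫_{x₊}^x √|det B(s)| ds`.
With `b = weberParam D` the integrals may equivalently be started at `-2√(-b)` and `x₋`. -/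
def langer (D : ℝ → ℝ) (x : ℝ) : ℝ :=
  Function.invFun
    (fun y : ℝ => ∫ s in (2 * √(-weberParam D))..y, √|s ^ 2 / 4 + weberParam D|)
    (∫ s in (rightTurningPoint D)..x, √|D s|)

/-- The construction of turning points, Weber parameter and Langer transformation from
`D = det B` succeeds: there are exactly two turning points, one on each side of `0`, `b < 0`, and
`g` is an increasing `C³` bijection of the line solving the Langer equation
`g'² (g²/4 + b) = -det B` and mapping the turning points to `±2√(-b)`. -/
structure LangerWellDefined (D : ℝ → ℝ) : Prop where
  left_neg : leftTurningPoint D < 0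
  right_pos : 0 < rightTurningPoint D
  zeros : ∀ x, D x = 0 ↔ x = leftTurningPoint D ∨ x = rightTurningPoint D
  param_neg : weberParam D < 0
  contDiff : ContDiff ℝ 3 (langer D)
  deriv_pos : ∀ x, 0 < deriv (langer D) x
  bijective : Function.Bijective (langer D)
  equation : ∀ x, deriv (langer D) x ^ 2 * (langer D x ^ 2 / 4 + weberParam D) = -D x
  map_left : langer D (leftTurningPoint D) = -(2 * √(-weberParam D))
  map_right : langer D (rightTurningPoint D) = 2 * √(-weberParam D)

/-- The expression `-3 g''²/(4 g'⁴) + g'''/(2 g'³)`. -/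
def schrodingerQAt (g : ℝ → ℝ) (x : ℝ) : ℝ :=
  -(3 * iteratedDeriv 2 g x ^ 2) / (4 * deriv g x ^ 4)
    + iteratedDeriv 3 g x / (2 * deriv g x ^ 3)

/-- The expression
`-3 g''²/(4 g'⁴) + g'''/(2 g'³) - (1/g'²) [-3 R'²/(4 R²) + R''/(2 R)]`. -/
def zakharovShabatQAt (g R : ℝ → ℝ) (x : ℝ) : ℝ :=
  -(3 * iteratedDeriv 2 g x ^ 2) / (4 * deriv g x ^ 4)
    + iteratedDeriv 3 g x / (2 * deriv g x ^ 3)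
    - 1 / deriv g x ^ 2 *
        (-(3 * deriv R x ^ 2) / (4 * R x ^ 2) + iteratedDeriv 2 R x / (2 * R x))

/-- The perturbing potential `Q(y; l)` of the Schrödinger system, with `x = g⁻¹(y)`. -/
def schrodingerQ (V : ℝ → ℝ → ℝ) (l y : ℝ) : ℝ :=
  schrodingerQAt (langer (detFun (schrodingerB V l)))
    (Function.invFun (langer (detFun (schrodingerB V l))) y)

/-- The functions `r₊ = -S'/2 + A` and `r₋ = -S'/2 - A`. -/
def rPlus (A S : ℝ → ℝ) (x : ℝ) : ℝ := -(1 / 2) * deriv S x + A x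

/-- See `rPlus`. -/
def rMinus (A S : ℝ → ℝ) (x : ℝ) : ℝ := -(1 / 2) * deriv S x - A x

/-- The perturbing potential `Q(y; l)` of the Zakharov-Shabat system, with `x = g⁻¹(y)`, formed
with the nonvanishing factor `R₊(x; l) = l - r₋(x)` of `-det B = R₊ R₋`. -/
def zakharovShabatQ (A S : ℝ → ℝ) (l y : ℝ) : ℝ :=
  zakharovShabatQAt (langer (detFun (zakharovShabatB A S l))) (fun x => l - rMinus A S x)
    (Function.invFun (langer (detFun (zakharovShabatB A S l))) y)

/-- Hypotheses on the (possibly energy-dependent) single-well potential `V x l`, for energies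
`l ∈ [0, Λ]`: growth exponents `p₊, p₋`, leading coefficients `V₊, V₋`, all asymptotics uniform
in `l`, and smoothness in `(x, l)` for `x ∈ (-δ, δ)`. -/
structure SchrodingerHypotheses (V : ℝ → ℝ → ℝ) (Λ δ pPlus pMinus : ℝ)
    (VPlus VMinus : ℝ → ℝ) : Prop where
  Λ_pos : 0 < Λ
  δ_pos : 0 < δ
  pPlus_nonneg : 0 ≤ pPlus
  pMinus_nonneg : 0 ≤ pMinus
  VPlus_pos : ∀ l ∈ Icc 0 Λ, 0 < VPlus l
  VMinus_pos : ∀ l ∈ Icc 0 Λ, 0 < VMinus l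
  contDiff : ∀ l ∈ Icc 0 Λ, ContDiff ℝ 5 (fun x => V x l)
  zero : ∀ l ∈ Icc 0 Λ, V 0 l = 0
  deriv_zero : ∀ l ∈ Icc 0 Λ, deriv (fun x => V x l) 0 = 0
  deriv2_zero : ∀ l ∈ Icc 0 Λ, 0 < iteratedDeriv 2 (fun x => V x l) 0
  deriv_pos : ∀ l ∈ Icc 0 Λ, ∀ x, 0 < x → 0 < deriv (fun x => V x l) x
  deriv_neg : ∀ l ∈ Icc 0 Λ, ∀ x, x < 0 → deriv (fun x => V x l) x < 0
  growth_top : TendstoUniformlyOn (fun x l => V x l / (VPlus l * |x| ^ pPlus)) (fun _ => 1)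
    atTop (Icc 0 Λ)
  growth_bot : TendstoUniformlyOn (fun x l => V x l / (VMinus l * |x| ^ pMinus)) (fun _ => 1)
    atBot (Icc 0 Λ)
  bound_top : ∀ r > 0, ∃ c : ℝ, ∀ l ∈ Icc 0 Λ, ∀ x, r ≤ x →
    |deriv (fun x => V x l) x| ≤ c * |x| ^ (pPlus - 1) ∧
    |iteratedDeriv 2 (fun x => V x l) x| ≤ c * |x| ^ (pPlus - 2)
  bound_bot : ∀ r > 0, ∃ c : ℝ, ∀ l ∈ Icc 0 Λ, ∀ x, x ≤ -r →
    |deriv (fun x => V x l) x| ≤ c * |x| ^ (pMinus - 1) ∧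
    |iteratedDeriv 2 (fun x => V x l) x| ≤ c * |x| ^ (pMinus - 2)
  mixed_exists : ∀ n ≤ 5, ∀ x ∈ Ioo (-δ) δ,
    ContDiffOn ℝ 2 (fun l => iteratedDeriv n (fun x => V x l) x) (Icc 0 Λ)
  mixed_continuous : ∀ m ≤ 2, ∀ n ≤ 5,
    ContinuousOn (fun q : ℝ × ℝ =>
      iteratedDerivWithin m (fun l => iteratedDeriv n (fun x => V x l) q.1) (Icc 0 Λ) q.2)
      (Ioo (-δ) δ ×ˢ Icc 0 Λ)

/-- Hypotheses on the amplitude `A` and phase `S` of the Zakharov-Shabat potential,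
in terms of `r₊` and `r₋`. -/
structure ZakharovShabatHypotheses (A S : ℝ → ℝ) : Prop where
  differentiable_S : Differentiable ℝ S
  contDiff_plus : ContDiff ℝ 5 (rPlus A S)
  contDiff_minus : ContDiff ℝ 5 (rMinus A S)
  minus_ge : ∀ x, -1 ≤ rMinus A S x
  plus_le : ∀ x, rPlus A S x ≤ 1
  gap : (⨆ x, rMinus A S x) < ⨅ x, rPlus A S x
  bddAbove_minus : BddAbove (range (rMinus A S))
  bddBelow_plus : BddBelow (range (rPlus A S))
  tendsto_plus : Tendsto (rPlus A S) (cocompact ℝ) (𝓝 1)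
  tendsto_minus : Tendsto (rMinus A S) (cocompact ℝ) (𝓝 (-1))
  deriv_plus : deriv (rPlus A S) =O[cocompact ℝ] fun x => |x| ^ (-1 : ℝ)
  deriv_minus : deriv (rMinus A S) =O[cocompact ℝ] fun x => |x| ^ (-1 : ℝ)
  deriv2_plus : iteratedDeriv 2 (rPlus A S) =O[cocompact ℝ] fun x => |x| ^ (-2 : ℝ)
  deriv2_minus : iteratedDeriv 2 (rMinus A S) =O[cocompact ℝ] fun x => |x| ^ (-2 : ℝ)
  deriv_zero : deriv (rPlus A S) 0 = 0
  deriv2_zero : 0 < iteratedDeriv 2 (rPlus A S) 0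
  deriv_pos : ∀ x, 0 < x → 0 < deriv (rPlus A S) x
  deriv_neg : ∀ x, x < 0 → deriv (rPlus A S) x < 0

end Weber

end

/-! In both systems `-det B = (V - a²) ρ` with a single well `V` (minimum value 0 at 0), a positive
factor `ρ` and an energy `a² > 0`: `ρ = 1`, `a² = λ` for Schrödinger, and `V = r₊ - r₊(0)`, `ρ = λ -
r₋`, `a² = λ - r₊(0)` for Zakharov–Shabat. The difficulty is uniformity as `a → 0`, when the two
turning points merge; away from them the claim is a WKB estimate.

Near the well, the signed square root `u = ±√V` is a `C⁴` coordinate because the minimum is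
nondegenerate. It turns `√|det B| dx` into `√|u² - a²| φ(u) du` with `φ > 0` of class `C³`. If `c`
is the mean of `φ` over `[-a, a]` for the semicircle law, then `b = -c a² / 2`, and `g = √(2c) w(u)`
where `c ∫_a^w √|s² - a²| ds = ∫_a^u √|s² - a²| φ ds`. It remains to show that `w` is `C³` in `u`,
with bounds independent of `a` and with `w'` bounded below (`model_unifC`).

Write `w = u + (u² - a²) P`. Dividing the equation by `(u² - a²) √|u² - a²|` removes the
singularities and leaves `P ∫₀¹ √(rad a u (τ P)) dτ = K / c`, where `K` is the quotient of `∫_a^u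
√|s² - a²| (φ - c) ds` by the same factor. `K` is regular also at `-a` exactly because `φ - c` has
semicircle mean zero. It is uniformly `C²` (`exists_quotient_unifC`): the quadratic Taylor
polynomial of `φ` is integrated explicitly, and the cubic remainder is handled by rescaling every
point to unit distance from the opposite turning point (`kPlus_unifC`). Comparing `w` with `u` at
the turning points keeps `rad` away from 0, and the identity `rad_identity` cancels the factor `u² -
a²` in `P'`, so that `P'` is a regular expression in `K'` and `P`. Bootstrapping gives `P` in `C²`
and then `w` in `C³`.

Far from the well, `g'² (g²/4 + b) = f` with `f = -det B` expresses `Q` through `f''/f`, `(f'/f)²`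
and the same quantities for the Weber model (`RightLanger.schrodingerQAt_eq`). Bounds `x |f'| + x²
|f''| ≲ f` and the comparison `g² ≲ x √f` give `|Q| (1 + g²) ≤ C` (`exists_wkb_bound`).
`exists_langer_bound` joins both regions, and the two systems are then checked against its
hypotheses. -/

namespace Weber

/-! ### Calculus of families with derivative bounds independent of the index -/

/-- The family `f i` is `C^k` on the sets `s i`, with derivatives up to order `k` bounded on `s i`
uniformly in `i`. -/
def UnifC {ι : Type*} (k : ℕ) (s : ι → Set ℝ) (f : ι → ℝ → ℝ) : Prop :=
  match k with
  | 0 => (∃ M, ∀ i, ∀ x ∈ s i, |f i x| ≤ M) ∧ ∀ i, ∀ x ∈ s i, ContinuousAt (f i) x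
  | k + 1 => (∃ M, ∀ i, ∀ x ∈ s i, |f i x| ≤ M) ∧ (∀ i, ∀ x ∈ s i, DifferentiableAt ℝ (f i) x) ∧
      UnifC k s (fun i => deriv (f i))

namespace UnifC

variable {ι κ : Type*} {k : ℕ} {s t : ι → Set ℝ} {f g : ι → ℝ → ℝ}

theorem bdd (h : UnifC k s f) : ∃ M, ∀ i, ∀ x ∈ s i, |f i x| ≤ M := by
  cases k with
  | zero => exact h.1
  | succ k => exact h.1

theorem bdd_pos (h : UnifC k s f) : ∃ M, 0 < M ∧ ∀ i, ∀ x ∈ s i, |f i x| ≤ M := by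
  obtain ⟨M, hM⟩ := h.bdd
  exact ⟨max M 1, by positivity, fun i x hx => (hM i x hx).trans (le_max_left _ _)⟩

theorem continuousAt (h : UnifC k s f) {i : ι} {x : ℝ} (hx : x ∈ s i) : ContinuousAt (f i) x := by
  cases k with
  | zero => exact h.2 i x hx
  | succ k => exact (h.2.1 i x hx).continuousAt

theorem continuousOn (h : UnifC k s f) (i : ι) : ContinuousOn (f i) (s i) :=
  fun _ hx => (h.continuousAt hx).continuousWithinAt

theorem differentiableAt (h : UnifC (k + 1) s f) {i : ι} {x : ℝ} (hx : x ∈ s i) :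
    DifferentiableAt ℝ (f i) x := h.2.1 i x hx

theorem hasDerivAt (h : UnifC (k + 1) s f) {i : ι} {x : ℝ} (hx : x ∈ s i) :
    HasDerivAt (f i) (deriv (f i) x) x := (h.2.1 i x hx).hasDerivAt

theorem deriv (h : UnifC (k + 1) s f) : UnifC k s (fun i => deriv (f i)) := h.2.2

theorem of_succ (h : UnifC (k + 1) s f) : UnifC k s f := by
  induction k generalizing f with
  | zero => exact ⟨h.1, fun i x hx => h.continuousAt hx⟩
  | succ k ih => exact ⟨h.1, h.2.1, ih h.2.2⟩

theorem of_le {l : ℕ} (h : UnifC k s f) (hl : l ≤ k) : UnifC l s f := by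
  induction k with
  | zero => obtain rfl : l = 0 := by omega
            exact h
  | succ k ih =>
    rcases Nat.lt_or_ge l (k + 1) with h1 | h1
    · exact ih h.of_succ (by omega)
    · obtain rfl : l = k + 1 := by omega
      exact h

theorem mono (h : UnifC k t f) (hst : ∀ i, s i ⊆ t i) : UnifC k s f := by
  induction k generalizing f with
  | zero =>
    obtain ⟨⟨M, hM⟩, hc⟩ := h
    exact ⟨⟨M, fun i x hx => hM i x (hst i hx)⟩, fun i x hx => hc i x (hst i hx)⟩
  | succ k ih =>
    obtain ⟨⟨M, hM⟩, hc, hd⟩ := h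
    exact ⟨⟨M, fun i x hx => hM i x (hst i hx)⟩, fun i x hx => hc i x (hst i hx), ih hd⟩

theorem reindex (h : UnifC k s f) (e : κ → ι) : UnifC k (fun j => s (e j)) (fun j => f (e j)) := by
  induction k generalizing f with
  | zero =>
    obtain ⟨⟨M, hM⟩, hc⟩ := h
    exact ⟨⟨M, fun i x hx => hM _ x hx⟩, fun i x hx => hc _ x hx⟩
  | succ k ih =>
    obtain ⟨⟨M, hM⟩, hc, hd⟩ := h
    exact ⟨⟨M, fun i x hx => hM _ x hx⟩, fun i x hx => hc _ x hx, ih hd⟩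

theorem union (h : UnifC k s f) (h' : UnifC k t f) : UnifC k (fun i => s i ∪ t i) f := by
  have key : ∀ f : ι → ℝ → ℝ, (∃ M, ∀ i, ∀ x ∈ s i, |f i x| ≤ M) →
      (∃ M, ∀ i, ∀ x ∈ t i, |f i x| ≤ M) → ∃ M, ∀ i, ∀ x ∈ s i ∪ t i, |f i x| ≤ M := by
    rintro f ⟨M, hM⟩ ⟨N, hN⟩
    refine ⟨max M N, fun i x hx => ?_⟩
    rcases hx with hx | hx
    · exact (hM i x hx).trans (le_max_left _ _)
    · exact (hN i x hx).trans (le_max_right _ _)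
  induction k generalizing f with
  | zero => exact ⟨key f h.1 h'.1, fun i x hx => hx.elim (h.2 i x) (h'.2 i x)⟩
  | succ k ih =>
    exact ⟨key f h.1 h'.1, fun i x hx => hx.elim (h.2.1 i x) (h'.2.1 i x), ih h.2.2 h'.2.2⟩

theorem congr (hs : ∀ i, IsOpen (s i)) (h : UnifC k s f) (hfg : ∀ i, ∀ x ∈ s i, g i x = f i x) :
    UnifC k s g := by
  have ev : ∀ i, ∀ x ∈ s i, g i =ᶠ[𝓝 x] f i := fun i x hx =>
    Filter.eventually_of_mem ((hs i).mem_nhds hx) (hfg i)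
  induction k generalizing f g with
  | zero =>
    obtain ⟨⟨M, hM⟩, hc⟩ := h
    exact ⟨⟨M, fun i x hx => by rw [hfg i x hx]; exact hM i x hx⟩,
      fun i x hx => (hc i x hx).congr (ev i x hx).symm⟩
  | succ k ih =>
    obtain ⟨⟨M, hM⟩, hc, hd⟩ := h
    have h1 : ∀ i, ∀ x ∈ s i, _root_.deriv (g i) x = _root_.deriv (f i) x :=
      fun i x hx => (ev i x hx).deriv_eq
    refine ⟨⟨M, fun i x hx => by rw [hfg i x hx]; exact hM i x hx⟩,
      fun i x hx => (ev i x hx).differentiableAt_iff.2 (hc i x hx), ih hd h1 fun i x hx => ?_⟩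
    exact Filter.eventually_of_mem ((hs i).mem_nhds hx) (h1 i)

/-- The induction step behind all closure properties: a derivative formula built from families
already controlled raises the order by one. Openness is needed because `deriv` sees a neighbourhood.
-/
theorem of_hasDerivAt (hs : ∀ i, IsOpen (s i)) (hb : ∃ M, ∀ i, ∀ x ∈ s i, |f i x| ≤ M)
    (hd : ∀ i, ∀ x ∈ s i, HasDerivAt (f i) (g i x) x) (hg : UnifC k s g) : UnifC (k + 1) s f :=
  ⟨hb, fun i x hx => (hd i x hx).differentiableAt, hg.congr hs fun i x hx => (hd i x hx).deriv⟩

theorem const (hs : ∀ i, IsOpen (s i)) {c : ι → ℝ} {M : ℝ} (hc : ∀ i, |c i| ≤ M) :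
    UnifC k s (fun i _ => c i) := by
  have h0 : ∀ k, UnifC k s (fun _ _ => (0 : ℝ)) := by
    intro k
    induction k with
    | zero => exact ⟨⟨0, by simp⟩, fun i x hx => continuousAt_const⟩
    | succ k ih => exact of_hasDerivAt hs ⟨0, by simp⟩ (fun i x hx => hasDerivAt_const _ _) ih
  cases k with
  | zero => exact ⟨⟨M, fun i x _ => hc i⟩, fun i x hx => continuousAt_const⟩
  | succ k => exact of_hasDerivAt hs ⟨M, fun i x _ => hc i⟩ (fun i x hx => hasDerivAt_const _ _) (h0 k)

theorem const' (hs : ∀ i, IsOpen (s i)) (c : ℝ) : UnifC k s (fun _ _ => c) :=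
  const hs (c := fun _ => c) (M := |c|) fun _ => le_rfl

theorem id {M : ℝ} (hs : ∀ i, IsOpen (s i)) (hM : ∀ i, ∀ x ∈ s i, |x| ≤ M) :
    UnifC k s (fun _ x => x) := by
  cases k with
  | zero => exact ⟨⟨M, hM⟩, fun i x hx => continuousAt_id⟩
  | succ k => exact of_hasDerivAt hs ⟨M, hM⟩ (fun i x hx => hasDerivAt_id x) (const' hs 1)

theorem add (hs : ∀ i, IsOpen (s i)) (hf : UnifC k s f) (hg : UnifC k s g) :
    UnifC k s (fun i x => f i x + g i x) := by
  have hb : ∃ M, ∀ i, ∀ x ∈ s i, |f i x + g i x| ≤ M := by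
    obtain ⟨M, hM⟩ := hf.bdd
    obtain ⟨N, hN⟩ := hg.bdd
    exact ⟨M + N, fun i x hx => (abs_add_le _ _).trans (add_le_add (hM i x hx) (hN i x hx))⟩
  induction k generalizing f g with
  | zero => exact ⟨hb, fun i x hx => (hf.continuousAt hx).add (hg.continuousAt hx)⟩
  | succ k ih =>
    refine of_hasDerivAt hs hb (fun i x hx => (hf.hasDerivAt hx).add (hg.hasDerivAt hx))
      (ih hf.deriv hg.deriv ?_)
    obtain ⟨M, hM⟩ := hf.deriv.bdd
    obtain ⟨N, hN⟩ := hg.deriv.bdd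
    exact ⟨M + N, fun i x hx => (abs_add_le _ _).trans (add_le_add (hM i x hx) (hN i x hx))⟩

theorem mul (hs : ∀ i, IsOpen (s i)) (hf : UnifC k s f) (hg : UnifC k s g) :
    UnifC k s (fun i x => f i x * g i x) := by
  have hb : ∃ M, ∀ i, ∀ x ∈ s i, |f i x * g i x| ≤ M := by
    obtain ⟨M, hM0, hM⟩ := hf.bdd_pos
    obtain ⟨N, hN⟩ := hg.bdd
    exact ⟨M * N, fun i x hx => by
      rw [abs_mul]
      exact mul_le_mul (hM i x hx) (hN i x hx) (abs_nonneg _) hM0.le⟩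
  induction k generalizing f g with
  | zero => exact ⟨hb, fun i x hx => (hf.continuousAt hx).mul (hg.continuousAt hx)⟩
  | succ k ih =>
    have bd : ∀ {f g : ι → ℝ → ℝ}, UnifC k s f → UnifC k s g →
        ∃ M, ∀ i, ∀ x ∈ s i, |f i x * g i x| ≤ M := by
      intro f g hf hg
      obtain ⟨M, hM0, hM⟩ := hf.bdd_pos
      obtain ⟨N, hN⟩ := hg.bdd
      exact ⟨M * N, fun i x hx => by
        rw [abs_mul]
        exact mul_le_mul (hM i x hx) (hN i x hx) (abs_nonneg _) hM0.le⟩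
    refine of_hasDerivAt hs hb (fun i x hx => (hf.hasDerivAt hx).mul (hg.hasDerivAt hx))
      (UnifC.add hs (ih hf.deriv hg.of_succ (bd hf.deriv hg.of_succ))
        (ih hf.of_succ hg.deriv (bd hf.of_succ hg.deriv)))

theorem neg (hs : ∀ i, IsOpen (s i)) (hf : UnifC k s f) : UnifC k s (fun i x => -f i x) := by
  simpa using (const' hs (-1)).mul hs hf

theorem sub (hs : ∀ i, IsOpen (s i)) (hf : UnifC k s f) (hg : UnifC k s g) :
    UnifC k s (fun i x => f i x - g i x) := by
  simpa [sub_eq_add_neg] using hf.add hs (hg.neg hs)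

theorem inv (hs : ∀ i, IsOpen (s i)) (hf : UnifC k s f) {m : ℝ} (hm : 0 < m)
    (hfm : ∀ i, ∀ x ∈ s i, m ≤ f i x) : UnifC k s (fun i x => (f i x)⁻¹) := by
  have hb : ∃ M, ∀ i, ∀ x ∈ s i, |(f i x)⁻¹| ≤ M := ⟨m⁻¹, fun i x hx => by
    rw [abs_inv, abs_of_pos (hm.trans_le (hfm i x hx))]
    exact inv_anti₀ hm (hfm i x hx)⟩
  have h0 : ∀ i, ∀ x ∈ s i, f i x ≠ 0 := fun i x hx => (hm.trans_le (hfm i x hx)).ne'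
  induction k with
  | zero => exact ⟨hb, fun i x hx => (hf.continuousAt hx).inv₀ (h0 i x hx)⟩
  | succ k ih =>
    have h1 := ih hf.of_succ
    refine of_hasDerivAt hs hb (g := fun i x => -(_root_.deriv (f i) x * ((f i x)⁻¹ * (f i x)⁻¹)))
      (fun i x hx => ?_) ((hf.deriv.mul hs (h1.mul hs h1)).neg hs)
    refine ((hf.hasDerivAt hx).inv (h0 i x hx)).congr_deriv ?_
    have := h0 i x hx
    field_simp

theorem sqrt (hs : ∀ i, IsOpen (s i)) (hf : UnifC k s f) {m : ℝ} (hm : 0 < m)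
    (hfm : ∀ i, ∀ x ∈ s i, m ≤ f i x) : UnifC k s (fun i x => √(f i x)) := by
  have hb : ∃ M, ∀ i, ∀ x ∈ s i, |√(f i x)| ≤ M := by
    obtain ⟨M, hM⟩ := hf.bdd
    exact ⟨√M, fun i x hx => by
      rw [abs_of_nonneg (Real.sqrt_nonneg _)]
      exact Real.sqrt_le_sqrt ((le_abs_self _).trans (hM i x hx))⟩
  have h0 : ∀ i, ∀ x ∈ s i, f i x ≠ 0 := fun i x hx => (hm.trans_le (hfm i x hx)).ne'
  induction k with
  | zero => exact ⟨hb, fun i x hx => (hf.continuousAt hx).sqrt⟩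
  | succ k ih =>
    have h1 := (ih hf.of_succ).inv hs (Real.sqrt_pos.2 hm)
      (fun i x hx => Real.sqrt_le_sqrt (hfm i x hx))
    refine of_hasDerivAt hs hb
      (g := fun i x => _root_.deriv (f i) x * (1 / 2 * (√(f i x))⁻¹))
      (fun i x hx => ?_) (hf.deriv.mul hs ((const' hs (1 / 2)).mul hs h1))
    refine ((hf.hasDerivAt hx).sqrt (h0 i x hx)).congr_deriv ?_
    have := Real.sqrt_pos.2 (hm.trans_le (hfm i x hx))
    field_simp

theorem comp (hs : ∀ i, IsOpen (s i)) (hf : UnifC k t f) (hg : UnifC k s g)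
    (hst : ∀ i, ∀ x ∈ s i, g i x ∈ t i) : UnifC k s (fun i x => f i (g i x)) := by
  induction k generalizing f with
  | zero =>
    obtain ⟨M, hM⟩ := hf.bdd
    exact ⟨⟨M, fun i x hx => hM i _ (hst i x hx)⟩, fun i x hx =>
      ContinuousAt.comp (f := g i) (g := f i) (hf.continuousAt (hst i x hx)) (hg.continuousAt hx)⟩
  | succ k ih =>
    obtain ⟨M, hM⟩ := hf.bdd
    refine of_hasDerivAt hs ⟨M, fun i x hx => hM i _ (hst i x hx)⟩
      (g := fun i x => _root_.deriv (f i) (g i x) * _root_.deriv (g i) x)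
      (fun i x hx => (hf.hasDerivAt (hst i x hx)).comp x (hg.hasDerivAt hx))
      ((ih hf.deriv hg.of_succ).mul hs hg.deriv)

theorem contDiffOn (hs : ∀ i, IsOpen (s i)) (hf : UnifC k s f) (i : ι) :
    ContDiffOn ℝ k (f i) (s i) := by
  induction k generalizing f with
  | zero => simpa [contDiffOn_zero] using hf.continuousOn i
  | succ k ih =>
    push_cast
    rw [contDiffOn_succ_iff_deriv_of_isOpen (hs i)]
    exact ⟨fun x hx => (hf.differentiableAt hx).differentiableWithinAt, by simp, ih hf.deriv⟩

theorem of_iteratedDeriv (hd : ∀ i, ContDiff ℝ k (f i))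
    (hb : ∀ n ≤ k, ∃ M, ∀ i, ∀ x ∈ s i, |iteratedDeriv n (f i) x| ≤ M) : UnifC k s f := by
  induction k generalizing f with
  | zero => exact ⟨by simpa using hb 0 le_rfl, fun i x _ => (hd i).continuous.continuousAt⟩
  | succ k ih =>
    refine ⟨by simpa using hb 0 (by omega),
      fun i x _ => (hd i).differentiable (by simp) x, ih (fun i => ?_) fun n hn => ?_⟩
    · have := hd i
      push_cast at this
      rw [contDiff_succ_iff_deriv] at this
      exact this.2.2
    · simpa [iteratedDeriv_succ'] using hb (n + 1) (by omega)

theorem of_contDiff {f : ℝ → ℝ} (hf : ContDiff ℝ k f) (R : ℝ) :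
    UnifC k (fun _ : Unit => Ioo (-R) R) (fun _ => f) := by
  refine of_iteratedDeriv (fun _ => hf) fun n hn => ?_
  have hc : Continuous (iteratedDeriv n f) := hf.continuous_iteratedDeriv n (by exact_mod_cast hn)
  obtain ⟨M, hM⟩ := (isCompact_Icc (a := -R) (b := R)).exists_bound_of_continuousOn hc.continuousOn
  exact ⟨M, fun _ x hx => hM x (Ioo_subset_Icc_self hx)⟩

/-- The sets `s i`, indexed additionally by an integration variable `τ ∈ (0, 1)`. -/
def withUnit (s : ι → Set ℝ) (q : ι × ℝ) : Set ℝ := {x | x ∈ s q.1 ∧ q.2 ∈ Ioo (0 : ℝ) 1}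

theorem isOpen_withUnit (hs : ∀ i, IsOpen (s i)) (q : ι × ℝ) : IsOpen (withUnit s q) := by
  by_cases h : q.2 ∈ Ioo (0 : ℝ) 1
  · have : withUnit s q = s q.1 := by simp only [withUnit, h, and_true, ofPred_mem_eq]
    exact this ▸ hs q.1
  · simp [withUnit, h]

theorem fst (h : UnifC k s f) : UnifC k (withUnit s) (fun q => f q.1) :=
  (h.reindex Prod.fst).mono fun _ _ hx => hx.1

theorem ae_Ioo : ∀ᵐ τ ∂(volume.restrict (uIoc (0 : ℝ) 1)), τ ∈ Ioo (0 : ℝ) 1 := by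
  rw [uIoc_of_le zero_le_one, ← restrict_Ioo_eq_restrict_Ioc]
  exact ae_restrict_mem measurableSet_Ioo

/-- The derivative is the pointwise limit of difference quotients, which are measurable in `τ`. The
shift by `N` keeps the points `x + 1/(n+1)` in `u`. -/
theorem measurable_deriv_param {G : ℝ → ℝ → ℝ} {u : Set ℝ} (hu : IsOpen u)
    (hm : ∀ x ∈ u, AEStronglyMeasurable (fun τ => G τ x) (volume.restrict (uIoc (0 : ℝ) 1)))
    (hd : ∀ τ ∈ Ioo (0 : ℝ) 1, ∀ x ∈ u, DifferentiableAt ℝ (G τ) x) {x : ℝ} (hx : x ∈ u) :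
    AEStronglyMeasurable (fun τ => _root_.deriv (G τ) x) (volume.restrict (uIoc (0 : ℝ) 1)) := by
  have h1 : Tendsto (fun n : ℕ => x + 1 / ((n : ℝ) + 1)) atTop (𝓝 x) := by
    simpa using tendsto_const_nhds.add (tendsto_one_div_add_atTop_nhds_zero_nat (𝕜 := ℝ))
  obtain ⟨N, hN⟩ := eventually_atTop.1 (h1.eventually (hu.mem_nhds hx))
  refine aestronglyMeasurable_of_tendsto_ae (u := atTop)
    (f := fun (n : ℕ) τ => (((n + N : ℕ) : ℝ) + 1) *
      (G τ (x + 1 / (((n + N : ℕ) : ℝ) + 1)) - G τ x)) (fun n => ?_) ?_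
  · exact (((hm _ (hN (n + N) (by omega))).sub (hm x hx)).const_mul _)
  · filter_upwards [ae_Ioo] with τ hτ
    have h2 := (hd τ hτ x hx).hasDerivAt.tendsto_slope
    have h3 : Tendsto (fun n : ℕ => x + 1 / (((n + N : ℕ) : ℝ) + 1)) atTop (𝓝[≠] x) := by
      refine tendsto_nhdsWithin_of_tendsto_nhds_of_eventually_within _
        ((tendsto_add_atTop_iff_nat N).2 h1) (Eventually.of_forall fun n => ?_)
      have : (0 : ℝ) < 1 / (((n + N : ℕ) : ℝ) + 1) := by positivity
      simp only [mem_compl_iff, mem_singleton_iff]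
      linarith
    refine (h2.comp h3).congr fun n => ?_
    have : (((n + N : ℕ) : ℝ) + 1) ≠ 0 := by positivity
    simp only [Function.comp, slope_def_field]
    field_simp
    ring

/-- With `τ` treated as an additional index, uniformity in `τ` is part of the hypothesis, so a
constant dominates the integrand and each of its derivatives. The endpoints of `(0, 1)`, where
factors such as `√τ` and `√(2a + τ(u - a))` could degenerate, are null and excluded by `withUnit`.
-/
theorem integral (hs : ∀ i, IsOpen (s i)) {G : ι × ℝ → ℝ → ℝ} (hG : UnifC k (withUnit s) G)
    (hm : ∀ i, ∀ x ∈ s i,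
      AEStronglyMeasurable (fun τ => G (i, τ) x) (volume.restrict (uIoc (0 : ℝ) 1))) :
    UnifC k s (fun i x => ∫ τ in (0 : ℝ)..1, G (i, τ) x) := by
  have bd : ∀ {k} {G : ι × ℝ → ℝ → ℝ}, UnifC k (withUnit s) G →
      ∃ M, ∀ i, ∀ x ∈ s i, ∀ᵐ τ ∂(volume.restrict (uIoc (0 : ℝ) 1)), ‖G (i, τ) x‖ ≤ M := by
    intro k G hG
    obtain ⟨M, hM⟩ := hG.bdd
    refine ⟨M, fun i x hx => ?_⟩
    filter_upwards [ae_Ioo] with τ hτ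
    exact hM (i, τ) x ⟨hx, hτ⟩
  have bdi : ∀ {k} {G : ι × ℝ → ℝ → ℝ}, UnifC k (withUnit s) G →
      ∃ M, ∀ i, ∀ x ∈ s i, |∫ τ in (0 : ℝ)..1, G (i, τ) x| ≤ M := by
    intro k G hG
    obtain ⟨M, hM⟩ := bd hG
    refine ⟨M, fun i x hx => ?_⟩
    have := intervalIntegral.norm_integral_le_of_norm_le_const_ae
      (a := 0) (b := 1) (f := fun τ => G (i, τ) x) (C := M)
      ((ae_restrict_iff' measurableSet_uIoc).1 (hM i x hx))
    simpa using this
  induction k generalizing G with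
  | zero =>
    refine ⟨bdi hG, fun i x hx => ?_⟩
    obtain ⟨M, hM⟩ := bd hG
    refine intervalIntegral.continuousAt_of_dominated_interval (bound := fun _ => M)
      ?_ ?_ (by simp) ?_
    · exact Filter.eventually_of_mem ((hs i).mem_nhds hx) fun y hy => hm i y hy
    · exact Filter.eventually_of_mem ((hs i).mem_nhds hx) fun y hy =>
        (ae_restrict_iff' measurableSet_uIoc).1 (hM i y hy)
    · refine (ae_restrict_iff' measurableSet_uIoc).1 ?_
      filter_upwards [ae_Ioo] with τ hτ
      exact hG.continuousAt (i := (i, τ)) ⟨hx, hτ⟩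
  | succ k ih =>
    have hm' : ∀ i, ∀ x ∈ s i, AEStronglyMeasurable (fun τ => _root_.deriv (G (i, τ)) x)
        (volume.restrict (uIoc (0 : ℝ) 1)) := fun i x hx =>
      measurable_deriv_param (G := fun τ => G (i, τ)) (hs i) (hm i)
        (fun τ hτ y hy => hG.differentiableAt (i := (i, τ)) ⟨hy, hτ⟩) hx
    refine of_hasDerivAt hs (bdi hG) (fun i x hx => ?_) (ih hG.deriv hm')
    obtain ⟨M, hM⟩ := bd hG
    obtain ⟨N, hN⟩ := hG.deriv.bdd
    refine (intervalIntegral.hasDerivAt_integral_of_dominated_loc_of_deriv_le (μ := volume)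
      (F := fun y τ => G (i, τ) y) (F' := fun y τ => _root_.deriv (G (i, τ)) y)
      (s := s i) (bound := fun _ => N) ((hs i).mem_nhds hx)
      (Filter.eventually_of_mem ((hs i).mem_nhds hx) fun y hy => hm i y hy)
      ?_ (hm' i x hx) ?_ (by simp) ?_).2
    · rw [intervalIntegrable_iff]
      have : IsFiniteMeasure (volume.restrict (uIoc (0 : ℝ) 1)) := by
        rw [uIoc_of_le zero_le_one]; infer_instance
      exact Integrable.of_bound (hm i x hx) M (hM i x hx)
    · refine (ae_restrict_iff' measurableSet_uIoc).1 ?_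
      filter_upwards [ae_Ioo] with τ hτ y hy
      exact hN (i, τ) y ⟨hy, hτ⟩
    · refine (ae_restrict_iff' measurableSet_uIoc).1 ?_
      filter_upwards [ae_Ioo] with τ hτ y hy
      exact hG.hasDerivAt (i := (i, τ)) ⟨hy, hτ⟩

end UnifC

end Weber

/-! ### Rescaling of uniformly smooth families -/

namespace Weber

namespace UnifC

variable {ι κ : Type*} {k : ℕ} {s t : ι → Set ℝ} {f g : ι → ℝ → ℝ}

theorem affine (hs : ∀ i, IsOpen (s i)) {B M N : ℝ} (hB : ∀ i, ∀ x ∈ s i, |x| ≤ B)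
    {p q : ι → ℝ} (hp : ∀ i, |p i| ≤ M) (hq : ∀ i, |q i| ≤ N) :
    UnifC k s (fun i x => p i + q i * x) :=
  (const hs hp).add hs ((const hs hq).mul hs (id hs hB))

/-- Rescaling a family whose Taylor polynomials of degree `k - 1` at `0` vanish. -/
theorem rescale {J : ι → Set ℝ} (hJ : ∀ i, IsOpen (J i)) (hJc : ∀ i, OrdConnected (J i))
    (hJ0 : ∀ i, 0 ∈ J i) (hf : UnifC k J f) (h0 : ∀ m < k, ∀ i, iteratedDeriv m (f i) 0 = 0)
    (e : κ → ι) {σ : κ → ℝ} (hσ : ∀ j, 0 < σ j) {B : ℝ} :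
    UnifC k (fun j => {z | σ j * z ∈ J (e j) ∧ z ∈ Ioo (-B) B})
      (fun j z => f (e j) (σ j * z) / σ j ^ k) := by
  have hs : ∀ j, IsOpen {z | σ j * z ∈ J (e j) ∧ z ∈ Ioo (-B) B} := fun j =>
    ((hJ (e j)).preimage (by fun_prop)).inter isOpen_Ioo
  induction k generalizing f with
  | zero =>
    obtain ⟨M, hM⟩ := hf.bdd
    refine ⟨⟨M, fun j z hz => by simpa using hM _ _ hz.1⟩, fun j z hz => ?_⟩
    have h1 : ContinuousAt (f (e j)) (σ j * z) := hf.continuousAt hz.1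
    have h2 : ContinuousAt (fun z => f (e j) (σ j * z)) z :=
      ContinuousAt.comp (f := fun z => σ j * z) h1 (by fun_prop)
    simpa using h2
  | succ k ih =>
    -- Differentiation lowers by one both the power of `σ` and the order of vanishing, so the
    -- induction hypothesis applies to the derivatives.
    have hd : ∀ j, ∀ z ∈ {z | σ j * z ∈ J (e j) ∧ z ∈ Ioo (-B) B},
        HasDerivAt (fun z => f (e j) (σ j * z) / σ j ^ (k + 1))
          (_root_.deriv (f (e j)) (σ j * z) / σ j ^ k) z := by
      intro j z hz
      have h1 : HasDerivAt (fun z => σ j * z) (σ j) z := by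
        simpa using (hasDerivAt_id z).const_mul (σ j)
      refine ((HasDerivAt.comp z (hf.hasDerivAt hz.1) h1).div_const _).congr_deriv ?_
      have := (hσ j).ne'
      field_simp
      ring
    have h1 := ih hf.deriv (fun m hm i => by
      have := h0 (m + 1) (by omega) i
      rwa [iteratedDeriv_succ'] at this)
    refine of_hasDerivAt hs ?_ hd h1
    obtain ⟨M, hM0, hM⟩ := h1.bdd_pos
    refine ⟨M * B, fun j z hz => ?_⟩
    have hB : 0 < B := by linarith [hz.2.1, hz.2.2]
    -- The function vanishes at 0, so on a convex set the mean value inequality converts the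
    -- derivative bound into a bound for the function itself, free of `σ`.
    have hconv : Convex ℝ {z | σ j * z ∈ J (e j) ∧ z ∈ Ioo (-B) B} := by
      refine OrdConnected.convex ⟨fun x hx y hy z hz => ⟨?_, ?_⟩⟩
      · exact (hJc (e j)).out hx.1 hy.1
          ⟨mul_le_mul_of_nonneg_left hz.1 (hσ j).le, mul_le_mul_of_nonneg_left hz.2 (hσ j).le⟩
      · exact ⟨hx.2.1.trans_le hz.1, hz.2.trans_lt hy.2.2⟩
    have h00 : (0 : ℝ) ∈ {z | σ j * z ∈ J (e j) ∧ z ∈ Ioo (-B) B} :=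
      ⟨by simpa using hJ0 (e j), by simpa using hB⟩
    have := hconv.norm_image_sub_le_of_norm_hasDerivWithin_le
      (fun x hx => (hd j x hx).hasDerivWithinAt) (fun x hx => hM j x hx) h00 hz
    have hf0 : f (e j) 0 = 0 := by simpa using h0 0 (by omega) (e j)
    simp only [mul_zero, hf0, zero_div, sub_zero, Real.norm_eq_abs] at this
    refine this.trans (mul_le_mul_of_nonneg_left ?_ hM0.le)
    exact (abs_lt.2 ⟨hz.2.1, hz.2.2⟩).le

/-- A family is uniformly `C^k` if it is locally a bounded rescaling of a uniformly `C^k` family. -/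
theorem of_rescale {t : κ → Set ℝ} (ht : ∀ j, IsOpen (t j))
    {F : κ → ℝ → ℝ} (hF : UnifC k t F) (e : κ → ι) {σ : κ → ℝ} {B : ℝ} (hσ : ∀ j, 0 < σ j)
    (hB : ∀ j, σ j ≤ B) (hcov : ∀ i, ∀ x ∈ s i, ∃ j, e j = i ∧ x / σ j ∈ t j)
    (hfF : ∀ j, ∀ z ∈ t j, f (e j) (σ j * z) = σ j ^ k * F j z) : UnifC k s f := by
  -- By the chain rule the derivative of order `n` of `f` is `σ^(k-n)` times that of `F`; since `n ≤
  -- k` and `σ ≤ B`, no negative power of the scale ever occurs.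
  have hb : ∀ {k : ℕ} {f : ι → ℝ → ℝ} {F : κ → ℝ → ℝ}, UnifC k t F →
      (∀ j, ∀ z ∈ t j, f (e j) (σ j * z) = σ j ^ k * F j z) →
      ∃ M, ∀ i, ∀ x ∈ s i, |f i x| ≤ M := by
    intro k f F hF hfF
    obtain ⟨M, hM0, hM⟩ := hF.bdd_pos
    refine ⟨B ^ k * M, fun i x hx => ?_⟩
    obtain ⟨j, rfl, hj⟩ := hcov i x hx
    have h1 := hfF j _ hj
    rw [mul_div_cancel₀ _ (hσ j).ne'] at h1
    rw [h1, abs_mul, abs_pow, abs_of_pos (hσ j)]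
    exact mul_le_mul (pow_le_pow_left₀ (hσ j).le (hB j) _) (hM j _ hj) (abs_nonneg _)
      (pow_nonneg ((hσ j).le.trans (hB j)) _)
  have key : ∀ {k : ℕ} {f : ι → ℝ → ℝ} {F : κ → ℝ → ℝ},
      (∀ j, ∀ z ∈ t j, f (e j) (σ j * z) = σ j ^ k * F j z) → ∀ j, ∀ z ∈ t j,
      f (e j) =ᶠ[𝓝 (σ j * z)] fun x => σ j ^ k * F j (x / σ j) := by
    intro k f F hfF j z hz
    have h1 : Tendsto (fun x => x / σ j) (𝓝 (σ j * z)) (𝓝 z) := by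
      have : ContinuousAt (fun x => x / σ j) (σ j * z) := by fun_prop
      unfold ContinuousAt at this
      beta_reduce at this
      rwa [mul_div_cancel_left₀ _ (hσ j).ne'] at this
    filter_upwards [h1.eventually ((ht j).mem_nhds hz)] with x hx
    rw [← hfF j _ hx, mul_div_cancel₀ _ (hσ j).ne']
  induction k generalizing f F with
  | zero =>
    refine ⟨hb hF hfF, fun i x hx => ?_⟩
    obtain ⟨j, rfl, hj⟩ := hcov i x hx
    have h2 := key hfF j _ hj
    rw [mul_div_cancel₀ _ (hσ j).ne'] at h2
    refine ContinuousAt.congr ?_ h2.symm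
    have h3 : ContinuousAt (F j) (x / σ j) := hF.continuousAt hj
    have h4 : ContinuousAt (fun x => F j (x / σ j)) x :=
      ContinuousAt.comp (f := fun x => x / σ j) h3 (by fun_prop)
    exact h4.const_mul _
  | succ k ih =>
    have hd : ∀ j, ∀ z ∈ t j,
        HasDerivAt (f (e j)) (σ j ^ k * _root_.deriv (F j) z) (σ j * z) := by
      intro j z hz
      refine HasDerivAt.congr_of_eventuallyEq ?_ (key hfF j z hz)
      have h1 : HasDerivAt (fun x => x / σ j) (1 / σ j) (σ j * z) := (hasDerivAt_id _).div_const _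
      have h2 : HasDerivAt (F j) (_root_.deriv (F j) z) (σ j * z / σ j) := by
        rw [mul_div_cancel_left₀ _ (hσ j).ne']; exact hF.hasDerivAt hz
      refine ((HasDerivAt.comp (σ j * z) h2 h1).const_mul (σ j ^ (k + 1))).congr_deriv ?_
      have := (hσ j).ne'
      field_simp
      ring
    refine ⟨hb hF hfF, fun i x hx => ?_, ih hF.deriv fun j z hz => (hd j z hz).deriv⟩
    obtain ⟨j, rfl, hj⟩ := hcov i x hx
    have h2 := hd j _ hj
    rw [mul_div_cancel₀ _ (hσ j).ne'] at h2
    exact h2.differentiableAt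

end UnifC

/-! ### The quotient on the side of the right turning point -/

/-- For `u > -a`, the quotient of `∫_a^u √|s² - a²| q(s) ds` by `(u² - a²) √|u² - a²|`. -/
noncomputable def kPlus (a : ℝ) (q : ℝ → ℝ) (u : ℝ) : ℝ :=
  (u + a)⁻¹ * (√(u + a))⁻¹ * ∫ τ in (0 : ℝ)..1, √τ * √(2 * a + τ * (u - a)) * q (a + τ * (u - a))

/-- Homogeneity: the weight `√|s² - a²| ds` and the divisor differ by one power of length, so a
density vanishing to third order yields a quotient of order two. This is what limits the quotient to
`C²` bounds here. -/
theorem kPlus_rescale {σ α : ℝ} (hσ : 0 < σ) (q : ℝ → ℝ) (v : ℝ) :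
    kPlus (σ * α) q (σ * v) = σ ^ 2 * kPlus α (fun z => q (σ * z) / σ ^ 3) v := by
  have h1 : ∀ τ : ℝ, √τ * √(2 * (σ * α) + τ * (σ * v - σ * α)) *
      q (σ * α + τ * (σ * v - σ * α)) = (√σ * σ ^ 3) *
      (√τ * √(2 * α + τ * (v - α)) * (q (σ * (α + τ * (v - α))) / σ ^ 3)) := by
    intro τ
    have e1 : 2 * (σ * α) + τ * (σ * v - σ * α) = σ * (2 * α + τ * (v - α)) := by ring
    have e2 : σ * α + τ * (σ * v - σ * α) = σ * (α + τ * (v - α)) := by ring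
    rw [e1, e2, Real.sqrt_mul hσ.le]
    field_simp
  unfold kPlus
  simp_rw [h1]
  rw [intervalIntegral.integral_const_mul, ← mul_add, Real.sqrt_mul hσ.le, mul_inv, mul_inv]
  have := (Real.sqrt_pos.2 hσ).ne'
  generalize (∫ τ in (0 : ℝ)..1,
    √τ * √(2 * α + τ * (v - α)) * (q (σ * (α + τ * (v - α))) / σ ^ 3)) = I
  field_simp

/-- Substitute `s = a + τ (u - a)`. The factor `(u - a) √|u - a|` splits off and cancels, so that
`kPlus` is regular at `u = a` and singular only at `u = -a`. -/
theorem integral_sqrt_mul_eq_kPlus {a u : ℝ} (hu : -a < u) (ha : 0 < a) (q : ℝ → ℝ) :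
    ∫ s in a..u, √|s ^ 2 - a ^ 2| * q s =
      (u ^ 2 - a ^ 2) * √|u ^ 2 - a ^ 2| * kPlus a q u := by
  have h1 := intervalIntegral.smul_integral_comp_mul_add (a := 0) (b := 1)
    (fun s => √|s ^ 2 - a ^ 2| * q s) (u - a) a
  simp only [mul_zero, zero_add, mul_one, sub_add_cancel, smul_eq_mul] at h1
  rw [← h1]
  have h2 : ∫ τ in (0 : ℝ)..1, √|((u - a) * τ + a) ^ 2 - a ^ 2| * q ((u - a) * τ + a) =
      ∫ τ in (0 : ℝ)..1, √|u - a| * (√τ * √(2 * a + τ * (u - a)) * q (a + τ * (u - a))) := by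
    refine intervalIntegral.integral_congr fun τ hτ => ?_
    rw [uIcc_of_le zero_le_one] at hτ
    have e1 : ((u - a) * τ + a) ^ 2 - a ^ 2 = (u - a) * (τ * (2 * a + τ * (u - a))) := by ring
    have e2 : 0 ≤ 2 * a + τ * (u - a) := by nlinarith [hτ.1, hτ.2]
    have e3 : (u - a) * τ + a = a + τ * (u - a) := by ring
    rw [e1, e3, abs_mul, abs_of_nonneg (mul_nonneg hτ.1 e2), Real.sqrt_mul (abs_nonneg _),
      Real.sqrt_mul hτ.1]
    ring
  rw [h2, intervalIntegral.integral_const_mul, kPlus]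
  have h3 : 0 < u + a := by linarith
  have e4 : u ^ 2 - a ^ 2 = (u - a) * (u + a) := by ring
  rw [e4, abs_mul, Real.sqrt_mul (abs_nonneg _), abs_of_pos h3]
  have := (Real.sqrt_pos.2 h3).ne'
  field_simp

/-- The bounds must survive `a → 0`, where both `a` and `u + a` may be small. Around each point `u`
one rescales by `σ = u + a`: there `kPlus` is a regular expression on an interval of fixed size, and
the cubic vanishing of `R` together with `c = O(a³)` compensates the scaling. -/
theorem kPlus_unifC {ι : Type*} {a c : ι → ℝ} {J : ι → Set ℝ} {R : ι → ℝ → ℝ} {B M : ℝ}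
    (ha : ∀ i, 0 < a i) (hJ : ∀ i, IsOpen (J i)) (hJc : ∀ i, OrdConnected (J i))
    (hJB : ∀ i, ∀ x ∈ J i, |x| ≤ B) (haJ : ∀ i, a i ∈ J i) (hJ0 : ∀ i, 0 ∈ J i)
    (hR : UnifC 3 J R) (hR0 : ∀ m < 3, ∀ i, iteratedDeriv m (R i) 0 = 0)
    (hc : ∀ i, |c i| ≤ M * a i ^ 3) :
    UnifC 2 (fun i => J i ∩ Ioi (-(a i / 2)))
      (fun i => kPlus (a i) (fun s => R i s - c i)) := by
  -- The new index includes the point itself, so that each point carries its own scale `σ`.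
  let κ := {p : ι × ℝ // p.2 ∈ J p.1 ∩ Ioi (-(a p.1 / 2))}
  let e : κ → ι := fun j => j.1.1
  let σ : κ → ℝ := fun j => j.1.2 + a (e j)
  let α : κ → ℝ := fun j => a (e j) / σ j
  have hσa : ∀ j, a (e j) / 2 < σ j := fun j => by
    have : -(a j.1.1 / 2) < j.1.2 := j.2.2
    simp only [σ, e]; linarith
  have hσ : ∀ j, 0 < σ j := fun j => by linarith [hσa j, ha (e j)]
  have hα0 : ∀ j, 0 < α j := fun j => div_pos (ha _) (hσ j)
  have hα2 : ∀ j, α j < 2 := fun j => by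
    rw [div_lt_iff₀ (hσ j)]; linarith [hσa j]
  have haσ : ∀ j, σ j * α j = a (e j) := fun j => mul_div_cancel₀ _ (hσ j).ne'
  have hσB : ∀ j, σ j ≤ 2 * B := fun j => by
    have h1 := (le_abs_self _).trans (hJB _ _ j.2.1)
    have h2 := (le_abs_self _).trans (hJB _ _ (haJ (e j)))
    simp only [σ]; linarith
  -- In rescaled variables the point sits at `v = 1 - α`; on this interval `v + α` stays in `(1/2,
  -- 3/2)`, away from the singularity of `kPlus α`.
  let t : κ → Set ℝ := fun j => {v | σ j * v ∈ J (e j) ∧ v ∈ Ioo (1 / 2 - α j) (3 / 2 - α j)}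
  have ht : ∀ j, IsOpen (t j) := fun j =>
    ((hJ (e j)).preimage (by fun_prop)).inter isOpen_Ioo
  have htb : ∀ j, ∀ v ∈ t j, |v| ≤ 2 := fun j v hv => by
    rw [abs_le]; constructor <;> linarith [hv.2.1, hv.2.2, hα0 j, hα2 j]
  let qh : κ → ℝ → ℝ := fun j z => R (e j) (σ j * z) / σ j ^ 3 - c (e j) / σ j ^ 3
  have htr : ∀ j, IsOpen {z | σ j * z ∈ J (e j) ∧ z ∈ Ioo (-3) 3} := fun j =>
    ((hJ (e j)).preimage (by fun_prop)).inter isOpen_Ioo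
  have hqh : UnifC 2 (fun j => {z | σ j * z ∈ J (e j) ∧ z ∈ Ioo (-3) 3}) qh := by
    refine ((hR.rescale hJ hJc hJ0 hR0 e hσ (B := 3)).of_succ).sub htr
      (UnifC.const htr (M := |M| * 8) fun j => ?_)
    rw [abs_div, abs_of_pos (pow_pos (hσ j) 3), div_le_iff₀ (pow_pos (hσ j) 3)]
    have h1 : a (e j) ^ 3 ≤ 8 * σ j ^ 3 := by
      have : a (e j) ≤ 2 * σ j := by linarith [hσa j]
      calc a (e j) ^ 3 ≤ (2 * σ j) ^ 3 := pow_le_pow_left₀ (ha _).le this _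
        _ = _ := by ring
    calc |c (e j)| ≤ M * a (e j) ^ 3 := hc _
      _ ≤ |M| * a (e j) ^ 3 := mul_le_mul_of_nonneg_right (le_abs_self _) (pow_pos (ha _) 3).le
      _ ≤ |M| * (8 * σ j ^ 3) := mul_le_mul_of_nonneg_left h1 (abs_nonneg _)
      _ = _ := by ring
  have hseg : ∀ j, ∀ v ∈ t j, ∀ τ ∈ Icc (0 : ℝ) 1,
      α j + τ * (v - α j) ∈ {z | σ j * z ∈ J (e j) ∧ z ∈ Ioo (-3) 3} := by
    intro j v hv τ hτ
    constructor
    · have h1 : σ j * (α j + τ * (v - α j)) = (1 - τ) * a (e j) + τ * (σ j * v) := by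
        rw [← haσ]; ring
      rw [mem_ofPred_eq] at *
      rw [h1]
      exact (hJc (e j)).convex (haJ (e j)) hv.1 (by linarith [hτ.2]) hτ.1 (by ring)
    · have h2 := abs_le.1 (htb j v hv)
      have h0 := hα0 j
      have h3 := hα2 j
      have h4 : α j + τ * (v - α j) = (1 - τ) * α j + τ * v := by ring
      rw [h4]
      constructor <;> nlinarith [hτ.1, hτ.2]
  have hF : UnifC 2 t (fun j => kPlus (α j) (qh j)) := by
    have hva : ∀ j, ∀ v ∈ t j, 1 / 2 ≤ v + α j := fun j v hv => by linarith [hv.2.1]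
    have h1 : UnifC 2 t (fun j v => v + α j) :=
      (UnifC.id ht htb).add ht (UnifC.const ht (M := 2) fun j => by
        rw [abs_of_pos (hα0 j)]; exact (hα2 j).le)
    refine ((h1.inv ht (by norm_num) hva).mul ht ((h1.sqrt ht (by norm_num) hva).inv ht
      (m := √(1 / 2)) (by positivity) fun j v hv => Real.sqrt_le_sqrt (hva j v hv))).mul ht ?_
    have ho := UnifC.isOpen_withUnit ht
    refine UnifC.integral ht (G := fun j v => √j.2 * √(2 * α j.1 + j.2 * (v - α j.1)) *
      qh j.1 (α j.1 + j.2 * (v - α j.1))) ?_ ?_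
    · have hb' : ∀ q : κ × ℝ, ∀ x ∈ UnifC.withUnit t q, |x| ≤ 2 := fun q x hx => htb _ _ hx.1
      -- The variable `τ` is clamped to `[0, 1]` because `UnifC.const` asks for a bound at every
      -- index, including those whose set is empty.
      let w : κ × ℝ → ℝ := fun q => min 1 (max 0 q.2)
      have hw : ∀ q, w q ∈ Icc (0 : ℝ) 1 := fun q =>
        ⟨le_min zero_le_one (le_max_left _ _), min_le_left _ _⟩
      have hwq : ∀ q x, x ∈ UnifC.withUnit t q → w q = q.2 := fun q x hx => by
        simp only [w]; rw [max_eq_right hx.2.1.le, min_eq_right hx.2.2.le]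
      -- The radicand `2α + τ(v - α)` has no uniform positive lower bound. Its value `d` at `v = 1 -
      -- α` is factored out; the remaining factor lies between `1/2` and `3/2`, where the square
      -- root is smooth.
      let d : κ × ℝ → ℝ := fun q => 2 * α q.1 * (1 - w q) + w q
      have hd : ∀ q, 0 ≤ d q := fun q => by
        have := hw q; have := hα0 q.1; simp only [d]; nlinarith [this, (hw q).1, (hw q).2]
      have hwd : ∀ q, w q ≤ d q := fun q => by
        have := hw q; have := hα0 q.1; simp only [d]; nlinarith [this, (hw q).1, (hw q).2]
      have hd5 : ∀ q, d q ≤ 5 := fun q => by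
        have h2 := hα2 q.1; have := hα0 q.1; simp only [d]; nlinarith [this, (hw q).1, (hw q).2]
      have hk : ∀ q, |w q / d q| ≤ 1 := fun q => by
        rw [abs_of_nonneg (div_nonneg (hw q).1 (hd q))]
        exact div_le_one_of_le₀ (hwd q) (hd q)
      have g1 : UnifC 2 (UnifC.withUnit t)
          (fun q v => 1 + (w q / d q) * (v + α q.1 - 1)) :=
        (UnifC.const' ho 1).add ho ((UnifC.const ho hk).mul ho ((h1.fst).sub ho (UnifC.const' ho 1)))
      have g2 := g1.sqrt ho (m := 1 / 2) (by norm_num) (fun q v hv => by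
        have h3 := hv.1.2
        have h4 : |(w q / d q) * (v + α q.1 - 1)| ≤ 1 * (1 / 2) := by
          rw [abs_mul]
          refine mul_le_mul (hk q) ?_ (abs_nonneg _) zero_le_one
          rw [abs_le]; constructor <;> linarith [h3.1, h3.2]
        linarith [(abs_le.1 h4).1])
      have g3 : UnifC 2 (UnifC.withUnit t) (fun q v => α q.1 * (1 - w q) + w q * v) := by
        refine UnifC.affine ho hb' (M := 2) (N := 1) (fun q => ?_) (fun q => ?_)
        · have := hα2 q.1; have := hα0 q.1
          rw [abs_le]; constructor <;> nlinarith [(hw q).1, (hw q).2]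
        · rw [abs_le]; constructor <;> linarith [(hw q).1, (hw q).2]
      have g4 : UnifC 2 (UnifC.withUnit t) (fun q v => qh q.1 (α q.1 * (1 - w q) + w q * v)) := by
        refine UnifC.comp ho (hqh.reindex Prod.fst) g3 fun q v hv => ?_
        have := hseg q.1 v hv.1 (w q) (hw q)
        convert this using 1
        ring
      have g5 : UnifC 2 (UnifC.withUnit t) (fun q _ => √(w q) * √(d q)) :=
        UnifC.const ho (M := √1 * √5) fun q => by
          rw [abs_of_nonneg (by positivity)]
          exact mul_le_mul (Real.sqrt_le_sqrt (hw q).2) (Real.sqrt_le_sqrt (hd5 q))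
            (Real.sqrt_nonneg _) (Real.sqrt_nonneg _)
      refine ((g5.mul ho g2).mul ho g4).congr ho fun q v hv => ?_
      have hq := hwq q v hv
      have hd0 : 0 < d q := lt_of_lt_of_le (by rw [hq]; exact hv.2.1) (hwd q)
      have e1 : 2 * α q.1 + q.2 * (v - α q.1) = d q * (1 + (w q / d q) * (v + α q.1 - 1)) := by
        have : d q * (1 + (w q / d q) * (v + α q.1 - 1)) = d q + w q * (v + α q.1 - 1) := by
          field_simp
        rw [this, ← hq]; simp only [d]; ring
      have e2 : α q.1 + q.2 * (v - α q.1) = α q.1 * (1 - w q) + w q * v := by rw [hq]; ring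
      rw [e1, e2, Real.sqrt_mul hd0.le, ← hq]
      ring
    · intro j v hv
      refine ContinuousOn.aestronglyMeasurable ?_ measurableSet_uIoc
      have h5 : ContinuousOn (fun τ => qh j (α j + τ * (v - α j))) (uIoc (0 : ℝ) 1) := by
        intro τ hτ
        rw [uIoc_of_le zero_le_one] at hτ
        have h6 : ContinuousAt (qh j) (α j + τ * (v - α j)) :=
          hqh.continuousAt (hseg j v hv τ (Ioc_subset_Icc_self hτ))
        exact (ContinuousAt.comp (f := fun τ => α j + τ * (v - α j)) h6
          (by fun_prop)).continuousWithinAt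
      have h7 : Continuous (fun τ => √τ * √(2 * α j + τ * (v - α j))) := by fun_prop
      exact h7.continuousOn.mul h5
  refine UnifC.of_rescale ht hF e hσ hσB ?_ ?_
  · intro i x hx
    refine ⟨⟨(i, x), hx⟩, rfl, ?_⟩
    set j : κ := ⟨(i, x), hx⟩
    have h1 : x / σ j = 1 - α j := by
      have := (hσ j).ne'
      simp only [α]
      rw [eq_sub_iff_add_eq, ← add_div, div_eq_one_iff_eq this]
    refine ⟨?_, ?_⟩
    · rw [mul_div_cancel₀ _ (hσ j).ne']; exact hx.1
    · rw [h1]; constructor <;> linarith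
  · intro j v _
    have := kPlus_rescale (hσ j) (α := α j) (fun s => R (e j) s - c (e j)) v
    rw [haσ] at this
    rw [this]
    congr 2
    funext z
    exact sub_div _ _ _

end Weber

/-! ### Semicircle averages and the quotient across both turning points -/

namespace Weber

theorem hasDerivAt_mul_sqrt_abs (t : ℝ) :
    HasDerivAt (fun t : ℝ => t * √|t|) (3 / 2 * √|t|) t := by
  refine hasDerivAt_of_hasDerivAt_of_ne' (x := 0) (g := fun t => 3 / 2 * √|t|)
    (fun y hy => ?_) (by fun_prop) (by fun_prop) t
  have h1 := ((hasDerivAt_id y).mul ((hasDerivAt_abs hy).sqrt (abs_ne_zero.2 hy)))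
  refine h1.congr_deriv ?_
  have h2 : 0 < √|y| := Real.sqrt_pos.2 (abs_pos.2 hy)
  have h3 : y * (SignType.sign y : ℝ) = √|y| ^ 2 := by
    rw [Real.sq_sqrt (abs_nonneg _), mul_comm, sign_mul_self]
  simp only [_root_.id]
  field_simp
  rw [h3]; ring

theorem hasDerivAt_sq_sub_mul_sqrt (a u : ℝ) :
    HasDerivAt (fun u : ℝ => (u ^ 2 - a ^ 2) * √|u ^ 2 - a ^ 2|)
      (3 * u * √|u ^ 2 - a ^ 2|) u := by
  have h1 : HasDerivAt (fun u : ℝ => u ^ 2 - a ^ 2) (2 * u) u := by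
    simpa using (hasDerivAt_pow 2 u).sub_const (a ^ 2)
  refine ((hasDerivAt_mul_sqrt_abs (u ^ 2 - a ^ 2)).comp u h1).congr_deriv ?_
  ring

/-- The constant `a²/4` is the second moment of the semicircle law on `[-a, a]`. It makes the
polynomial mean-free, which is why the integral has the full factor `(u² - a²) √|u² - a²|` with a
polynomial quotient. -/
theorem integral_sqrt_mul_poly (a u p q : ℝ) :
    ∫ s in a..u, √|s ^ 2 - a ^ 2| * (p * s + q * (s ^ 2 - a ^ 2 / 4)) =
      (u ^ 2 - a ^ 2) * √|u ^ 2 - a ^ 2| * (p / 3 + q * u / 4) := by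
  rw [intervalIntegral.integral_eq_sub_of_hasDerivAt
    (f := fun u => (u ^ 2 - a ^ 2) * √|u ^ 2 - a ^ 2| * (p / 3 + q * u / 4))]
  · simp
  · intro x _
    have h1 : HasDerivAt (fun u : ℝ => p / 3 + q * u / 4) (q / 4) x := by
      simpa using (((hasDerivAt_id x).const_mul q).div_const 4).const_add (p / 3)
    refine ((hasDerivAt_sq_sub_mul_sqrt a x).mul h1).congr_deriv ?_
    ring
  · exact Continuous.intervalIntegrable (by fun_prop) _ _

theorem integral_sqrt_abs_sq_sub {a : ℝ} (ha : 0 < a) :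
    ∫ s in (-a)..a, √|s ^ 2 - a ^ 2| = Real.pi * a ^ 2 / 2 := by
  have h1 := intervalIntegral.smul_integral_comp_mul_left (a := -1) (b := 1)
    (fun s => √|s ^ 2 - a ^ 2|) a
  simp only [mul_neg, mul_one, smul_eq_mul] at h1
  rw [← h1]
  have h2 : ∫ x in (-1 : ℝ)..1, √|(a * x) ^ 2 - a ^ 2| = ∫ x in (-1 : ℝ)..1, a * √(1 - x ^ 2) := by
    refine intervalIntegral.integral_congr fun x hx => ?_
    rw [uIcc_of_le (by norm_num)] at hx
    have e1 : (a * x) ^ 2 - a ^ 2 = -(a ^ 2 * (1 - x ^ 2)) := by ring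
    have e2 : 0 ≤ 1 - x ^ 2 := by nlinarith [hx.1, hx.2]
    rw [e1, abs_neg, abs_of_nonneg (by positivity), Real.sqrt_mul (by positivity),
      Real.sqrt_sq ha.le]
  rw [h2, intervalIntegral.integral_const_mul, integral_sqrt_one_sub_sq]
  ring

theorem hasDerivAt_integral_of_continuousOn {f : ℝ → ℝ} {J : Set ℝ} (hJ : IsOpen J)
    (hJc : OrdConnected J) (hf : ContinuousOn f J) {a u : ℝ} (ha : a ∈ J) (hu : u ∈ J) :
    HasDerivAt (fun u => ∫ s in a..u, f s) (f u) u :=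
  intervalIntegral.integral_hasDerivAt_right
    ((hf.mono (hJc.uIcc_subset ha hu)).intervalIntegrable)
    (hf.stronglyMeasurableAtFilter hJ u hu) (hf.continuousAt (hJ.mem_nhds hu))

/-- The mean of `φ` over `[-a, a]` with respect to the semicircle law. -/
noncomputable def semiMean (a : ℝ) (φ : ℝ → ℝ) : ℝ :=
  2 / (Real.pi * a ^ 2) * ∫ s in (-a)..a, √|s ^ 2 - a ^ 2| * φ s

theorem integral_sqrt_mul_sub_semiMean {a : ℝ} (ha : 0 < a) {φ : ℝ → ℝ}
    (hφ : ContinuousOn φ (Icc (-a) a)) :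
    ∫ s in (-a)..a, √|s ^ 2 - a ^ 2| * (φ s - semiMean a φ) = 0 := by
  simp_rw [mul_sub]
  rw [intervalIntegral.integral_sub, intervalIntegral.integral_mul_const,
    integral_sqrt_abs_sq_sub ha, semiMean]
  · have := Real.pi_pos
    field_simp
    ring
  · refine ContinuousOn.intervalIntegrable ?_
    rw [uIcc_of_le (by linarith)]
    exact (by fun_prop : Continuous fun s : ℝ => √|s ^ 2 - a ^ 2|).continuousOn.mul hφ
  · exact Continuous.intervalIntegrable (by fun_prop) _ _

theorem abs_semiMean_le {a M : ℝ} (ha : 0 < a) {φ : ℝ → ℝ} (hφ : ∀ s ∈ Icc (-a) a, |φ s| ≤ M) :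
    |semiMean a φ| ≤ M := by
  have h1 : ‖∫ s in (-a)..a, √|s ^ 2 - a ^ 2| * φ s‖ ≤
      |∫ s in (-a)..a, √|s ^ 2 - a ^ 2| * M| := by
    refine intervalIntegral.norm_integral_le_abs_of_norm_le ?_
      (Continuous.intervalIntegrable (by fun_prop) _ _)
    refine (ae_restrict_iff' measurableSet_uIoc).2 (Eventually.of_forall fun s hs => ?_)
    rw [uIoc_of_le (by linarith)] at hs
    rw [norm_mul, Real.norm_of_nonneg (Real.sqrt_nonneg _)]
    exact mul_le_mul_of_nonneg_left (hφ s (Ioc_subset_Icc_self hs)) (Real.sqrt_nonneg _)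
  rw [intervalIntegral.integral_mul_const, integral_sqrt_abs_sq_sub ha] at h1
  have hM : 0 ≤ M := (abs_nonneg _).trans (hφ 0 ⟨by linarith, by linarith⟩)
  have hpi := Real.pi_pos
  rw [abs_of_nonneg (by positivity), Real.norm_eq_abs] at h1
  rw [semiMean, abs_mul, abs_of_pos (by positivity)]
  calc 2 / (Real.pi * a ^ 2) * |∫ s in (-a)..a, √|s ^ 2 - a ^ 2| * φ s|
      ≤ 2 / (Real.pi * a ^ 2) * (Real.pi * a ^ 2 / 2 * M) :=
        mul_le_mul_of_nonneg_left h1 (by positivity)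
    _ = M := by field_simp

theorem semiMean_mono {a : ℝ} (ha : 0 < a) {φ ψ : ℝ → ℝ} (hφ : ContinuousOn φ (Icc (-a) a))
    (hψ : ContinuousOn ψ (Icc (-a) a)) (h : ∀ s ∈ Icc (-a) a, φ s ≤ ψ s) :
    semiMean a φ ≤ semiMean a ψ := by
  have hpi := Real.pi_pos
  have hc : Continuous fun s : ℝ => √|s ^ 2 - a ^ 2| := by fun_prop
  refine mul_le_mul_of_nonneg_left ?_ (by positivity)
  refine intervalIntegral.integral_mono_on (by linarith) ?_ ?_ fun s hs =>
    mul_le_mul_of_nonneg_left (h s hs) (Real.sqrt_nonneg _)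
  · refine ContinuousOn.intervalIntegrable ?_
    rw [uIcc_of_le (by linarith)]
    exact hc.continuousOn.mul hφ
  · refine ContinuousOn.intervalIntegrable ?_
    rw [uIcc_of_le (by linarith)]
    exact hc.continuousOn.mul hψ

theorem semiMean_const {a : ℝ} (ha : 0 < a) (c : ℝ) : semiMean a (fun _ => c) = c := by
  have hpi := Real.pi_pos
  rw [semiMean, intervalIntegral.integral_mul_const, integral_sqrt_abs_sq_sub ha]
  field_simp

/-- As the integral over `[-a, a]` vanishes, the base point may be moved from `a` to `-a`; the
reflection `s ↦ -s` then reduces to the right turning point. -/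
theorem integral_sqrt_mul_eq_neg_kPlus {a u : ℝ} (hu : u < a) (ha : 0 < a) {q : ℝ → ℝ} {J : Set ℝ}
    (hJc : OrdConnected J) (haJ : a ∈ J) (haJ' : -a ∈ J) (huJ : u ∈ J) (hq : ContinuousOn q J)
    (h0 : ∫ s in (-a)..a, √|s ^ 2 - a ^ 2| * q s = 0) :
    ∫ s in a..u, √|s ^ 2 - a ^ 2| * q s =
      (u ^ 2 - a ^ 2) * √|u ^ 2 - a ^ 2| * (-kPlus a (fun s => q (-s)) (-u)) := by
  have hc : ContinuousOn (fun s => √|s ^ 2 - a ^ 2| * q s) J :=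
    (by fun_prop : Continuous fun s : ℝ => √|s ^ 2 - a ^ 2|).continuousOn.mul hq
  have hi : ∀ {x y}, x ∈ J → y ∈ J →
      IntervalIntegrable (fun s => √|s ^ 2 - a ^ 2| * q s) volume x y := fun hx hy =>
    (hc.mono (hJc.uIcc_subset hx hy)).intervalIntegrable
  have h1 := intervalIntegral.integral_add_adjacent_intervals (hi haJ' haJ) (hi haJ huJ)
  rw [h0, zero_add] at h1
  have h2 := integral_sqrt_mul_eq_kPlus (a := a) (u := -u) (by linarith) ha (fun s => q (-s))
  have h3 := intervalIntegral.integral_comp_neg (a := a) (b := -u)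
    (fun s => √|s ^ 2 - a ^ 2| * q s)
  simp only [neg_sq, neg_neg] at h2 h3
  rw [h2] at h3
  rw [h1, intervalIntegral.integral_symm, ← h3]
  ring

/-- The quadratic Taylor polynomial of `φ` contributes an explicit affine quotient. The cubic
remainder contributes `kPlus` for `u > -a/2` and its reflection for `u < a/2`; both represent the
same integral on the overlap, hence they glue. -/
theorem exists_quotient_unifC {ι : Type*} {a : ι → ℝ} {J : ι → Set ℝ} {φ : ι → ℝ → ℝ} {B : ℝ}
    (ha : ∀ i, 0 < a i) (hJ : ∀ i, IsOpen (J i)) (hJc : ∀ i, OrdConnected (J i))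
    (hJB : ∀ i, ∀ x ∈ J i, |x| ≤ B) (haJ : ∀ i, a i ∈ J i) (haJ' : ∀ i, -a i ∈ J i)
    (hφ : UnifC 3 J φ) :
    ∃ K : ι → ℝ → ℝ, UnifC 2 J K ∧ ∀ i, ∀ u ∈ J i,
      ∫ s in (a i)..u, √|s ^ 2 - a i ^ 2| * (φ i s - semiMean (a i) (φ i)) =
        (u ^ 2 - a i ^ 2) * √|u ^ 2 - a i ^ 2| * K i u := by
  have hJ0 : ∀ i, 0 ∈ J i := fun i =>
    (hJc i).out (haJ' i) (haJ i) ⟨by linarith [ha i], (ha i).le⟩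
  have haI : ∀ i, Icc (-a i) (a i) ⊆ J i := fun i => (hJc i).out (haJ' i) (haJ i)
  let p0 : ι → ℝ := fun i => φ i 0
  let p1 : ι → ℝ := fun i => deriv (φ i) 0
  let p2 : ι → ℝ := fun i => deriv (deriv (φ i)) 0 / 2
  let R : ι → ℝ → ℝ := fun i s => φ i s - (p0 i + p1 i * s + p2 i * (s * s))
  have hp0 : ∃ M, ∀ i, |p0 i| ≤ M := hφ.bdd.imp fun M h i => h i 0 (hJ0 i)
  have hp1 : ∃ M, ∀ i, |p1 i| ≤ M := hφ.deriv.bdd.imp fun M h i => h i 0 (hJ0 i)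
  have hp2 : ∃ M, ∀ i, |p2 i| ≤ M := by
    obtain ⟨M, h⟩ := hφ.deriv.deriv.bdd
    refine ⟨M / 2, fun i => ?_⟩
    simp only [p2, abs_div, Nat.abs_ofNat]
    linarith [h i 0 (hJ0 i)]
  obtain ⟨M0, hM0⟩ := hp0
  obtain ⟨M1, hM1⟩ := hp1
  obtain ⟨M2, hM2⟩ := hp2
  have hid : ∀ k, UnifC k J (fun _ x => x) := fun k => UnifC.id hJ hJB
  have hR : UnifC 3 J R := hφ.sub hJ ((UnifC.affine hJ hJB hM0 hM1).add hJ
    ((UnifC.const hJ hM2).mul hJ ((hid 3).mul hJ (hid 3))))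
  have hR1 : ∀ i, ∀ x ∈ J i, HasDerivAt (R i) (deriv (φ i) x - (p1 i + 2 * p2 i * x)) x := by
    intro i x hx
    refine ((hφ.hasDerivAt hx).sub ((((hasDerivAt_id x).const_mul (p1 i)).const_add (p0 i)).add
      (((hasDerivAt_id x).mul (hasDerivAt_id x)).const_mul (p2 i)))).congr_deriv ?_
    simp only [_root_.id]; ring
  have hR2 : ∀ i, ∀ x ∈ J i,
      HasDerivAt (deriv (R i)) (deriv (deriv (φ i)) x - 2 * p2 i) x := by
    intro i x hx
    have h1 : HasDerivAt (fun x => deriv (φ i) x - (p1 i + 2 * p2 i * x))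
        (deriv (deriv (φ i)) x - 2 * p2 i) x := by
      refine ((hφ.deriv.hasDerivAt hx).sub
        (((hasDerivAt_id x).const_mul (2 * p2 i)).const_add (p1 i))).congr_deriv ?_
      simp
    exact h1.congr_of_eventuallyEq
      (Filter.eventually_of_mem ((hJ i).mem_nhds hx) fun y hy => (hR1 i y hy).deriv)
  have hR0 : ∀ m < 3, ∀ i, iteratedDeriv m (R i) 0 = 0 := by
    intro m hm i
    interval_cases m
    · simp [R, p0]
    · rw [iteratedDeriv_one, (hR1 i 0 (hJ0 i)).deriv]; simp [p1]
    · rw [iteratedDeriv_succ, iteratedDeriv_one, (hR2 i 0 (hJ0 i)).deriv]; simp [p2]; ring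
  -- The part of the mean due to the remainder: the polynomial has mean `p0 + p2 a²/4`, the odd term
  -- contributing nothing.
  let cR : ι → ℝ := fun i => semiMean (a i) (φ i) - p0 i - p2 i * a i ^ 2 / 4
  have hq : ∀ i s, R i s - cR i = (φ i s - semiMean (a i) (φ i)) -
      (p1 i * s + p2 i * (s ^ 2 - a i ^ 2 / 4)) := fun i s => by simp only [R, cR]; ring
  have hwc : ∀ i, Continuous fun s : ℝ => √|s ^ 2 - a i ^ 2| := fun i => by fun_prop
  have hφc : ∀ i, ContinuousOn (fun s => √|s ^ 2 - a i ^ 2| * (φ i s - semiMean (a i) (φ i))) (J i) :=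
    fun i => (hwc i).continuousOn.mul ((hφ.continuousOn i).sub continuousOn_const)
  have hii : ∀ i, ∀ x ∈ J i, ∀ y ∈ J i, IntervalIntegrable
      (fun s => √|s ^ 2 - a i ^ 2| * (φ i s - semiMean (a i) (φ i))) volume x y :=
    fun i x hx y hy => ((hφc i).mono ((hJc i).uIcc_subset hx hy)).intervalIntegrable
  have hip : ∀ i x y, IntervalIntegrable
      (fun s => √|s ^ 2 - a i ^ 2| * (p1 i * s + p2 i * (s ^ 2 - a i ^ 2 / 4))) volume x y :=
    fun i x y => Continuous.intervalIntegrable (by fun_prop) _ _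
  have hsplit : ∀ i, ∀ x ∈ J i, ∀ y ∈ J i, ∫ s in x..y, √|s ^ 2 - a i ^ 2| * (R i s - cR i) =
      (∫ s in x..y, √|s ^ 2 - a i ^ 2| * (φ i s - semiMean (a i) (φ i))) -
      ∫ s in x..y, √|s ^ 2 - a i ^ 2| * (p1 i * s + p2 i * (s ^ 2 - a i ^ 2 / 4)) := by
    intro i x hx y hy
    rw [← intervalIntegral.integral_sub (hii i x hx y hy) (hip i x y)]
    refine intervalIntegral.integral_congr fun s _ => ?_
    rw [hq]; ring
  have hmean : ∀ i, ∫ s in (-a i)..(a i), √|s ^ 2 - a i ^ 2| * (R i s - cR i) = 0 := by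
    intro i
    rw [hsplit i _ (haJ' i) _ (haJ i), integral_sqrt_mul_sub_semiMean (ha i)
      ((hφ.continuousOn i).mono (haI i)), intervalIntegral.integral_symm, integral_sqrt_mul_poly]
    simp
  -- Evaluating the rescaled remainder at `z = s/|s|` with scale `σ = |s|` gives the cubic bound.
  have hRb : ∃ M, ∀ i, ∀ s ∈ J i, s ≠ 0 → |R i s| ≤ M * |s| ^ 3 := by
    have h1 := hR.rescale hJ hJc hJ0 hR0 (κ := {p : ι × ℝ // 0 < p.2}) (fun j => j.1.1)
      (σ := fun j => j.1.2) (fun j => j.2) (B := 2)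
    obtain ⟨M, hM⟩ := h1.bdd
    refine ⟨M, fun i s hs h0 => ?_⟩
    have hpos := abs_pos.2 h0
    have h3 : |s| * (s / |s|) = s := mul_div_cancel₀ _ hpos.ne'
    have h4 : |(s / (|s|))| = 1 := by rw [abs_div, abs_abs, div_self hpos.ne']
    have h2 := hM ⟨(i, |s|), hpos⟩ (s / |s|) ⟨by simpa only [h3] using hs, by
      have := abs_le.1 h4.le
      constructor <;> linarith [this.1, this.2]⟩
    simp only [h3] at h2
    rwa [abs_div, abs_of_pos (pow_pos hpos 3), div_le_iff₀ (pow_pos hpos 3)] at h2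
  have hcRm : ∀ i, cR i = semiMean (a i) (R i) := by
    intro i
    have hRc : ContinuousOn (R i) (Icc (-a i) (a i)) := (hR.continuousOn i).mono (haI i)
    have h1 := integral_sqrt_mul_sub_semiMean (ha i) hRc
    have h2 := hmean i
    have h3 : IntervalIntegrable (fun s => √|s ^ 2 - a i ^ 2| * R i s) volume (-a i) (a i) := by
      refine ContinuousOn.intervalIntegrable ?_
      rw [uIcc_of_le (by linarith [ha i])]
      exact (hwc i).continuousOn.mul hRc
    simp_rw [mul_sub] at h1 h2
    have h6 : ∀ c : ℝ, IntervalIntegrable (fun s => √|s ^ 2 - a i ^ 2| * c) volume (-a i) (a i) :=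
      fun c => Continuous.intervalIntegrable (by fun_prop) _ _
    rw [intervalIntegral.integral_sub h3 (h6 _), intervalIntegral.integral_mul_const, integral_sqrt_abs_sq_sub (ha i)] at h1 h2
    have h4 : 0 < Real.pi * a i ^ 2 / 2 := by have := ha i; have := Real.pi_pos; positivity
    have h5 : Real.pi * a i ^ 2 / 2 * cR i = Real.pi * a i ^ 2 / 2 * semiMean (a i) (R i) := by
      linarith
    exact mul_left_cancel₀ h4.ne' h5
  obtain ⟨M, hM⟩ := hRb
  -- An average over `[-a, a]` of a function bounded by a multiple of `|s|³` is `O(a³)`, the size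
  -- demanded by `kPlus_unifC`.
  have hcR : ∀ i, |cR i| ≤ |M| * a i ^ 3 := by
    intro i
    rw [hcRm]
    refine abs_semiMean_le (ha i) fun s hs => ?_
    have hs3 : |s| ^ 3 ≤ a i ^ 3 := pow_le_pow_left₀ (abs_nonneg _) (abs_le.2 hs) 3
    by_cases h0 : s = 0
    · have : R i s = 0 := by rw [h0]; simpa using hR0 0 (by norm_num) i
      rw [this, abs_zero]
      have := ha i
      positivity
    · exact (hM i s (haI i hs) h0).trans
        ((mul_le_mul_of_nonneg_right (le_abs_self M) (by positivity)).trans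
          (mul_le_mul_of_nonneg_left hs3 (abs_nonneg _)))
  have hKp := kPlus_unifC ha hJ hJc hJB haJ hJ0 hR hR0 hcR
  have hKm : UnifC 2 (fun i => J i ∩ Iio (a i / 2))
      (fun i u => -kPlus (a i) (fun s => R i (-s) - cR i) (-u)) := by
    have hJn : ∀ i, IsOpen {x | -x ∈ J i} := fun i => (hJ i).preimage continuous_neg
    have hnegJ : UnifC 3 (fun i => {x | -x ∈ J i}) (fun _ x => -x) :=
      (UnifC.id hJn (M := B) fun i x hx => by simpa using hJB i _ hx).neg hJn
    have hR' : UnifC 3 (fun i => {x | -x ∈ J i}) (fun i x => R i (-x)) :=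
      UnifC.comp hJn hR hnegJ fun i x hx => hx
    have h1 := kPlus_unifC (J := fun i => {x | -x ∈ J i}) (R := fun i x => R i (-x)) ha hJn
      (fun i => ⟨fun x hx y hy z hz => (hJc i).out hy hx ⟨neg_le_neg hz.2, neg_le_neg hz.1⟩⟩)
      (fun i x hx => by simpa using hJB i _ hx) haJ' (fun i => by simpa using hJ0 i) hR'
      (fun m hm i => by
        have := iteratedDeriv_comp_neg m (R i) 0
        rw [this]; simp [hR0 m hm i]) hcR
    have hop : ∀ i, IsOpen (J i ∩ Iio (a i / 2)) := fun i => (hJ i).inter isOpen_Iio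
    refine UnifC.neg hop (UnifC.comp hop h1
      ((UnifC.id hop (M := B) fun i x hx => hJB i x hx.1).neg hop) fun i x hx => ⟨?_, ?_⟩)
    · simpa using hx.1
    · have : x < a i / 2 := hx.2
      simp only [mem_Ioi]; linarith
  let K0 : ι → ℝ → ℝ := fun i u => if -(a i / 2) < u then kPlus (a i) (fun s => R i s - cR i) u
    else -kPlus (a i) (fun s => R i (-s) - cR i) (-u)
  have hqc : ∀ i, ContinuousOn (fun s => R i s - cR i) (J i) := fun i =>
    (hR.continuousOn i).sub continuousOn_const
  have hminus : ∀ i, ∀ u ∈ J i, u < a i → ∫ s in (a i)..u, √|s ^ 2 - a i ^ 2| * (R i s - cR i) =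
      (u ^ 2 - a i ^ 2) * √|u ^ 2 - a i ^ 2| * (-kPlus (a i) (fun s => R i (-s) - cR i) (-u)) :=
    fun i u hu h => integral_sqrt_mul_eq_neg_kPlus h (ha i) (hJc i) (haJ i) (haJ' i) hu (hqc i)
      (hmean i)
  have hK0 : UnifC 2 J K0 := by
    have h1 : UnifC 2 (fun i => J i ∩ Ioi (-(a i / 2))) K0 :=
      hKp.congr (fun i => (hJ i).inter isOpen_Ioi) fun i u hu => if_pos hu.2
    have h2 : UnifC 2 (fun i => J i ∩ Iio (a i / 2)) K0 := by
      refine hKm.congr (fun i => (hJ i).inter isOpen_Iio) fun i u hu => ?_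
      have hu2 : u < a i / 2 := hu.2
      have hai := ha i
      by_cases h : -(a i / 2) < u
      · simp only [K0, if_pos h]
        have e1 := hminus i u hu.1 (by linarith)
        rw [integral_sqrt_mul_eq_kPlus (by linarith) hai] at e1
        -- On the overlap `|u| < a/2` the common divisor is nonzero, so equality of the integrals
        -- forces equality of the quotients.
        have e2 : u ^ 2 - a i ^ 2 ≠ 0 := by nlinarith
        exact mul_left_cancel₀ (mul_ne_zero e2 (Real.sqrt_pos.2 (abs_pos.2 e2)).ne') e1
      · simp only [K0, if_neg h]
    refine (h1.union h2).mono fun i u hu => ?_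
    by_cases h : -(a i / 2) < u
    · exact Or.inl ⟨hu, h⟩
    · exact Or.inr ⟨hu, by simp only [mem_Iio]; linarith [ha i]⟩
  refine ⟨fun i u => (p1 i / 3 + p2 i / 4 * u) + K0 i u, ?_, fun i u hu => ?_⟩
  · refine (UnifC.affine hJ hJB (M := M1 / 3) (N := M2 / 4) (fun i => ?_) fun i => ?_).add hJ hK0
    · rw [abs_div, Nat.abs_ofNat]; linarith [hM1 i]
    · rw [abs_div, Nat.abs_ofNat]; linarith [hM2 i]
  · have h1 := hsplit i _ (haJ i) u hu
    have h2 : ∫ s in (a i)..u, √|s ^ 2 - a i ^ 2| * (R i s - cR i) =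
        (u ^ 2 - a i ^ 2) * √|u ^ 2 - a i ^ 2| * K0 i u := by
      by_cases h : -(a i / 2) < u
      · simp only [K0, if_pos h]
        exact integral_sqrt_mul_eq_kPlus (by linarith [ha i]) (ha i) _
      · simp only [K0, if_neg h]
        exact hminus i u hu (by linarith [ha i])
    rw [integral_sqrt_mul_poly, h2] at h1
    linear_combination -h1

end Weber

/-! ### The action integral and comparison at the turning points -/

namespace Weber

/-- The antiderivative of `√|s² - a²|` that vanishes at `a`. -/
noncomputable def actionInt (a y : ℝ) : ℝ := ∫ s in a..y, √|s ^ 2 - a ^ 2|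

theorem continuous_sqrt_abs_sq_sub (a : ℝ) : Continuous fun s : ℝ => √|s ^ 2 - a ^ 2| := by
  fun_prop

theorem intervalIntegrable_sqrt_abs_sq_sub (a x y : ℝ) :
    IntervalIntegrable (fun s : ℝ => √|s ^ 2 - a ^ 2|) volume x y :=
  (continuous_sqrt_abs_sq_sub a).intervalIntegrable x y

theorem hasDerivAt_actionInt (a y : ℝ) : HasDerivAt (actionInt a) (√|y ^ 2 - a ^ 2|) y :=
  intervalIntegral.integral_hasDerivAt_right (intervalIntegrable_sqrt_abs_sq_sub a a y)
    ((continuous_sqrt_abs_sq_sub a).stronglyMeasurableAtFilter _ _)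
    (continuous_sqrt_abs_sq_sub a).continuousAt

theorem continuous_actionInt (a : ℝ) : Continuous (actionInt a) :=
  continuous_iff_continuousAt.2 fun y => (hasDerivAt_actionInt a y).continuousAt

theorem actionInt_sub (a x y : ℝ) :
    actionInt a y - actionInt a x = ∫ s in x..y, √|s ^ 2 - a ^ 2| :=
  intervalIntegral.integral_interval_sub_left (intervalIntegrable_sqrt_abs_sq_sub a _ _)
    (intervalIntegrable_sqrt_abs_sq_sub a _ _)

theorem strictMono_actionInt (a : ℝ) : StrictMono (actionInt a) := by
  intro x y hxy
  rw [← sub_pos, actionInt_sub]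
  refine intervalIntegral.integral_pos hxy (continuous_sqrt_abs_sq_sub a).continuousOn
    (fun _ _ => Real.sqrt_nonneg _) ?_
  have key : ∀ s : ℝ, s ≠ a → s ≠ -a → 0 < √|s ^ 2 - a ^ 2| := by
    intro s h1 h2
    refine Real.sqrt_pos.2 (abs_pos.2 ?_)
    have : s ^ 2 - a ^ 2 = (s - a) * (s + a) := by ring
    rw [this]
    exact mul_ne_zero (sub_ne_zero.2 h1) (fun h => h2 (by linarith))
  -- Otherwise `x`, `y` and their midpoint would all lie in the two-point set `{a, -a}`.
  by_contra! hcon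
  have h3 : ∀ s ∈ Icc x y, s = a ∨ s = -a := fun s hs => by
    by_contra! h
    exact absurd (key s h.1 h.2) (not_lt.2 (hcon s hs))
  have e1 := h3 x ⟨le_rfl, hxy.le⟩
  have e2 := h3 y ⟨hxy.le, le_rfl⟩
  have e3 := h3 ((x + y) / 2) ⟨by linarith, by linarith⟩
  rcases e1 with e1 | e1 <;> rcases e2 with e2 | e2 <;> rcases e3 with e3 | e3 <;> linarith

theorem actionInt_self (a : ℝ) : actionInt a a = 0 := intervalIntegral.integral_same

theorem actionInt_neg_self {a : ℝ} (ha : 0 < a) : actionInt a (-a) = -(Real.pi * a ^ 2 / 2) := by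
  rw [actionInt, intervalIntegral.integral_symm, integral_sqrt_abs_sq_sub ha]

theorem actionInt_neg {a : ℝ} (ha : 0 < a) (y : ℝ) :
    actionInt a (-y) = -(Real.pi * a ^ 2 / 2) - actionInt a y := by
  have h1 := actionInt_sub a (-a) (-y)
  have h2 := intervalIntegral.integral_comp_neg (a := y) (b := a) (fun s => √|s ^ 2 - a ^ 2|)
  simp only [neg_sq] at h2
  rw [← h2, actionInt_neg_self ha] at h1
  have h3 : actionInt a y = -∫ s in y..a, √|s ^ 2 - a ^ 2| := intervalIntegral.integral_symm _ _
  linarith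

theorem tendsto_actionInt_atTop (a : ℝ) : Tendsto (actionInt a) atTop atTop := by
  have h1 : Tendsto (fun y : ℝ => (y - |a| - 1) + actionInt a (|a| + 1)) atTop atTop :=
    tendsto_atTop_add_const_right _ _ (tendsto_atTop_add_const_right _ _
      (tendsto_atTop_add_const_right _ _ tendsto_id))
  refine tendsto_atTop_mono' _ ?_ h1
  filter_upwards [eventually_ge_atTop (|a| + 1)] with y hy
  have h2 := actionInt_sub a (|a| + 1) y
  have h3 : ∫ _ in (|a| + 1)..y, (1 : ℝ) ≤ ∫ s in (|a| + 1)..y, √|s ^ 2 - a ^ 2| := by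
    refine intervalIntegral.integral_mono_on hy (by simp)
      (intervalIntegrable_sqrt_abs_sq_sub a _ _) fun s hs => ?_
    rw [Real.one_le_sqrt]
    have := abs_nonneg a
    refine le_trans ?_ (le_abs_self _)
    have : a ^ 2 = |a| ^ 2 := (sq_abs a).symm
    nlinarith [hs.1]
  simp at h3
  linarith

theorem surjective_actionInt {a : ℝ} (ha : 0 < a) : Function.Surjective (actionInt a) := by
  refine (continuous_actionInt a).surjective (tendsto_actionInt_atTop a) ?_
  have h1 : Tendsto (fun y => -(Real.pi * a ^ 2 / 2) - actionInt a (-y)) atBot atBot := by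
    have := (tendsto_actionInt_atTop a).comp tendsto_neg_atBot_atTop
    have h2 := tendsto_neg_atTop_atBot.comp this
    simpa [sub_eq_add_neg, Function.comp_def] using
      tendsto_atBot_add_const_left _ (-(Real.pi * a ^ 2 / 2)) h2
  refine h1.congr fun y => ?_
  rw [actionInt_neg ha]; ring

/-- `actionInt a` as an order isomorphism of the line. -/
noncomputable def actionIso {a : ℝ} (ha : 0 < a) : ℝ ≃o ℝ :=
  (strictMono_actionInt a).orderIsoOfSurjective _ (surjective_actionInt ha)

theorem actionInt_actionIso_symm {a : ℝ} (ha : 0 < a) (z : ℝ) :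
    actionInt a ((actionIso ha).symm z) = z := (actionIso ha).apply_symm_apply z

theorem eq_actionIso_symm {a : ℝ} (ha : 0 < a) {w z : ℝ} (h : actionInt a w = z) :
    w = (actionIso ha).symm z := by
  rw [← h]; exact ((actionIso ha).symm_apply_apply w).symm

theorem hasDerivAt_actionIso_symm {a : ℝ} (ha : 0 < a) {z : ℝ}
    (h : ((actionIso ha).symm z) ^ 2 - a ^ 2 ≠ 0) :
    HasDerivAt (actionIso ha).symm (√|((actionIso ha).symm z) ^ 2 - a ^ 2|)⁻¹ z :=
  HasDerivAt.of_local_left_inverse (actionIso ha).symm.continuous.continuousAt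
    (hasDerivAt_actionInt a _) (Real.sqrt_pos.2 (abs_pos.2 h)).ne'
    (Eventually.of_forall fun y => actionInt_actionIso_symm ha y)

theorem actionInt_eq_mul (a x : ℝ) :
    actionInt a (a + x) = x * ∫ τ in (0 : ℝ)..1, √|(a + τ * x) ^ 2 - a ^ 2| := by
  have h1 := intervalIntegral.smul_integral_comp_mul_add (a := 0) (b := 1)
    (fun s => √|s ^ 2 - a ^ 2|) x a
  simp only [mul_zero, zero_add, mul_one, smul_eq_mul] at h1
  rw [actionInt, add_comm a x, ← h1]
  congr 1
  refine intervalIntegral.integral_congr fun τ _ => ?_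
  rw [show x * τ + a = a + τ * x by ring]

/-- Since `x ≥ -a`, the path `a + τ x` stays in `[0, ∞)`, where `|s² - a²|` grows with the distance
from `a`; shrinking the path by `k` therefore decreases the integrand pointwise. -/
theorem integral_sqrt_scale_le {a x k : ℝ} (ha : 0 < a) (hx : -a ≤ x) (hk0 : 0 ≤ k) (hk1 : k ≤ 1) :
    ∫ τ in (0 : ℝ)..1, √|(a + τ * (k * x)) ^ 2 - a ^ 2| ≤
      ∫ τ in (0 : ℝ)..1, √|(a + τ * x) ^ 2 - a ^ 2| := by
  refine intervalIntegral.integral_mono_on zero_le_one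
    (Continuous.intervalIntegrable (by fun_prop) _ _)
    (Continuous.intervalIntegrable (by fun_prop) _ _) fun τ hτ => Real.sqrt_le_sqrt ?_
  have e1 : (a + τ * (k * x)) ^ 2 - a ^ 2 = k * (τ * x * (2 * a + k * (τ * x))) := by ring
  have e2 : (a + τ * x) ^ 2 - a ^ 2 = τ * x * (2 * a + τ * x) := by ring
  have h1 : -a ≤ τ * x := by nlinarith [hτ.1, hτ.2]
  rw [e1, e2, abs_mul, abs_mul (τ * x), abs_mul (τ * x), abs_of_nonneg hk0]
  have h2 : 0 ≤ 2 * a + k * (τ * x) := by nlinarith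
  have h3 : 0 ≤ 2 * a + τ * x := by linarith
  rw [abs_of_nonneg h2, abs_of_nonneg h3]
  have h4 : k * (2 * a + k * (τ * x)) ≤ 2 * a + τ * x := by
    have : 2 * a + τ * x - k * (2 * a + k * (τ * x)) =
      (1 - k) * (2 * a + (1 + k) * (τ * x)) := by ring
    have h5 : 0 ≤ 2 * a + (1 + k) * (τ * x) := by nlinarith
    nlinarith [mul_nonneg (sub_nonneg.2 hk1) h5]
  calc k * (|τ * x| * (2 * a + k * (τ * x))) = |τ * x| * (k * (2 * a + k * (τ * x))) := by ring
    _ ≤ |τ * x| * (2 * a + τ * x) := mul_le_mul_of_nonneg_left h4 (abs_nonneg _)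

theorem integral_mul_le_of_le {a x y c : ℝ} {φ : ℝ → ℝ} (hxy : x ≤ y)
    (hφ : ContinuousOn φ (Icc x y)) (h : ∀ s ∈ Icc x y, c ≤ φ s) :
    c * (∫ s in x..y, √|s ^ 2 - a ^ 2|) ≤ ∫ s in x..y, √|s ^ 2 - a ^ 2| * φ s := by
  rw [mul_comm, ← intervalIntegral.integral_mul_const]
  refine intervalIntegral.integral_mono_on hxy
    ((intervalIntegrable_sqrt_abs_sq_sub a _ _).mul_const c) ?_ fun s hs =>
      mul_le_mul_of_nonneg_left (h s hs) (Real.sqrt_nonneg _)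
  refine ContinuousOn.intervalIntegrable ?_
  rw [uIcc_of_le hxy]
  exact (continuous_sqrt_abs_sq_sub a).continuousOn.mul hφ

/-- Comparison of `w` with `u` near the right turning point. -/
theorem turning_comparison {a u w c m M : ℝ} {φ : ℝ → ℝ} (ha : 0 < a) (hu : -a < u) (hm : 0 < m)
    (hmM : m ≤ M) (hφ : ContinuousOn φ (uIcc a u)) (hφm : ∀ s ∈ uIcc a u, m ≤ φ s)
    (hc : 0 < c) (hcM : c ≤ M) (h : c * actionInt a w = ∫ s in a..u, √|s ^ 2 - a ^ 2| * φ s) :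
    (a ≤ u → a + m / M / 2 * (u - a) ≤ w) ∧ (u ≤ a → w ≤ a + m / M / 2 * (u - a)) := by
  have hM : 0 < M := hm.trans_le hmM
  set k := m / M with hk
  have hk0 : 0 < k := div_pos hm hM
  have hk1 : k ≤ 1 := (div_le_one hM).2 hmM
  have hkM : k * M = m := div_mul_cancel₀ _ hM.ne'
  -- The displacement is halved because only `u > -a` is known: the midpoint `(u + a)/2` of `a` and
  -- `u` is positive, as the scaling inequality requires. This is the origin of the factor `1/2` in
  -- the conclusion.
  have hI := integral_sqrt_scale_le (a := a) (x := (u - a) / 2) ha (by linarith) hk0.le hk1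
  have e1 := actionInt_eq_mul a ((u - a) / 2)
  have e2 := actionInt_eq_mul a (k * ((u - a) / 2))
  have e3 : a + k / 2 * (u - a) = a + k * ((u - a) / 2) := by ring
  constructor
  · intro hau
    rw [uIcc_of_le hau] at hφ hφm
    have h1 := integral_mul_le_of_le (a := a) hau hφ hφm
    rw [← h] at h1
    change m * actionInt a u ≤ _ at h1
    have h2 : actionInt a (a + (u - a) / 2) ≤ actionInt a u :=
      (strictMono_actionInt a).monotone (by linarith)
    have h3 : actionInt a (a + k * ((u - a) / 2)) ≤ k * actionInt a (a + (u - a) / 2) := by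
      rw [e1, e2]
      have := mul_le_mul_of_nonneg_left hI (mul_nonneg hk0.le (by linarith : 0 ≤ (u - a) / 2))
      linarith
    have h0 : 0 ≤ actionInt a u := by
      rw [← actionInt_self a]; exact (strictMono_actionInt a).monotone hau
    have h4 : 0 ≤ actionInt a w := by
      by_contra! hneg
      nlinarith
    have h5 : k * actionInt a u ≤ actionInt a w := by
      have : M * (k * actionInt a u) ≤ M * actionInt a w := by
        calc M * (k * actionInt a u) = m * actionInt a u := by rw [← hkM]; ring
          _ ≤ c * actionInt a w := h1
          _ ≤ M * actionInt a w := mul_le_mul_of_nonneg_right hcM h4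
      exact le_of_mul_le_mul_left this hM
    rw [e3]
    refine (strictMono_actionInt a).le_iff_le.1 (h3.trans (le_trans ?_ h5))
    exact mul_le_mul_of_nonneg_left h2 hk0.le
  · intro hau
    rw [uIcc_of_ge hau] at hφ hφm
    have h1 := integral_mul_le_of_le (a := a) hau hφ hφm
    rw [intervalIntegral.integral_symm a u, intervalIntegral.integral_symm a u, ← h] at h1
    change m * -actionInt a u ≤ _ at h1
    have h2 : actionInt a u ≤ actionInt a (a + (u - a) / 2) :=
      (strictMono_actionInt a).monotone (by linarith)
    have h3 : k * actionInt a (a + (u - a) / 2) ≤ actionInt a (a + k * ((u - a) / 2)) := by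
      rw [e1, e2]
      have := mul_le_mul_of_nonneg_left hI (mul_nonneg hk0.le (by linarith : 0 ≤ -((u - a) / 2)))
      linarith
    have h0 : actionInt a u ≤ 0 := by
      rw [← actionInt_self a]; exact (strictMono_actionInt a).monotone hau
    have h4 : actionInt a w ≤ 0 := by
      by_contra! hneg
      nlinarith
    have h5 : actionInt a w ≤ k * actionInt a u := by
      have : M * actionInt a w ≤ M * (k * actionInt a u) := by
        calc M * actionInt a w ≤ c * actionInt a w := by nlinarith
          _ ≤ m * actionInt a u := by linarith
          _ = M * (k * actionInt a u) := by rw [← hkM]; ring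
      exact le_of_mul_le_mul_left this hM
    rw [e3]
    refine (strictMono_actionInt a).le_iff_le.1 (h5.trans (le_trans ?_ h3))
    exact mul_le_mul_of_nonneg_left h2 hk0.le

/-- Comparison of `w` with `u` near the left turning point. -/
theorem turning_comparison_left {a u w c m M : ℝ} {φ : ℝ → ℝ} {J : Set ℝ} (ha : 0 < a) (hu : u < a)
    (hm : 0 < m) (hmM : m ≤ M) (hJc : OrdConnected J) (haJ : a ∈ J) (haJ' : -a ∈ J) (huJ : u ∈ J)
    (hφ : ContinuousOn φ J) (hφm : ∀ s ∈ J, m ≤ φ s) (hc : 0 < c) (hcM : c ≤ M)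
    (hcm : c = semiMean a φ)
    (h : c * actionInt a w = ∫ s in a..u, √|s ^ 2 - a ^ 2| * φ s) :
    (-a ≤ u → -a + m / M / 2 * (u + a) ≤ w) ∧ (u ≤ -a → w ≤ -a + m / M / 2 * (u + a)) := by
  have hi : ∀ {x y}, x ∈ J → y ∈ J →
      IntervalIntegrable (fun s => √|s ^ 2 - a ^ 2| * φ s) volume x y := fun hx hy =>
    (((continuous_sqrt_abs_sq_sub a).continuousOn.mul hφ).mono
      (hJc.uIcc_subset hx hy)).intervalIntegrable
  have h1 := intervalIntegral.integral_add_adjacent_intervals (hi haJ' haJ) (hi haJ huJ)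
  have htot : ∫ s in (-a)..a, √|s ^ 2 - a ^ 2| * φ s = c * (Real.pi * a ^ 2 / 2) := by
    rw [hcm, semiMean]
    have := Real.pi_pos
    field_simp
  have h3 := intervalIntegral.integral_comp_neg (a := a) (b := -u)
    (fun s => √|s ^ 2 - a ^ 2| * φ s)
  simp only [neg_sq, neg_neg] at h3
  -- Because `c` is the mean of `φ`, the total actions over `[-a, a]` agree, so the reflected
  -- problem satisfies the same equation based at the right turning point.
  have h2 : c * actionInt a (-w) = ∫ s in a..(-u), √|s ^ 2 - a ^ 2| * φ (-s) := by
    rw [actionInt_neg ha, h3, intervalIntegral.integral_symm, ← h1, htot, ← h]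
    ring
  have hsub : ∀ s ∈ uIcc a (-u), -s ∈ J := by
    intro s hs
    have : -s ∈ uIcc (-a) u := by
      have h4 : -s ∈ uIcc (-a) (- -u) := by
        rw [← Set.neg_mem_neg, neg_neg, Set.neg_uIcc]; simpa using hs
      rwa [neg_neg] at h4
    exact hJc.uIcc_subset haJ' huJ this
  have := turning_comparison ha (by linarith : -a < -u) hm hmM
    (hφ.comp (by fun_prop) hsub) (fun s hs => hφm _ (hsub s hs)) hc hcM h2
  constructor
  · intro h5
    have := this.2 (by linarith)
    linarith
  · intro h5
    have := this.1 (by linarith)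
    linarith

end Weber

/-! ### The displacement `P` and its regular equation -/

namespace Weber

/-- A continuous function whose derivative near `x` extends continuously to `x` is differentiable
there. It carries derivative formulas found off the turning points, or off 0, across them. -/
theorem hasDerivAt_of_punctured {f g : ℝ → ℝ} {x : ℝ}
    (hd : ∀ᶠ y in 𝓝[≠] x, HasDerivAt f (g y) y) (hf : ContinuousAt f x)
    (hg : ContinuousAt g x) : HasDerivAt f (g x) x := by
  obtain ⟨s, hs, hxs⟩ := mem_nhdsWithin_iff_exists_mem_nhds_inter.1 hd
  have hd' : ∀ y ∈ s, y ≠ x → HasDerivAt f (g y) y := fun y hy hyx => hxs ⟨hy, hyx⟩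
  have A : HasDerivWithinAt f (g x) (Ici x) x := by
    refine hasDerivWithinAt_Ici_of_tendsto_deriv (s := s ∩ Ioi x)
      (fun y hy => (hd' y hy.1 (ne_of_gt hy.2)).differentiableAt.differentiableWithinAt)
      hf.continuousWithinAt (inter_mem (mem_nhdsWithin_of_mem_nhds hs) self_mem_nhdsWithin) ?_
    refine (hg.tendsto.mono_left nhdsWithin_le_nhds).congr' ?_
    filter_upwards [self_mem_nhdsWithin, mem_nhdsWithin_of_mem_nhds hs] with y hy hy'
    exact (hd' y hy' (ne_of_gt hy)).deriv.symm
  have B : HasDerivWithinAt f (g x) (Iic x) x := by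
    refine hasDerivWithinAt_Iic_of_tendsto_deriv (s := s ∩ Iio x)
      (fun y hy => (hd' y hy.1 (ne_of_lt hy.2)).differentiableAt.differentiableWithinAt)
      hf.continuousWithinAt (inter_mem (mem_nhdsWithin_of_mem_nhds hs) self_mem_nhdsWithin) ?_
    refine (hg.tendsto.mono_left nhdsWithin_le_nhds).congr' ?_
    filter_upwards [self_mem_nhdsWithin, mem_nhdsWithin_of_mem_nhds hs] with y hy hy'
    exact (hd' y hy' (ne_of_lt hy)).deriv.symm
  simpa using B.union A

theorem eventually_sq_sub_ne {a : ℝ} (u : ℝ) : ∀ᶠ v in 𝓝[≠] u, v ^ 2 - a ^ 2 ≠ 0 := by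
  have key : ∀ y : ℝ, ∀ᶠ v in 𝓝[≠] u, v ≠ y := by
    intro y
    by_cases h : y = u
    · rw [h]; exact self_mem_nhdsWithin
    · exact mem_nhdsWithin_of_mem_nhds (isOpen_ne.mem_nhds (Ne.symm h))
  filter_upwards [key a, key (-a)] with v h1 h2
  rw [show v ^ 2 - a ^ 2 = (v - a) * (v + a) by ring]
  exact mul_ne_zero (sub_ne_zero.2 h1) fun h => h2 (by linarith)

/-- Differentiate the defining relation of `K` and divide by `√|u² - a²|`; at `u = ±a` pass to the
limit. At these points the equation reads `3 u K = φ - c`, which fixes the value of `K`. -/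
theorem quotient_ode {a c : ℝ} {J : Set ℝ} {φ K : ℝ → ℝ} (hJ : IsOpen J) (hJc : OrdConnected J)
    (haJ : a ∈ J) (hφ : ContinuousOn φ J) (hK : ∀ u ∈ J, DifferentiableAt ℝ K u)
    (hK' : ∀ u ∈ J, ContinuousAt (deriv K) u)
    (h : ∀ u ∈ J, ∫ s in a..u, √|s ^ 2 - a ^ 2| * (φ s - c) =
      (u ^ 2 - a ^ 2) * √|u ^ 2 - a ^ 2| * K u) {u : ℝ} (hu : u ∈ J) :
    (u ^ 2 - a ^ 2) * deriv K u + 3 * u * K u = φ u - c := by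
  have off : ∀ u ∈ J, u ^ 2 - a ^ 2 ≠ 0 →
      (u ^ 2 - a ^ 2) * deriv K u + 3 * u * K u = φ u - c := by
    intro u hu hne
    have h1 := hasDerivAt_integral_of_continuousOn hJ hJc
      ((continuous_sqrt_abs_sq_sub a).continuousOn.mul (hφ.sub (continuousOn_const (c := c))))
      haJ hu
    have h2 := (hasDerivAt_sq_sub_mul_sqrt a u).mul (hK u hu).hasDerivAt
    have h3 : 3 * u * √|u ^ 2 - a ^ 2| * K u + (u ^ 2 - a ^ 2) * √|u ^ 2 - a ^ 2| * deriv K u =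
        √|u ^ 2 - a ^ 2| * (φ u - c) := (h2.congr_of_eventuallyEq
      (Filter.eventually_of_mem (hJ.mem_nhds hu) fun v hv => h v hv)).unique h1
    have h4 := (Real.sqrt_pos.2 (abs_pos.2 hne)).ne'
    refine mul_left_cancel₀ h4 ?_
    linear_combination h3
  have hc : ContinuousAt (fun u => (u ^ 2 - a ^ 2) * deriv K u + 3 * u * K u - (φ u - c)) u := by
    have := hK' u hu
    have := (hK u hu).continuousAt
    have := hφ.continuousAt (hJ.mem_nhds hu)
    fun_prop
  have h1 : Tendsto (fun u => (u ^ 2 - a ^ 2) * deriv K u + 3 * u * K u - (φ u - c)) (𝓝[≠] u)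
      (𝓝 0) := by
    refine tendsto_const_nhds.congr' ?_
    filter_upwards [eventually_sq_sub_ne (a := a) u,
      mem_nhdsWithin_of_mem_nhds (hJ.mem_nhds hu)] with v hv hvJ
    rw [off v hvJ hv, sub_self]
  have := tendsto_nhds_unique (hc.tendsto.mono_left nhdsWithin_le_nhds) h1
  linarith

/-- The ratio `((u + (u² - a²) p)² - a²) / (u² - a²)`. -/
def rad (a u p : ℝ) : ℝ := (1 + (u + a) * p) * (1 + (u - a) * p)

theorem sq_sub_eq_mul_rad (a u p : ℝ) :
    (u + (u ^ 2 - a ^ 2) * p) ^ 2 - a ^ 2 = (u ^ 2 - a ^ 2) * rad a u p := by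
  unfold rad; ring

theorem one_add_mul_ge {k q τ : ℝ} (hk1 : k ≤ 1) (hq : k ≤ 1 + q) (hτ : τ ∈ Icc (0 : ℝ) 1) :
    k ≤ 1 + τ * q := by
  nlinarith [hτ.1, hτ.2]

/-- Both factors of `rad` are affine in `τ`, equal to 1 at `τ = 0` and at least `k` at `τ = 1`. -/
theorem rad_mul_ge {a u p k τ : ℝ} (hk : 0 < k) (hk1 : k ≤ 1) (hA : k ≤ 1 + (u + a) * p)
    (hB : k ≤ 1 + (u - a) * p) (hτ : τ ∈ Icc (0 : ℝ) 1) : k ^ 2 ≤ rad a u (τ * p) := by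
  have h1 := one_add_mul_ge hk1 hA hτ
  have h2 := one_add_mul_ge hk1 hB hτ
  unfold rad
  rw [show (u + a) * (τ * p) = τ * ((u + a) * p) by ring,
    show (u - a) * (τ * p) = τ * ((u - a) * p) by ring, sq]
  exact mul_le_mul h1 h2 hk.le (hk.le.trans h1)

theorem continuous_rad (a u p : ℝ) : Continuous fun τ : ℝ => rad a u (τ * p) := by
  unfold rad; fun_prop

/-- Integrate over `[0, 1]` the `τ`-derivative of `(1 + 2uτp) √(rad a u (τp))`. The identity
isolates an explicit factor `u² - a²`, which later cancels the denominator in the derivative of `P`.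
-/
theorem rad_identity {a u p k : ℝ} (hk : 0 < k) (hk1 : k ≤ 1) (hA : k ≤ 1 + (u + a) * p)
    (hB : k ≤ 1 + (u - a) * p) :
    (1 + 2 * u * p) * √(rad a u p) - 1 =
      3 * u * (p * ∫ τ in (0 : ℝ)..1, √(rad a u (τ * p))) +
      (u ^ 2 - a ^ 2) *
        (p * ∫ τ in (0 : ℝ)..1, (τ * p + u * (τ * p) ^ 2) * (√(rad a u (τ * p)))⁻¹) := by
  have hpos : ∀ τ ∈ Icc (0 : ℝ) 1, 0 < rad a u (τ * p) := fun τ hτ =>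
    lt_of_lt_of_le (by positivity) (rad_mul_ge hk hk1 hA hB hτ)
  have hc1 : ContinuousOn (fun τ : ℝ => √(rad a u (τ * p))) (uIcc 0 1) :=
    ((continuous_rad a u p).sqrt).continuousOn
  have hc2 : ContinuousOn (fun τ : ℝ => (τ * p + u * (τ * p) ^ 2) * (√(rad a u (τ * p)))⁻¹)
      (uIcc 0 1) := by
    refine ContinuousOn.mul (by fun_prop) (hc1.inv₀ fun τ hτ => ?_)
    rw [uIcc_of_le zero_le_one] at hτ
    exact (Real.sqrt_pos.2 (hpos τ hτ)).ne'
  have h1 : ∀ τ ∈ uIcc (0 : ℝ) 1, HasDerivAt (fun τ => (1 + 2 * u * (τ * p)) * √(rad a u (τ * p)))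
      (3 * u * p * √(rad a u (τ * p)) + (u ^ 2 - a ^ 2) * p *
        ((τ * p + u * (τ * p) ^ 2) * (√(rad a u (τ * p)))⁻¹)) τ := by
    intro τ hτ
    rw [uIcc_of_le zero_le_one] at hτ
    have hlin : ∀ q : ℝ, HasDerivAt (fun τ : ℝ => 1 + q * (τ * p)) (q * p) τ := fun q => by
      simpa using (((hasDerivAt_id τ).mul_const p).const_mul q).const_add 1
    have hr : HasDerivAt (fun τ => rad a u (τ * p))
        ((u + a) * p * (1 + (u - a) * (τ * p)) + (1 + (u + a) * (τ * p)) * ((u - a) * p)) τ :=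
      (hlin (u + a)).mul (hlin (u - a))
    refine ((hlin (2 * u)).mul (hr.sqrt (hpos τ hτ).ne')).congr_deriv ?_
    have hs := Real.sqrt_pos.2 (hpos τ hτ)
    have hsq : √(rad a u (τ * p)) ^ 2 = (1 + (u + a) * (τ * p)) * (1 + (u - a) * (τ * p)) :=
      Real.sq_sqrt (hpos τ hτ).le
    generalize √(rad a u (τ * p)) = r at hs hsq
    field_simp
    linear_combination (-2 * u * p) * hsq
  have h2 := intervalIntegral.integral_eq_sub_of_hasDerivAt h1
    (((hc1.const_mul _).add (hc2.const_mul _)).intervalIntegrable)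
  rw [intervalIntegral.integral_add ((hc1.const_mul _).intervalIntegrable)
    ((hc2.const_mul _).intervalIntegrable), intervalIntegral.integral_const_mul,
    intervalIntegral.integral_const_mul] at h2
  have h3 : rad a u 0 = 1 := by simp [rad]
  simp only [one_mul, zero_mul, mul_zero, add_zero, h3, Real.sqrt_one] at h2
  linarith

/-- Along the segment from `u` to `u + (u² - a²) p` the factor `√|u² - a²|` separates from `√|s² -
a²|`, leaving `√rad`. Subtracting `actionInt a u` from the equation for `w` thus gives the regular
equation for `P`. -/
theorem integral_sqrt_segment {a u p k : ℝ} (hk : 0 < k) (hk1 : k ≤ 1)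
    (hA : k ≤ 1 + (u + a) * p) (hB : k ≤ 1 + (u - a) * p) :
    actionInt a (u + (u ^ 2 - a ^ 2) * p) - actionInt a u =
      (u ^ 2 - a ^ 2) * √|u ^ 2 - a ^ 2| * (p * ∫ τ in (0 : ℝ)..1, √(rad a u (τ * p))) := by
  have h1 := intervalIntegral.smul_integral_comp_mul_add (a := 0) (b := 1)
    (fun s => √|s ^ 2 - a ^ 2|) ((u ^ 2 - a ^ 2) * p) u
  simp only [mul_zero, zero_add, mul_one, smul_eq_mul] at h1
  rw [actionInt_sub, add_comm u, ← h1]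
  have h2 : ∫ τ in (0 : ℝ)..1, √|((u ^ 2 - a ^ 2) * p * τ + u) ^ 2 - a ^ 2| =
      ∫ τ in (0 : ℝ)..1, √|u ^ 2 - a ^ 2| * √(rad a u (τ * p)) := by
    refine intervalIntegral.integral_congr fun τ hτ => ?_
    rw [uIcc_of_le zero_le_one] at hτ
    have hpos : 0 < rad a u (τ * p) :=
      lt_of_lt_of_le (by positivity) (rad_mul_ge hk hk1 hA hB hτ)
    rw [show (u ^ 2 - a ^ 2) * p * τ + u = u + (u ^ 2 - a ^ 2) * (τ * p) by ring,
      sq_sub_eq_mul_rad, abs_mul, abs_of_pos hpos, Real.sqrt_mul (abs_nonneg _)]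
  rw [h2, intervalIntegral.integral_const_mul]
  ring

/-- The function `P` with `w(u) = u + (u² - a²) P(u)`, including its values at the turning
points `u = ±a`. -/
theorem exists_displacement {a c m M : ℝ} {J : Set ℝ} {φ K w : ℝ → ℝ} (ha : 0 < a)
    (hJc : OrdConnected J) (haJ : a ∈ J) (haJ' : -a ∈ J)
    (hφ : ContinuousOn φ J) (hm : 0 < m) (hφm : ∀ u ∈ J, m ≤ φ u)
    (hc : c = semiMean a φ) (hcm : m ≤ c) (hcM : c ≤ M)
    (hK : ∀ u ∈ J, ∫ s in a..u, √|s ^ 2 - a ^ 2| * (φ s - c) =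
      (u ^ 2 - a ^ 2) * √|u ^ 2 - a ^ 2| * K u)
    (hode : ∀ u ∈ J, (u ^ 2 - a ^ 2) * deriv K u + 3 * u * K u = φ u - c)
    (hw : ∀ u ∈ J, c * actionInt a (w u) = ∫ s in a..u, √|s ^ 2 - a ^ 2| * φ s) {u : ℝ}
    (hu : u ∈ J) :
    ∃ p, w u = u + (u ^ 2 - a ^ 2) * p ∧ m / M / 2 ≤ 1 + (u + a) * p ∧
      m / M / 2 ≤ 1 + (u - a) * p ∧
      p * ∫ τ in (0 : ℝ)..1, √(rad a u (τ * p)) = K u / c := by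
  have hc0 : 0 < c := hm.trans_le hcm
  have hmM : m ≤ M := hcm.trans hcM
  have hM : 0 < M := hm.trans_le hmM
  have hk0 : 0 < m / M / 2 := by positivity
  have hk1 : m / M / 2 ≤ 1 := by
    have := (div_le_one hM).2 hmM
    linarith
  -- At a turning point the slope of `w` is `(φ/c)^(1/3) ^ 2`, suggested by the limit of `c² w'² (w²
  -- - a²) = φ² (u² - a²)`. Comparing `z²` with `z³ ≥ m/M` according as `z ≤ 1` or `z ≥ 1` gives its
  -- lower bound.
  have hcube : ∀ v ∈ J, ∃ z : ℝ, z ^ 3 = φ v / c ∧ m / M / 2 ≤ z ^ 2 ∧ 0 < z := by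
    intro v hv
    have h0 : 0 < φ v / c := div_pos (hm.trans_le (hφm v hv)) hc0
    refine ⟨(φ v / c) ^ (1 / 3 : ℝ), ?_, ?_, by positivity⟩
    · rw [← Real.rpow_natCast, ← Real.rpow_mul h0.le]; norm_num
    · set z := (φ v / c) ^ (1 / 3 : ℝ) with hz
      have hz0 : 0 < z := by positivity
      have hz3 : z ^ 3 = φ v / c := by
        rw [hz, ← Real.rpow_natCast, ← Real.rpow_mul h0.le]; norm_num
      have h1 : m / M ≤ z ^ 3 := by
        rw [hz3]; exact div_le_div₀ (hm.le.trans (hφm v hv)) (hφm v hv) hc0 hcM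
      have h2 : m / M ≤ 1 := (div_le_one hM).2 hmM
      rcases le_total z 1 with h3 | h3
      · nlinarith [mul_nonneg (sq_nonneg z) (sub_nonneg.2 h3), sq_nonneg z]
      · nlinarith
  by_cases h1 : u = a
  -- Here `w = u` whatever `p` is, so `p` is chosen by `1 + 2 a p = z²`. The regular equation then
  -- follows from `rad_identity` and the value `3 u K = φ - c`.
  · obtain ⟨z, hz3, hz2, hz0⟩ := hcube u hu
    have hwu : w u = u := by
      have := hw u hu
      rw [h1, intervalIntegral.integral_same] at this
      have h2 : actionInt a (w a) = actionInt a a := by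
        rw [actionInt_self]; exact (mul_eq_zero.1 this).resolve_left hc0.ne'
      rw [h1]; exact (strictMono_actionInt a).injective h2
    have hA : 1 + (u + a) * ((z ^ 2 - 1) / (2 * a)) = z ^ 2 := by
      rw [h1, ← two_mul, mul_div_cancel₀ _ (by positivity)]; ring
    have hB : 1 + (u - a) * ((z ^ 2 - 1) / (2 * a)) = 1 := by rw [h1]; ring
    refine ⟨(z ^ 2 - 1) / (2 * a), by rw [hwu, h1]; ring, by rw [hA]; exact hz2,
      by rw [hB]; exact hk1, ?_⟩
    have h3 := rad_identity (a := a) (u := u) (p := (z ^ 2 - 1) / (2 * a)) hk0 hk1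
      (by rw [hA]; exact hz2) (by rw [hB]; exact hk1)
    set I := ((z ^ 2 - 1) / (2 * a)) *
      ∫ τ in (0 : ℝ)..1, √(rad a u (τ * ((z ^ 2 - 1) / (2 * a)))) with hI
    have h4 : rad a u ((z ^ 2 - 1) / (2 * a)) = z ^ 2 := by rw [rad, hA, hB, mul_one]
    have h5 : 1 + 2 * u * ((z ^ 2 - 1) / (2 * a)) = z ^ 2 := by
      linear_combination hA + ((z ^ 2 - 1) / (2 * a)) * h1
    have h6 : u ^ 2 - a ^ 2 = 0 := by rw [h1]; ring
    rw [h4, h5, h6, Real.sqrt_sq hz0.le] at h3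
    have h7 := hode u hu
    rw [h6] at h7
    have h8 : c * z ^ 3 = φ u := by rw [hz3]; field_simp
    have hu0 : u ≠ 0 := by rw [h1]; exact ha.ne'
    rw [eq_div_iff hc0.ne']
    have h9 : 3 * u * (I * c) = 3 * u * K u := by
      linear_combination (-c) * h3 - h7 + h8
    exact mul_left_cancel₀ (mul_ne_zero three_ne_zero hu0) h9
  by_cases h2 : u = -a
  -- The same choice at `-a`, where the other factor of `rad` becomes `z²`. That `w` fixes `-a` uses
  -- that `c` is the semicircle mean of `φ`.
  · obtain ⟨z, hz3, hz2, hz0⟩ := hcube u hu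
    have hwu : w u = u := by
      have := hw u hu
      rw [h2, intervalIntegral.integral_symm] at this
      have h3 : actionInt a (w (-a)) = actionInt a (-a) := by
        rw [actionInt_neg_self ha]
        refine mul_left_cancel₀ hc0.ne' ?_
        rw [this, hc, semiMean]
        have := Real.pi_pos
        field_simp
      rw [h2]; exact (strictMono_actionInt a).injective h3
    have hB : 1 + (u - a) * ((1 - z ^ 2) / (2 * a)) = z ^ 2 := by
      rw [h2, show -a - a = -(2 * a) by ring, neg_mul, mul_div_cancel₀ _ (by positivity)]; ring
    have hA : 1 + (u + a) * ((1 - z ^ 2) / (2 * a)) = 1 := by rw [h2]; ring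
    refine ⟨(1 - z ^ 2) / (2 * a), by rw [hwu, h2]; ring, by rw [hA]; exact hk1,
      by rw [hB]; exact hz2, ?_⟩
    have h3 := rad_identity (a := a) (u := u) (p := (1 - z ^ 2) / (2 * a)) hk0 hk1
      (by rw [hA]; exact hk1) (by rw [hB]; exact hz2)
    set I := ((1 - z ^ 2) / (2 * a)) *
      ∫ τ in (0 : ℝ)..1, √(rad a u (τ * ((1 - z ^ 2) / (2 * a)))) with hI
    have h4 : rad a u ((1 - z ^ 2) / (2 * a)) = z ^ 2 := by rw [rad, hA, hB, one_mul]
    have h5 : 1 + 2 * u * ((1 - z ^ 2) / (2 * a)) = z ^ 2 := by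
      linear_combination hB + ((1 - z ^ 2) / (2 * a)) * h2
    have h6 : u ^ 2 - a ^ 2 = 0 := by rw [h2]; ring
    rw [h4, h5, h6, Real.sqrt_sq hz0.le] at h3
    have h7 := hode u hu
    rw [h6] at h7
    have h8 : c * z ^ 3 = φ u := by rw [hz3]; field_simp
    have hu0 : u ≠ 0 := by rw [h2]; exact (neg_neg_of_pos ha).ne
    rw [eq_div_iff hc0.ne']
    have h9 : 3 * u * (I * c) = 3 * u * K u := by
      linear_combination (-c) * h3 - h7 + h8
    exact mul_left_cancel₀ (mul_ne_zero three_ne_zero hu0) h9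
  have hne1 : u - a ≠ 0 := sub_ne_zero.2 h1
  have hne2 : u + a ≠ 0 := fun h => h2 (by linarith)
  have he : u ^ 2 - a ^ 2 = (u - a) * (u + a) := by ring
  have hene : u ^ 2 - a ^ 2 ≠ 0 := by rw [he]; exact mul_ne_zero hne1 hne2
  have hwe : w u = u + (u ^ 2 - a ^ 2) * ((w u - u) / (u ^ 2 - a ^ 2)) := by
    field_simp; ring
  have hA' : 1 + (u + a) * ((w u - u) / (u ^ 2 - a ^ 2)) = (w u - a) / (u - a) := by
    rw [he]; field_simp; ring
  have hB' : 1 + (u - a) * ((w u - u) / (u ^ 2 - a ^ 2)) = (w u + a) / (u + a) := by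
    rw [he]; field_simp; ring
  have hright : -a < u → (a ≤ u → a + m / M / 2 * (u - a) ≤ w u) ∧
      (u ≤ a → w u ≤ a + m / M / 2 * (u - a)) := fun h =>
    turning_comparison ha h hm hmM (hφ.mono (hJc.uIcc_subset haJ hu))
      (fun s hs => hφm s (hJc.uIcc_subset haJ hu hs)) hc0 hcM (hw u hu)
  have hleft : u < a → (-a ≤ u → -a + m / M / 2 * (u + a) ≤ w u) ∧
      (u ≤ -a → w u ≤ -a + m / M / 2 * (u + a)) := fun h =>
    turning_comparison_left ha h hm hmM hJc haJ haJ' hu hφ hφm hc0 hcM hc (hw u hu)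
  -- The two factors of `rad` are the ratios `(w ∓ a)/(u ∓ a)`. The comparison at the near turning
  -- point bounds one directly; for a point outside `[-a, a]`, adding `2a` to numerator and
  -- denominator in absolute value gives the other, as `m / M / 2 ≤ 1`.
  have hAB : m / M / 2 ≤ (w u - a) / (u - a) ∧ m / M / 2 ≤ (w u + a) / (u + a) := by
    rcases lt_or_gt_of_ne h1 with hlt | hgt
    · rcases lt_or_gt_of_ne h2 with hlt' | hgt'
      · have := (hleft hlt).2 hlt'.le
        constructor
        · rw [le_div_iff_of_neg (by linarith)]
          nlinarith
        · rw [le_div_iff_of_neg (by linarith)]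
          linarith
      · have e1 := (hleft hlt).1 hgt'.le
        have e2 := (hright hgt').2 hlt.le
        constructor
        · rw [le_div_iff_of_neg (by linarith)]
          linarith
        · rw [le_div_iff₀ (by linarith)]
          linarith
    · have := (hright (by linarith)).1 hgt.le
      constructor
      · rw [le_div_iff₀ (by linarith)]
        linarith
      · rw [le_div_iff₀ (by linarith)]
        nlinarith
  refine ⟨(w u - u) / (u ^ 2 - a ^ 2), hwe, by rw [hA']; exact hAB.1, by rw [hB']; exact hAB.2, ?_⟩
  have hseg := integral_sqrt_segment (a := a) (u := u) (p := (w u - u) / (u ^ 2 - a ^ 2)) hk0 hk1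
    (by rw [hA']; exact hAB.1) (by rw [hB']; exact hAB.2)
  rw [← hwe] at hseg
  have hKu := hK u hu
  simp_rw [mul_sub] at hKu
  have h_int : IntervalIntegrable (fun s => √|s ^ 2 - a ^ 2| * φ s) volume a u :=
    (((continuous_sqrt_abs_sq_sub a).continuousOn.mul hφ).mono
      (hJc.uIcc_subset haJ hu)).intervalIntegrable
  rw [intervalIntegral.integral_sub h_int
    ((intervalIntegrable_sqrt_abs_sq_sub a _ _).mul_const c),
    intervalIntegral.integral_mul_const, ← hw u hu] at hKu
  change c * actionInt a (w u) - actionInt a u * c = _ at hKu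
  rw [eq_div_iff hc0.ne']
  refine mul_left_cancel₀ (mul_ne_zero hene (Real.sqrt_pos.2 (abs_pos.2 hene)).ne') ?_
  linear_combination hKu - c * hseg

end Weber

/-! ### Regularity of the displacement and of `w` -/

namespace Weber

/-- The left side of the equation for `P` is `∫₀^p √(rad a u q) dq`, increasing in `p` with slope
bounded below between `P u₀` and `P u`. Hence `|P u - P u₀|` is controlled by the defect of `P u₀`
in the equation at `u`, which tends to 0. -/
theorem displacement_continuousAt {a k c : ℝ} {J : Set ℝ} {P K : ℝ → ℝ} (hk : 0 < k)
    (hJ : IsOpen J) (hA : ∀ u ∈ J, k ≤ 1 + (u + a) * P u) (hB : ∀ u ∈ J, k ≤ 1 + (u - a) * P u)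
    (hP : ∀ u ∈ J, P u * ∫ τ in (0 : ℝ)..1, √(rad a u (τ * P u)) = K u / c) {u₀ : ℝ}
    (hu₀ : u₀ ∈ J) (hK : ContinuousAt K u₀) : ContinuousAt P u₀ := by
  have hΨ : ∀ u p : ℝ, p * ∫ τ in (0 : ℝ)..1, √(rad a u (τ * p)) =
      ∫ q in (0 : ℝ)..p, √(rad a u q) := by
    intro u p
    have := intervalIntegral.mul_integral_comp_mul_right (a := 0) (b := 1)
      (f := fun q => √(rad a u q)) p
    simpa using this
  set p₀ := P u₀ with hp₀
  have hcont : Continuous fun u => ∫ q in (0 : ℝ)..p₀, √(rad a u q) :=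
    intervalIntegral.continuous_parametric_intervalIntegral_of_continuous'
      (f := fun u q => √(rad a u q)) (by unfold rad Function.uncurry; fun_prop) 0 p₀
  -- At nearby `u` the old value `p₀` still gives factors above `k/2`, while `P u` gives factors at
  -- least `k`. The factors are affine in `q`, so the bound `k/2` holds on the whole segment.
  have hevA : ∀ᶠ u in 𝓝 u₀, k / 2 < 1 + (u + a) * p₀ := by
    have : ContinuousAt (fun u => 1 + (u + a) * p₀) u₀ := by fun_prop
    exact this.eventually (lt_mem_nhds (by linarith [hA u₀ hu₀]))
  have hevB : ∀ᶠ u in 𝓝 u₀, k / 2 < 1 + (u - a) * p₀ := by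
    have : ContinuousAt (fun u => 1 + (u - a) * p₀) u₀ := by fun_prop
    exact this.eventually (lt_mem_nhds (by linarith [hB u₀ hu₀]))
  have hest : ∀ᶠ u in 𝓝 u₀, |P u - p₀| ≤
      (k / 2)⁻¹ * |K u / c - ∫ q in (0 : ℝ)..p₀, √(rad a u q)| := by
    filter_upwards [hevA, hevB, hJ.mem_nhds hu₀] with u h1 h2 hu
    have hrc : Continuous fun q => √(rad a u q) := by unfold rad; fun_prop
    have h3 : K u / c - ∫ q in (0 : ℝ)..p₀, √(rad a u q) = ∫ q in p₀..(P u), √(rad a u q) := by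
      rw [← hP u hu, hΨ]
      exact intervalIntegral.integral_interval_sub_left (hrc.intervalIntegrable _ _)
        (hrc.intervalIntegrable _ _)
    have hlow : ∀ q ∈ uIcc p₀ (P u), k / 2 ≤ √(rad a u q) := by
      intro q hq
      obtain ⟨s, t, hs, ht, hst, rfl⟩ : ∃ s t : ℝ, 0 ≤ s ∧ 0 ≤ t ∧ s + t = 1 ∧
          s * p₀ + t * P u = q := by
        rw [← segment_eq_uIcc] at hq
        simpa [segment] using hq
      refine Real.le_sqrt_of_sq_le ?_
      unfold rad
      have hA' := hA u hu
      have hB' := hB u hu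
      have e1 : k / 2 ≤ 1 + (u + a) * (s * p₀ + t * P u) := by
        have : 1 + (u + a) * (s * p₀ + t * P u) =
          s * (1 + (u + a) * p₀) + t * (1 + (u + a) * P u) := by linear_combination -hst
        rw [this]; nlinarith
      have e2 : k / 2 ≤ 1 + (u - a) * (s * p₀ + t * P u) := by
        have : 1 + (u - a) * (s * p₀ + t * P u) =
          s * (1 + (u - a) * p₀) + t * (1 + (u - a) * P u) := by linear_combination -hst
        rw [this]; nlinarith
      rw [sq]
      exact mul_le_mul e1 e2 (by linarith) (by linarith)
    rw [h3, le_inv_mul_iff₀ (by linarith)]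
    have key : ∀ x y : ℝ, x ≤ y → (∀ q ∈ Icc x y, k / 2 ≤ √(rad a u q)) →
        k / 2 * (y - x) ≤ ∫ q in x..y, √(rad a u q) := by
      intro x y hxy hq
      have := intervalIntegral.integral_mono_on hxy (μ := volume) (f := fun _ => k / 2)
        intervalIntegrable_const (hrc.intervalIntegrable _ _) hq
      simp only [intervalIntegral.integral_const, smul_eq_mul] at this
      linarith
    rcases le_total p₀ (P u) with h4 | h4
    · rw [uIcc_of_le h4] at hlow
      rw [abs_of_nonneg (by linarith : 0 ≤ P u - p₀)]
      exact (key _ _ h4 hlow).trans (le_abs_self _)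
    · rw [uIcc_of_ge h4] at hlow
      rw [abs_of_nonpos (by linarith : P u - p₀ ≤ 0), intervalIntegral.integral_symm, abs_neg,
        neg_sub]
      exact (key _ _ h4 hlow).trans (le_abs_self _)
  have hlim : Tendsto (fun u => (k / 2)⁻¹ * |K u / c - ∫ q in (0 : ℝ)..p₀, √(rad a u q)|)
      (𝓝 u₀) (𝓝 0) := by
    have h1 : ContinuousAt (fun u => (k / 2)⁻¹ * |K u / c - ∫ q in (0 : ℝ)..p₀, √(rad a u q)|)
        u₀ := by
      have := hcont.continuousAt (x := u₀)
      fun_prop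
    have h2 := h1.tendsto
    have h3 := hP u₀ hu₀
    rw [hΨ, ← hp₀] at h3
    simpa [h3] using h2
  rw [ContinuousAt, tendsto_iff_norm_sub_tendsto_zero]
  exact squeeze_zero' (Eventually.of_forall fun _ => norm_nonneg _) hest hlim

/-- The derivative of `w` away from the turning points. -/
theorem hasDerivAt_of_action_eq {a c : ℝ} {J : Set ℝ} {φ w : ℝ → ℝ} (ha : 0 < a) (hc : 0 < c)
    (hJ : IsOpen J) (hJc : OrdConnected J) (haJ : a ∈ J) (hφ : ContinuousOn φ J)
    (hw : ∀ u ∈ J, c * actionInt a (w u) = ∫ s in a..u, √|s ^ 2 - a ^ 2| * φ s) {u : ℝ}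
    (hu : u ∈ J) (hne : w u ^ 2 - a ^ 2 ≠ 0) :
    HasDerivAt w (√|u ^ 2 - a ^ 2| * φ u / (c * √|w u ^ 2 - a ^ 2|)) u := by
  have hw' : ∀ v ∈ J, w v = (actionIso ha).symm ((∫ s in a..v, √|s ^ 2 - a ^ 2| * φ s) / c) :=
    fun v hv => eq_actionIso_symm ha (by rw [eq_div_iff hc.ne', mul_comm]; exact hw v hv)
  have h1 : HasDerivAt (fun v => ∫ s in a..v, √|s ^ 2 - a ^ 2| * φ s)
      (√|u ^ 2 - a ^ 2| * φ u) u :=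
    hasDerivAt_integral_of_continuousOn hJ hJc
      ((continuous_sqrt_abs_sq_sub a).continuousOn.mul hφ) haJ hu
  have h2 := hasDerivAt_actionIso_symm ha (z := (∫ s in a..u, √|s ^ 2 - a ^ 2| * φ s) / c)
    (by rw [← hw' u hu]; exact hne)
  rw [← hw' u hu] at h2
  have h3 := HasDerivAt.comp u h2 (h1.div_const c)
  refine (h3.congr_of_eventuallyEq
    (Filter.eventually_of_mem (hJ.mem_nhds hu) hw')).congr_deriv ?_
  have := (Real.sqrt_pos.2 (abs_pos.2 hne)).ne'
  field_simp

/-- The core estimate, with constants independent of `a`. The displacement `P` is bounded and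
continuous by its regular equation, has derivative `(K'/c - T)/H`, and hence inherits the `C²`
bounds step by step; `w' = φ/(c H)` then gives the third derivative of `w`. -/
theorem model_unifC {ι : Type*} {a : ι → ℝ} {J : ι → Set ℝ} {φ w : ι → ℝ → ℝ} {B m : ℝ}
    (ha : ∀ i, 0 < a i) (hJ : ∀ i, IsOpen (J i)) (hJc : ∀ i, OrdConnected (J i))
    (hJB : ∀ i, ∀ x ∈ J i, |x| ≤ B) (haJ : ∀ i, a i ∈ J i) (haJ' : ∀ i, -a i ∈ J i)
    (hφ : UnifC 3 J φ) (hm : 0 < m) (hφm : ∀ i, ∀ u ∈ J i, m ≤ φ i u)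
    (hw : ∀ i, ∀ u ∈ J i, semiMean (a i) (φ i) * actionInt (a i) (w i u) =
      ∫ s in (a i)..u, √|s ^ 2 - a i ^ 2| * φ i s) :
    UnifC 3 J w ∧ (∃ m', 0 < m' ∧ ∀ i, ∀ u ∈ J i, m' ≤ deriv (w i) u) ∧
      ∀ i, ∀ u ∈ J i, semiMean (a i) (φ i) ^ 2 * deriv (w i) u ^ 2 * (w i u ^ 2 - a i ^ 2) =
        φ i u ^ 2 * (u ^ 2 - a i ^ 2) := by
  obtain ⟨M₀, hM₀⟩ := hφ.bdd
  set M := max M₀ m with hMdef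
  have hM : 0 < M := lt_max_of_lt_right hm
  have hmM : m ≤ M := le_max_right _ _
  have hφM : ∀ i, ∀ u ∈ J i, φ i u ≤ M := fun i u hu =>
    ((le_abs_self _).trans (hM₀ i u hu)).trans (le_max_left _ _)
  have haI : ∀ i, Icc (-a i) (a i) ⊆ J i := fun i => (hJc i).out (haJ' i) (haJ i)
  set c : ι → ℝ := fun i => semiMean (a i) (φ i) with hc
  have hcm : ∀ i, m ≤ c i := fun i => by
    have := semiMean_mono (ha i) continuousOn_const ((hφ.continuousOn i).mono (haI i))
      (fun s hs => hφm i s (haI i hs))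
    rwa [semiMean_const (ha i)] at this
  have hcM : ∀ i, c i ≤ M := fun i => by
    have := semiMean_mono (ha i) ((hφ.continuousOn i).mono (haI i)) continuousOn_const
      (fun s hs => hφM i s (haI i hs))
    rwa [semiMean_const (ha i)] at this
  have hc0 : ∀ i, 0 < c i := fun i => hm.trans_le (hcm i)
  set k := m / M / 2 with hkdef
  have hk0 : 0 < k := by positivity
  have hk1 : k ≤ 1 := by
    have := (div_le_one hM).2 hmM
    linarith
  obtain ⟨K, hKu, hK⟩ := exists_quotient_unifC ha hJ hJc hJB haJ haJ' hφ
  have hode : ∀ i, ∀ u ∈ J i, (u ^ 2 - a i ^ 2) * deriv (K i) u + 3 * u * K i u = φ i u - c i :=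
    fun i u hu => quotient_ode (hJ i) (hJc i) (haJ i) (hφ.continuousOn i)
      (fun v hv => hKu.differentiableAt hv) (fun v hv => hKu.deriv.continuousAt hv) (hK i) hu
  have hex : ∀ i u, ∃ p, u ∈ J i → w i u = u + (u ^ 2 - a i ^ 2) * p ∧ k ≤ 1 + (u + a i) * p ∧
      k ≤ 1 + (u - a i) * p ∧ p * ∫ τ in (0 : ℝ)..1, √(rad (a i) u (τ * p)) = K i u / c i := by
    intro i u
    by_cases hu : u ∈ J i
    · obtain ⟨p, hp⟩ := exists_displacement (ha i) (hJc i) (haJ i) (haJ' i) (hφ.continuousOn i)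
        hm (hφm i) rfl (hcm i) (hcM i) (hK i) (hode i) (hw i) hu
      exact ⟨p, fun _ => hp⟩
    · exact ⟨0, fun h => absurd h hu⟩
  choose P hP using hex
  have hPw : ∀ i, ∀ u ∈ J i, w i u = u + (u ^ 2 - a i ^ 2) * P i u := fun i u hu => (hP i u hu).1
  have hPA : ∀ i, ∀ u ∈ J i, k ≤ 1 + (u + a i) * P i u := fun i u hu => (hP i u hu).2.1
  have hPB : ∀ i, ∀ u ∈ J i, k ≤ 1 + (u - a i) * P i u := fun i u hu => (hP i u hu).2.2.1
  have hPK : ∀ i, ∀ u ∈ J i, P i u * ∫ τ in (0 : ℝ)..1, √(rad (a i) u (τ * P i u)) =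
      K i u / c i := fun i u hu => (hP i u hu).2.2.2
  have hrad : ∀ i, ∀ u ∈ J i, ∀ τ ∈ Icc (0 : ℝ) 1, k ^ 2 ≤ rad (a i) u (τ * P i u) :=
    fun i u hu τ hτ => rad_mul_ge hk0 hk1 (hPA i u hu) (hPB i u hu) hτ
  have hrad1 : ∀ i, ∀ u ∈ J i, k ^ 2 ≤ rad (a i) u (P i u) := fun i u hu => by
    simpa using hrad i u hu 1 (by simp)
  have hk2 : 0 < k ^ 2 := by positivity
  have hP0 : UnifC 0 J P := by
    refine ⟨?_, fun i u hu => displacement_continuousAt hk0 (hJ i) (hPA i) (hPB i) (hPK i) hu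
      (hKu.continuousAt hu)⟩
    obtain ⟨N, hN0, hN⟩ := hKu.bdd_pos
    refine ⟨N / m / k, fun i u hu => ?_⟩
    have h1 : k ≤ ∫ τ in (0 : ℝ)..1, √(rad (a i) u (τ * P i u)) := by
      have := intervalIntegral.integral_mono_on zero_le_one (μ := volume) (f := fun _ => k)
        (g := fun τ => √(rad (a i) u (τ * P i u))) intervalIntegrable_const
        ((continuous_rad (a i) u (P i u)).sqrt.intervalIntegrable _ _)
        (fun τ hτ => Real.le_sqrt_of_sq_le (hrad i u hu τ hτ))
      simpa using this
    rw [le_div_iff₀ hk0]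
    calc |P i u| * k ≤ |P i u| * ∫ τ in (0 : ℝ)..1, √(rad (a i) u (τ * P i u)) :=
          mul_le_mul_of_nonneg_left h1 (abs_nonneg _)
      _ = |P i u * ∫ τ in (0 : ℝ)..1, √(rad (a i) u (τ * P i u))| := by
          rw [abs_mul, abs_of_nonneg (hk0.le.trans h1)]
      _ = |K i u| / c i := by rw [hPK i u hu, abs_div, abs_of_pos (hc0 i)]
      _ ≤ N / m := div_le_div₀ hN0.le (hN i u hu) hm (hcm i)
  have ho := UnifC.isOpen_withUnit hJ
  have haB : ∀ i, |a i| ≤ B := fun i => hJB i _ (haJ i)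
  let W : ι × ℝ → ℝ := fun q => min 1 (max 0 q.2)
  have hW : ∀ q, W q ∈ Icc (0 : ℝ) 1 := fun q =>
    ⟨le_min zero_le_one (le_max_left _ _), min_le_left _ _⟩
  have hWq : ∀ q x, x ∈ UnifC.withUnit J q → W q = q.2 := fun q x hx => by
    simp only [W]; rw [max_eq_right hx.2.1.le, min_eq_right hx.2.2.le]
  have hτ : ∀ j, UnifC j (UnifC.withUnit J) (fun q _ => q.2) := fun j =>
    (UnifC.const ho (c := W) (M := 1) fun q => by
      rw [abs_of_nonneg (hW q).1]; exact (hW q).2).congr ho fun q x hx => (hWq q x hx).symm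
  have hid : ∀ j, UnifC j J (fun _ x => x) := fun j => UnifC.id hJ hJB
  have hac : ∀ j, UnifC j J (fun i _ => a i) := fun j => UnifC.const hJ haB
  have hradU : ∀ {κ : Type _} {s : κ → Set ℝ} (e : κ → ι) (p : κ → ℝ → ℝ) (j : ℕ)
      (hs : ∀ i, IsOpen (s i)) (_ : ∀ i, s i ⊆ J (e i)) (_ : UnifC j s p),
      UnifC j s (fun i u => rad (a (e i)) u (p i u)) := by
    intro κ s e p j hs hsub hp
    have h1 : UnifC j s (fun _ x => x) := UnifC.id hs (M := B) fun i x hx => hJB _ x (hsub i hx)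
    have h2 : UnifC j s (fun i _ => a (e i)) := UnifC.const hs fun i => haB (e i)
    exact ((UnifC.const' hs 1).add hs ((h1.add hs h2).mul hs hp)).mul hs
      ((UnifC.const' hs 1).add hs ((h1.sub hs h2).mul hs hp))
  let T : ι → ℝ → ℝ := fun i u => P i u *
    ∫ τ in (0 : ℝ)..1, (τ * P i u + u * (τ * P i u) ^ 2) * (√(rad (a i) u (τ * P i u)))⁻¹
  let H : ι → ℝ → ℝ := fun i u => √(rad (a i) u (P i u))
  -- The candidate for `P'`. Off the turning points `P' = (w' - 1 - 2uP)/(u² - a²)` with `w' = φ/(c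
  -- H)`; inserting `quotient_ode` for `φ` and `rad_identity` for `(1 + 2uP) H` cancels the
  -- denominator.
  let F : ι → ℝ → ℝ := fun i u => (deriv (K i) u * (c i)⁻¹ - T i u) * (H i u)⁻¹
  have hHU : ∀ j, UnifC j J P → UnifC j J H := fun j hPj =>
    (hradU (fun i => i) P j hJ (fun _ => subset_rfl) hPj).sqrt hJ hk2 hrad1
  have hHk : ∀ i, ∀ u ∈ J i, k ≤ H i u := fun i u hu => Real.le_sqrt_of_sq_le (hrad1 i u hu)
  have hcU : ∀ j, UnifC j J (fun i _ => (c i)⁻¹) := fun j =>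
    UnifC.const hJ (M := m⁻¹) fun i => by
      rw [abs_inv, abs_of_pos (hc0 i)]; exact inv_anti₀ hm (hcm i)
  have hTU : ∀ j, UnifC j J P → UnifC j J T := by
    intro j hPj
    refine hPj.mul hJ (UnifC.integral hJ
      (G := fun q u => (q.2 * P q.1 u + u * (q.2 * P q.1 u) ^ 2) *
        (√(rad (a q.1) u (q.2 * P q.1 u)))⁻¹) ?_ ?_)
    · have h1 := (hτ j).mul ho hPj.fst
      have h2 : UnifC j (UnifC.withUnit J) (fun q u => (√(rad (a q.1) u (q.2 * P q.1 u)))⁻¹) :=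
        ((hradU Prod.fst _ j ho (fun q x hx => hx.1) h1).sqrt ho hk2 fun q u hu =>
          hrad q.1 u hu.1 q.2 (Ioo_subset_Icc_self hu.2)).inv ho hk0 fun q u hu =>
          Real.le_sqrt_of_sq_le (hrad q.1 u hu.1 q.2 (Ioo_subset_Icc_self hu.2))
      have h3 := (h1.add ho ((hid j).fst.mul ho (h1.mul ho h1))).mul ho h2
      simpa only [← sq] using h3
    · intro i u hu
      refine ContinuousOn.aestronglyMeasurable ?_ measurableSet_uIoc
      refine ContinuousOn.mul (by fun_prop)
        ((continuous_rad (a i) u (P i u)).sqrt.continuousOn.inv₀ fun τ hτ' => ?_)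
      rw [uIoc_of_le zero_le_one] at hτ'
      exact (Real.sqrt_pos.2 (hk2.trans_le (hrad i u hu τ (Ioc_subset_Icc_self hτ')))).ne'
  have hFU : ∀ j ≤ 1, UnifC j J P → UnifC j J F := fun j hj hPj =>
    (((hKu.deriv.of_le hj).mul hJ (hcU j)).sub hJ (hTU j hPj)).mul hJ
      ((hHU j hPj).inv hJ hk0 hHk)
  have hwe : ∀ i, ∀ u ∈ J i, w i u ^ 2 - a i ^ 2 = (u ^ 2 - a i ^ 2) * rad (a i) u (P i u) :=
    fun i u hu => by rw [hPw i u hu, sq_sub_eq_mul_rad]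
  have hwd : ∀ i, ∀ u ∈ J i, u ^ 2 - a i ^ 2 ≠ 0 →
      HasDerivAt (w i) (φ i u * (c i)⁻¹ * (H i u)⁻¹) u := by
    intro i u hu hne
    have hpos := hk2.trans_le (hrad1 i u hu)
    have h1 := hasDerivAt_of_action_eq (ha i) (hc0 i) (hJ i) (hJc i) (haJ i) (hφ.continuousOn i)
      (hw i) hu (by rw [hwe i u hu]; exact mul_ne_zero hne hpos.ne')
    refine h1.congr_deriv ?_
    rw [hwe i u hu, abs_mul, abs_of_pos hpos, Real.sqrt_mul (abs_nonneg _)]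
    have h2 := (Real.sqrt_pos.2 (abs_pos.2 hne)).ne'
    have h3 := (Real.sqrt_pos.2 hpos).ne'
    have h4 := (hc0 i).ne'
    simp only [H]
    field_simp
  have hPd : ∀ i, ∀ u ∈ J i, u ^ 2 - a i ^ 2 ≠ 0 → HasDerivAt (P i) (F i u) u := by
    intro i u hu hne
    have hev : P i =ᶠ[𝓝 u] fun v => (w i v - v) / (v ^ 2 - a i ^ 2) := by
      have h1 : ContinuousAt (fun v => v ^ 2 - a i ^ 2) u := by fun_prop
      filter_upwards [(hJ i).mem_nhds hu, h1.eventually_ne hne] with v hv hvne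
      rw [hPw i v hv]; field_simp; ring
    have h1 : HasDerivAt (fun v => v ^ 2 - a i ^ 2) (2 * u) u := by
      simpa using (hasDerivAt_pow 2 u).sub_const (a i ^ 2)
    have h2 := (((hwd i u hu hne).sub (hasDerivAt_id u)).div h1 hne).congr_of_eventuallyEq hev
    refine h2.congr_deriv ?_
    have hid := rad_identity hk0 hk1 (hPA i u hu) (hPB i u hu)
    have hpk := hPK i u hu
    have hH0 : 0 < H i u := hk0.trans_le (hHk i u hu)
    have hode' := hode i u hu
    have hwu := hPw i u hu
    rw [hpk] at hid
    change (1 + 2 * u * P i u) * H i u - 1 = 3 * u * (K i u / c i) + (u ^ 2 - a i ^ 2) * T i u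
      at hid
    have hci := (hc0 i).ne'
    simp only [F, Pi.sub_apply, _root_.id]
    rw [hwu]
    have hφe : φ i u = c i + ((u ^ 2 - a i ^ 2) * deriv (K i) u + 3 * u * K i u) := by linarith
    have hT : T i u = ((1 + 2 * u * P i u) * H i u - 1 - 3 * u * (K i u / c i)) /
        (u ^ 2 - a i ^ 2) := by
      rw [eq_div_iff hne]; linarith
    rw [hφe, hT]
    generalize u ^ 2 - a i ^ 2 = E at hne
    field_simp
    ring
  have hPd' : UnifC 0 J F → ∀ i, ∀ u ∈ J i, HasDerivAt (P i) (F i u) u := fun hF i u hu =>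
    hasDerivAt_of_punctured
      (by
        filter_upwards [eventually_sq_sub_ne (a := a i) u,
          mem_nhdsWithin_of_mem_nhds ((hJ i).mem_nhds hu)] with v hv hvJ
        exact hPd i v hvJ hv)
      (hP0.continuousAt hu) (hF.continuousAt hu)
  -- Bootstrap: `F` is as regular as `P`, up to order one because it contains `K'`; this takes `P`
  -- from `C⁰` to `C¹` and to `C²`.
  have hF0 := hFU 0 zero_le_one hP0
  have hP1 : UnifC 1 J P := UnifC.of_hasDerivAt hJ hP0.bdd (hPd' hF0) hF0
  have hP2 : UnifC 2 J P := UnifC.of_hasDerivAt hJ hP0.bdd (hPd' hF0) (hFU 1 le_rfl hP1)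
  have hH2 := hHU 2 hP2
  have hD2 : UnifC 2 J (fun i u => φ i u * (c i)⁻¹ * (H i u)⁻¹) :=
    (hφ.of_succ.mul hJ (hcU 2)).mul hJ (hH2.inv hJ hk0 hHk)
  have hw2 : UnifC 2 J w :=
    ((hid 2).add hJ ((((hid 2).mul hJ (hid 2)).sub hJ ((hac 2).mul hJ (hac 2))).mul hJ hP2)).congr
      hJ fun i u hu => by rw [hPw i u hu]; ring
  have hwd' : ∀ i, ∀ u ∈ J i, HasDerivAt (w i) (φ i u * (c i)⁻¹ * (H i u)⁻¹) u := fun i u hu =>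
    hasDerivAt_of_punctured (g := fun u => φ i u * (c i)⁻¹ * (H i u)⁻¹)
      (by
        filter_upwards [eventually_sq_sub_ne (a := a i) u,
          mem_nhdsWithin_of_mem_nhds ((hJ i).mem_nhds hu)] with v hv hvJ
        exact hwd i v hvJ hv)
      (hw2.continuousAt hu) (hD2.continuousAt hu)
  refine ⟨UnifC.of_hasDerivAt hJ hw2.bdd hwd' hD2, ?_, fun i u hu => ?_⟩
  · obtain ⟨N, hN0, hN⟩ := hH2.bdd_pos
    refine ⟨m * M⁻¹ * N⁻¹, by positivity, fun i u hu => ?_⟩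
    rw [(hwd' i u hu).deriv]
    have h1 := hφm i u hu
    have h2 : M⁻¹ ≤ (c i)⁻¹ := inv_anti₀ (hc0 i) (hcM i)
    have h3 : N⁻¹ ≤ (H i u)⁻¹ :=
      inv_anti₀ (hk0.trans_le (hHk i u hu)) ((le_abs_self _).trans (hN i u hu))
    have h4 : 0 < (c i)⁻¹ := inv_pos.2 (hc0 i)
    have h5 : 0 < φ i u := hm.trans_le h1
    have h6 : 0 ≤ φ i u * (c i)⁻¹ := by positivity
    gcongr
  · rw [(hwd' i u hu).deriv, hwe i u hu]
    have h1 : H i u ^ 2 = rad (a i) u (P i u) := Real.sq_sqrt (hk2.le.trans (hrad1 i u hu))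
    have h2 := (hk0.trans_le (hHk i u hu)).ne'
    have h3 := (hc0 i).ne'
    rw [← h1]
    change c i ^ 2 * _ * _ = _
    field_simp

end Weber

/-! ### The signed square root of a single well -/

namespace Weber

/-- `∫₀¹ V''(t x) dt`, which is `V'(x) / x` if `V'(0) = 0`. -/
noncomputable def wellZ (V : ℝ → ℝ) (x : ℝ) : ℝ := ∫ t in (0 : ℝ)..1, deriv (deriv V) (t * x)

/-- `V(x) / x²` for `V(0) = V'(0) = 0`. -/
noncomputable def wellW (V : ℝ → ℝ) (x : ℝ) : ℝ := ∫ t in (0 : ℝ)..1, t * wellZ V (t * x)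

/-- The signed square root of a single-well potential `V`. -/
noncomputable def wellU (V : ℝ → ℝ) (x : ℝ) : ℝ := x * √(wellW V x)

theorem mul_integral_comp_mul {f : ℝ → ℝ} (x : ℝ) :
    x * ∫ t in (0 : ℝ)..1, f (t * x) = ∫ s in (0 : ℝ)..x, f s := by
  simp

theorem deriv_eq_mul_wellZ {V : ℝ → ℝ} (hV : ContDiff ℝ 2 V) (h0 : deriv V 0 = 0) (x : ℝ) :
    deriv V x = x * wellZ V x := by
  have hV1 : ContDiff ℝ 1 (deriv V) := by
    rw [show (2 : WithTop ℕ∞) = 1 + 1 by norm_num, contDiff_succ_iff_deriv] at hV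
    exact hV.2.2
  rw [wellZ, mul_integral_comp_mul, intervalIntegral.integral_deriv_eq_sub, h0, sub_zero]
  · exact fun y _ => hV1.differentiable one_ne_zero y
  · exact (hV1.continuous_deriv le_rfl).intervalIntegrable _ _

theorem eq_sq_mul_wellW {V : ℝ → ℝ} (hV : ContDiff ℝ 2 V) (h : V 0 = 0) (h0 : deriv V 0 = 0)
    (x : ℝ) : V x = x ^ 2 * wellW V x := by
  have h1 : x * ∫ t in (0 : ℝ)..1, deriv V (t * x) = V x := by
    rw [mul_integral_comp_mul, intervalIntegral.integral_deriv_eq_sub, h, sub_zero]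
    · exact fun y _ => hV.differentiable two_ne_zero y
    · exact (hV.continuous_deriv one_le_two).intervalIntegrable _ _
  rw [← h1, wellW, sq, mul_assoc, ← intervalIntegral.integral_const_mul x (fun t => t * _)]
  congr 1
  refine intervalIntegral.integral_congr fun t _ => ?_
  rw [deriv_eq_mul_wellZ hV h0]; ring

theorem continuous_wellZ {V : ℝ → ℝ} (hV : ContDiff ℝ 2 V) : Continuous (wellZ V) := by
  have h2 : Continuous (deriv (deriv V)) := by
    have := hV.continuous_iteratedDeriv 2 (by norm_num)
    rwa [iteratedDeriv_succ, iteratedDeriv_one] at this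
  exact intervalIntegral.continuous_parametric_intervalIntegral_of_continuous'
    (f := fun x t => deriv (deriv V) (t * x)) (by unfold Function.uncurry; fun_prop) 0 1

theorem wellW_ge {V : ℝ → ℝ} (hV : ContDiff ℝ 2 V) {m R : ℝ}
    (h : ∀ x ∈ Ioo (-R) R, m ≤ wellZ V x) {x : ℝ} (hx : x ∈ Ioo (-R) R) : m / 2 ≤ wellW V x := by
  have hc := continuous_wellZ hV
  have h1 := intervalIntegral.integral_mono_on (μ := volume) zero_le_one
    (f := fun t => t * m) (g := fun t => t * wellZ V (t * x))
    (Continuous.intervalIntegrable (by fun_prop) _ _)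
    (Continuous.intervalIntegrable (by fun_prop) _ _)
    (fun t ht => mul_le_mul_of_nonneg_left (h _ ⟨by nlinarith [ht.1, ht.2, hx.1, hx.2],
      by nlinarith [ht.1, ht.2, hx.1, hx.2]⟩) ht.1)
  rw [intervalIntegral.integral_mul_const, integral_id] at h1
  unfold wellW
  linarith

section Family

variable {ι : Type*} {V : ι → ℝ → ℝ} {R m : ℝ}

theorem unifC_comp_mul {k : ℕ} {f : ι → ℝ → ℝ} (hf : UnifC k (fun _ => Ioo (-R) R) f) :
    UnifC k (UnifC.withUnit fun _ : ι => Ioo (-R) R) (fun q x => f q.1 (q.2 * x)) := by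
  have hs : ∀ _ : ι, IsOpen (Ioo (-R) R) := fun _ => isOpen_Ioo
  have ho := UnifC.isOpen_withUnit hs
  have hid : UnifC k (fun _ : ι => Ioo (-R) R) (fun _ x => x) :=
    UnifC.id hs (M := R) fun _ x hx => abs_le.2 ⟨hx.1.le, hx.2.le⟩
  have hτ : UnifC k (UnifC.withUnit fun _ : ι => Ioo (-R) R) (fun q _ => q.2) :=
    (UnifC.const ho (c := fun q : ι × ℝ => min 1 (max 0 q.2)) (M := 1) fun q => by
      rw [abs_of_nonneg (le_min zero_le_one (le_max_left _ _))]
      exact min_le_left _ _).congr ho fun q x hx => by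
        rw [max_eq_right hx.2.1.le, min_eq_right hx.2.2.le]
  refine UnifC.comp ho (hf.reindex Prod.fst) (hτ.mul ho hid.fst) fun q x hx => ?_
  have h1 := hx.1
  have h2 := hx.2
  constructor <;> nlinarith [h1.1, h1.2, h2.1, h2.2]

theorem wellZ_unifC {k : ℕ} (hV : ∀ i, ContDiff ℝ 2 (V i))
    (h : UnifC k (fun _ => Ioo (-R) R) fun i => deriv (deriv (V i))) :
    UnifC k (fun _ => Ioo (-R) R) fun i => wellZ (V i) := by
  refine UnifC.integral (fun _ => isOpen_Ioo)
    (G := fun q x => deriv (deriv (V q.1)) (q.2 * x)) (unifC_comp_mul h) fun i x _ => ?_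
  have h2 : Continuous (deriv (deriv (V i))) := by
    have := (hV i).continuous_iteratedDeriv 2 (by norm_num)
    rwa [iteratedDeriv_succ, iteratedDeriv_one] at this
  exact (by fun_prop : Continuous fun t => deriv (deriv (V i)) (t * x)).aestronglyMeasurable

theorem wellW_unifC {k : ℕ} (hV : ∀ i, ContDiff ℝ 2 (V i))
    (h : UnifC k (fun _ => Ioo (-R) R) fun i => deriv (deriv (V i))) :
    UnifC k (fun _ => Ioo (-R) R) fun i => wellW (V i) := by
  have hs : ∀ _ : ι, IsOpen (Ioo (-R) R) := fun _ => isOpen_Ioo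
  have ho := UnifC.isOpen_withUnit hs
  have hτ : UnifC k (UnifC.withUnit fun _ : ι => Ioo (-R) R) (fun q _ => q.2) :=
    (UnifC.const ho (c := fun q : ι × ℝ => min 1 (max 0 q.2)) (M := 1) fun q => by
      rw [abs_of_nonneg (le_min zero_le_one (le_max_left _ _))]
      exact min_le_left _ _).congr ho fun q x hx => by
        rw [max_eq_right hx.2.1.le, min_eq_right hx.2.2.le]
  refine UnifC.integral hs (G := fun q x => q.2 * wellZ (V q.1) (q.2 * x))
    (hτ.mul ho (unifC_comp_mul (wellZ_unifC hV h))) fun i x _ => ?_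
  have h2 := continuous_wellZ (hV i)
  exact (by fun_prop : Continuous fun t => t * wellZ (V i) (t * x)).aestronglyMeasurable

/-- The signed square root is uniformly `C⁴` with derivative `Z / (2 √W)`. -/
theorem wellU_unifC (hV : ∀ i, ContDiff ℝ 2 (V i)) (h0 : ∀ i, V i 0 = 0)
    (h1 : ∀ i, deriv (V i) 0 = 0)
    (h : UnifC 3 (fun _ => Ioo (-R) R) fun i => deriv (deriv (V i))) (hm : 0 < m)
    (hZ : ∀ i, ∀ x ∈ Ioo (-R) R, m ≤ wellZ (V i) x) :
    UnifC 4 (fun _ => Ioo (-R) R) (fun i => wellU (V i)) ∧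
      ∃ m', 0 < m' ∧ ∀ i, ∀ x ∈ Ioo (-R) R, m' ≤ deriv (wellU (V i)) x := by
  have hs : ∀ _ : ι, IsOpen (Ioo (-R) R) := fun _ => isOpen_Ioo
  have hid : ∀ k, UnifC k (fun _ : ι => Ioo (-R) R) (fun _ x => x) := fun k =>
    UnifC.id hs (M := R) fun _ x hx => abs_le.2 ⟨hx.1.le, hx.2.le⟩
  have hW := wellW_unifC hV h
  have hm2 : 0 < m / 2 := by positivity
  have hWm : ∀ i, ∀ x ∈ Ioo (-R) R, m / 2 ≤ wellW (V i) x := fun i x hx =>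
    wellW_ge (hV i) (hZ i) hx
  have hsW := hW.sqrt hs hm2 hWm
  have hU3 : UnifC 3 (fun _ => Ioo (-R) R) (fun i => wellU (V i)) := (hid 3).mul hs hsW
  have hsm : ∀ i, ∀ x ∈ Ioo (-R) R, √(m / 2) ≤ √(wellW (V i) x) := fun i x hx =>
    Real.sqrt_le_sqrt (hWm i x hx)
  have hsm0 : 0 < √(m / 2) := Real.sqrt_pos.2 hm2
  have hD : UnifC 3 (fun _ => Ioo (-R) R) fun i x => 1 / 2 * (wellZ (V i) x * (√(wellW (V i) x))⁻¹) :=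
    (UnifC.const' hs (1 / 2)).mul hs ((wellZ_unifC hV h).mul hs (hsW.inv hs hsm0 hsm))
  -- Away from 0, `u² = V` gives `2 u u' = V' = x Z`, and `u = x √W` allows division by `x`. The
  -- resulting formula is regular at 0 and one order smoother than the product rule would give.
  have hoff : ∀ i, ∀ x ∈ Ioo (-R) R, x ≠ 0 →
      HasDerivAt (wellU (V i)) (1 / 2 * (wellZ (V i) x * (√(wellW (V i) x))⁻¹)) x := by
    intro i x hx hx0
    have hd := hU3.hasDerivAt (k := 2) (i := i) hx
    have hsq : (fun x => wellU (V i) x ^ 2) =ᶠ[𝓝 x] V i := by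
      filter_upwards [isOpen_Ioo.mem_nhds hx] with y hy
      rw [wellU, mul_pow, Real.sq_sqrt (hm2.le.trans (hWm i y hy)),
        ← eq_sq_mul_wellW (hV i) (h0 i) (h1 i)]
    have e1 := (hd.pow 2).congr_of_eventuallyEq hsq.symm
    have e2 := e1.unique ((hV i).differentiable two_ne_zero x).hasDerivAt
    rw [deriv_eq_mul_wellZ (hV i) (h1 i)] at e2
    have hpos : 0 < √(wellW (V i) x) := hsm0.trans_le (hsm i x hx)
    convert hd using 1
    have e3 : 2 * (x * √(wellW (V i) x)) * deriv (wellU (V i)) x = x * wellZ (V i) x := by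
      simpa [wellU] using e2
    have e4 : wellZ (V i) x = 2 * √(wellW (V i) x) * deriv (wellU (V i)) x :=
      mul_left_cancel₀ hx0 (by linear_combination -e3)
    rw [e4]
    field_simp
  have hd : ∀ i, ∀ x ∈ Ioo (-R) R,
      HasDerivAt (wellU (V i)) (1 / 2 * (wellZ (V i) x * (√(wellW (V i) x))⁻¹)) x := by
    intro i x hx
    refine hasDerivAt_of_punctured
      (g := fun x => 1 / 2 * (wellZ (V i) x * (√(wellW (V i) x))⁻¹)) ?_
      (hU3.continuousAt (i := i) hx) (hD.continuousAt (i := i) hx)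
    by_cases hx0 : x = 0
    · rw [hx0] at hx ⊢
      filter_upwards [self_mem_nhdsWithin, mem_nhdsWithin_of_mem_nhds (isOpen_Ioo.mem_nhds hx)]
        with y hy hyR
      exact hoff i y hyR hy
    · refine mem_nhdsWithin_of_mem_nhds ?_
      filter_upwards [isOpen_ne.mem_nhds hx0, isOpen_Ioo.mem_nhds hx] with y hy hyR
      exact hoff i y hyR hy
  refine ⟨UnifC.of_hasDerivAt hs hU3.bdd hd hD, ?_⟩
  obtain ⟨N, hN0, hN⟩ := hsW.bdd_pos
  refine ⟨1 / 2 * (m * N⁻¹), by positivity, fun i x hx => ?_⟩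
  rw [(hd i x hx).deriv]
  have e1 := hZ i x hx
  have e2 : N⁻¹ ≤ (√(wellW (V i) x))⁻¹ :=
    inv_anti₀ (hsm0.trans_le (hsm i x hx)) ((le_abs_self _).trans (hN i x hx))
  have e3 : 0 ≤ wellZ (V i) x := hm.le.trans e1
  gcongr

end Family

/-- A single-well potential `V` with minimum `V(0) = 0`, a positive factor `ρ` and an energy `a²`
that `V` exceeds on both sides. -/
structure Well (V ρ : ℝ → ℝ) (a : ℝ) : Prop where
  contDiff : ContDiff ℝ 5 V
  zero : V 0 = 0
  deriv_zero : deriv V 0 = 0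
  deriv2_zero : 0 < deriv (deriv V) 0
  deriv_pos : ∀ x, 0 < x → 0 < deriv V x
  deriv_neg : ∀ x, x < 0 → deriv V x < 0
  contDiff_factor : ContDiff ℝ 3 ρ
  factor_pos : ∀ x, 0 < ρ x
  energy_pos : 0 < a
  exceed_right : ∃ x, 0 < x ∧ a ^ 2 < V x
  exceed_left : ∃ x, x < 0 ∧ a ^ 2 < V x

/-- The determinant `(a² - V) ρ` of a well. -/
def wellD (V ρ : ℝ → ℝ) (a x : ℝ) : ℝ := (a ^ 2 - V x) * ρ x

namespace Well

variable {V ρ : ℝ → ℝ} {a : ℝ}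

theorem contDiff_two (h : Well V ρ a) : ContDiff ℝ 2 V := h.contDiff.of_le (by norm_num)

theorem wellZ_pos (h : Well V ρ a) (x : ℝ) : 0 < wellZ V x := by
  have h1 := deriv_eq_mul_wellZ h.contDiff_two h.deriv_zero x
  rcases lt_trichotomy x 0 with hx | hx | hx
  · have := h.deriv_neg x hx
    by_contra! hcon
    nlinarith
  · subst hx
    simpa [wellZ] using h.deriv2_zero
  · have := h.deriv_pos x hx
    by_contra! hcon
    nlinarith

theorem unifC_deriv2 (h : Well V ρ a) (R : ℝ) :
    UnifC 3 (fun _ : Unit => Ioo (-R) R) fun _ => deriv (deriv V) := by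
  have h1 := UnifC.of_contDiff (k := 5) (f := V) (by exact_mod_cast h.contDiff) R
  exact h1.deriv.deriv

theorem exists_wellZ_ge (h : Well V ρ a) (R : ℝ) :
    ∃ m, 0 < m ∧ ∀ x ∈ Ioo (-R) R, m ≤ wellZ V x := by
  rcases le_or_gt R 0 with hR | hR
  · exact ⟨1, one_pos, fun x hx => absurd hx (by
      rw [Ioo_eq_empty (by linarith)]; exact notMem_empty _)⟩
  obtain ⟨x0, _, hmin⟩ := (isCompact_Icc (a := -R) (b := R)).exists_isMinOn
    (nonempty_Icc.2 (by linarith)) (continuous_wellZ h.contDiff_two).continuousOn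
  exact ⟨wellZ V x0, h.wellZ_pos x0, fun x hx => hmin (Ioo_subset_Icc_self hx)⟩

theorem hasDerivAt_wellU (h : Well V ρ a) (x : ℝ) :
    HasDerivAt (wellU V) (deriv (wellU V) x) x ∧ 0 < deriv (wellU V) x ∧
      ContinuousAt (deriv (wellU V)) x := by
  obtain ⟨m, hm, hZ⟩ := h.exists_wellZ_ge (|x| + 1)
  obtain ⟨h1, m', hm', h2⟩ := wellU_unifC (ι := Unit) (V := fun _ => V)
    (fun _ => h.contDiff_two) (fun _ => h.zero) (fun _ => h.deriv_zero)
    (h.unifC_deriv2 (|x| + 1)) hm (fun _ => hZ)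
  have hx : x ∈ Ioo (-(|x| + 1)) (|x| + 1) :=
    ⟨by linarith [neg_abs_le x], by linarith [le_abs_self x]⟩
  exact ⟨h1.hasDerivAt (i := ()) hx, hm'.trans_le (h2 () x hx), h1.deriv.continuousAt (i := ()) hx⟩

theorem continuous_wellU (h : Well V ρ a) : Continuous (wellU V) :=
  continuous_iff_continuousAt.2 fun x => (h.hasDerivAt_wellU x).1.continuousAt

theorem strictMono_wellU (h : Well V ρ a) : StrictMono (wellU V) :=
  strictMono_of_deriv_pos fun x => (h.hasDerivAt_wellU x).2.1

theorem wellU_sq (h : Well V ρ a) (x : ℝ) : wellU V x ^ 2 = V x := by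
  have hW : 0 ≤ wellW V x := by
    obtain ⟨m, hm, hZ⟩ := h.exists_wellZ_ge (|x| + 1)
    have hx : x ∈ Ioo (-(|x| + 1)) (|x| + 1) :=
      ⟨by linarith [neg_abs_le x], by linarith [le_abs_self x]⟩
    have := wellW_ge h.contDiff_two hZ hx
    linarith
  rw [wellU, mul_pow, Real.sq_sqrt hW, ← eq_sq_mul_wellW h.contDiff_two h.zero h.deriv_zero]

theorem wellU_zero : wellU V 0 = 0 := by simp [wellU]

theorem lt_wellU (h : Well V ρ a) {x : ℝ} (hx : 0 < x) (hV : a ^ 2 < V x) : a < wellU V x := by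
  have h1 : 0 < wellU V x := by rw [← wellU_zero (V := V)]; exact h.strictMono_wellU hx
  rw [← h.wellU_sq] at hV
  exact lt_of_pow_lt_pow_left₀ 2 h1.le hV

theorem wellU_lt (h : Well V ρ a) {x : ℝ} (hx : x < 0) (hV : a ^ 2 < V x) : wellU V x < -a := by
  have h1 : wellU V x < 0 := by rw [← wellU_zero (V := V)]; exact h.strictMono_wellU hx
  rw [← h.wellU_sq, ← neg_sq (wellU V x)] at hV
  linarith [lt_of_pow_lt_pow_left₀ 2 (by linarith) hV]

theorem exists_turning_right (h : Well V ρ a) : ∃ x, 0 < x ∧ wellU V x = a := by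
  obtain ⟨x1, hx1, hV⟩ := h.exceed_right
  obtain ⟨x, hx, hxa⟩ := intermediate_value_Icc hx1.le h.continuous_wellU.continuousOn
    (show a ∈ Icc (wellU V 0) (wellU V x1) from
      ⟨by rw [wellU_zero]; exact h.energy_pos.le, (h.lt_wellU hx1 hV).le⟩)
  refine ⟨x, lt_of_le_of_ne hx.1 fun h0 => ?_, hxa⟩
  rw [← h0, wellU_zero] at hxa
  exact h.energy_pos.ne hxa

theorem exists_turning_left (h : Well V ρ a) : ∃ x, x < 0 ∧ wellU V x = -a := by
  obtain ⟨x1, hx1, hV⟩ := h.exceed_left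
  have ha := h.energy_pos
  obtain ⟨x, hx, hxa⟩ := intermediate_value_Icc hx1.le h.continuous_wellU.continuousOn
    (show -a ∈ Icc (wellU V x1) (wellU V 0) from
      ⟨(h.wellU_lt hx1 hV).le, by rw [wellU_zero]; linarith⟩)
  refine ⟨x, lt_of_le_of_ne hx.2 fun h0 => ?_, hxa⟩
  rw [h0, wellU_zero] at hxa
  linarith

theorem wellD_eq (h : Well V ρ a) (x : ℝ) : wellD V ρ a x = (a ^ 2 - wellU V x ^ 2) * ρ x := by
  rw [wellD, h.wellU_sq]

theorem wellD_eq_zero_iff (h : Well V ρ a) (x : ℝ) :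
    wellD V ρ a x = 0 ↔ wellU V x = -a ∨ wellU V x = a := by
  rw [h.wellD_eq, mul_eq_zero, or_iff_left (h.factor_pos x).ne', sub_eq_zero, eq_comm,
    sq_eq_sq_iff_eq_or_eq_neg, or_comm]

theorem rightTurningPoint_eq (h : Well V ρ a) {x : ℝ} (hx : 0 < x) (hxa : wellU V x = a) :
    rightTurningPoint (wellD V ρ a) = x := by
  have : {y | 0 < y ∧ wellD V ρ a y = 0} = {x} := by
    ext y
    simp only [mem_ofPred_eq, mem_singleton_iff, h.wellD_eq_zero_iff]
    constructor
    · rintro ⟨hy, hy' | hy'⟩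
      · have : 0 < wellU V y := by rw [← wellU_zero (V := V)]; exact h.strictMono_wellU hy
        linarith [h.energy_pos]
      · exact h.strictMono_wellU.injective (hy'.trans hxa.symm)
    · rintro rfl
      exact ⟨hx, Or.inr hxa⟩
  rw [rightTurningPoint, this, csInf_singleton]

theorem leftTurningPoint_eq (h : Well V ρ a) {x : ℝ} (hx : x < 0) (hxa : wellU V x = -a) :
    leftTurningPoint (wellD V ρ a) = x := by
  have : {y | y < 0 ∧ wellD V ρ a y = 0} = {x} := by
    ext y
    simp only [mem_ofPred_eq, mem_singleton_iff, h.wellD_eq_zero_iff]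
    constructor
    · rintro ⟨hy, hy' | hy'⟩
      · exact h.strictMono_wellU.injective (hy'.trans hxa.symm)
      · have : wellU V y < 0 := by rw [← wellU_zero (V := V)]; exact h.strictMono_wellU hy
        linarith [h.energy_pos]
    · rintro rfl
      exact ⟨hx, Or.inl hxa⟩
  rw [leftTurningPoint, this, csSup_singleton]

theorem wellU_rightTurningPoint (h : Well V ρ a) :
    wellU V (rightTurningPoint (wellD V ρ a)) = a ∧ 0 < rightTurningPoint (wellD V ρ a) := by
  obtain ⟨x, hx, hxa⟩ := h.exists_turning_right
  rw [h.rightTurningPoint_eq hx hxa]; exact ⟨hxa, hx⟩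

theorem wellU_leftTurningPoint (h : Well V ρ a) :
    wellU V (leftTurningPoint (wellD V ρ a)) = -a ∧ leftTurningPoint (wellD V ρ a) < 0 := by
  obtain ⟨x, hx, hxa⟩ := h.exists_turning_left
  rw [h.leftTurningPoint_eq hx hxa]; exact ⟨hxa, hx⟩

end Well

end Weber

/-! ### Reduction of the Langer transformation to the model equation -/

namespace Weber

/-- The inverse of the signed square root of `V`. -/
noncomputable def wellX (V : ℝ → ℝ) : ℝ → ℝ := Function.invFun (wellU V)

/-- The density of `√ρ dx` with respect to the coordinate `u`. -/
noncomputable def wellPhi (V ρ : ℝ → ℝ) (s : ℝ) : ℝ :=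
  √(ρ (wellX V s)) * (deriv (wellU V) (wellX V s))⁻¹

namespace Well

variable {V ρ : ℝ → ℝ} {a : ℝ}

theorem wellX_wellU (h : Well V ρ a) (x : ℝ) : wellX V (wellU V x) = x :=
  Function.leftInverse_invFun h.strictMono_wellU.injective x

/-- The signed square root need not be onto, so `wellX` is arbitrary outside its range. Positivity
of the derivative makes the map locally open, hence nearby values are in the range. -/
theorem hasDerivAt_wellX (h : Well V ρ a) (x : ℝ) :
    HasDerivAt (wellX V) (deriv (wellU V) x)⁻¹ (wellU V x) := by
  have hst : HasStrictDerivAt (wellU V) (deriv (wellU V) x) x :=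
    hasStrictDerivAt_of_hasDerivAt_of_continuousAt
      (Eventually.of_forall fun y => (h.hasDerivAt_wellU y).1) (h.hasDerivAt_wellU x).2.2
  have hne := (h.hasDerivAt_wellU x).2.1.ne'
  have hmap := hst.map_nhds_eq hne
  refine HasDerivAt.of_local_left_inverse (f := wellU V) ?_ ?_ hne ?_
  · rw [ContinuousAt, h.wellX_wellU, ← hmap, tendsto_map'_iff]
    exact tendsto_id.congr fun y => (h.wellX_wellU y).symm
  · rw [h.wellX_wellU]; exact (h.hasDerivAt_wellU x).1
  · rw [← hmap, eventually_map]
    exact Eventually.of_forall fun y => by rw [h.wellX_wellU]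

theorem wellPhi_wellU (h : Well V ρ a) (x : ℝ) :
    wellPhi V ρ (wellU V x) * deriv (wellU V) x = √(ρ x) := by
  rw [wellPhi, h.wellX_wellU, mul_assoc, inv_mul_cancel₀ (h.hasDerivAt_wellU x).2.1.ne', mul_one]

theorem continuousAt_wellPhi (h : Well V ρ a) (x : ℝ) :
    ContinuousAt (wellPhi V ρ) (wellU V x) := by
  have h1 := (h.hasDerivAt_wellX x).continuousAt
  have h2 : ContinuousAt ρ (wellX V (wellU V x)) := h.contDiff_factor.continuous.continuousAt
  have h3 : ContinuousAt (deriv (wellU V)) (wellX V (wellU V x)) := (h.hasDerivAt_wellU _).2.2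
  refine ContinuousAt.mul (ContinuousAt.comp (f := wellX V) h2 h1).sqrt
    ((ContinuousAt.comp (f := wellX V) h3 h1).inv₀ (h.hasDerivAt_wellU _).2.1.ne')

theorem integral_sqrt_wellD (h : Well V ρ a) (x y : ℝ) :
    ∫ s in x..y, √|wellD V ρ a s| =
      ∫ s in (wellU V x)..(wellU V y), √|s ^ 2 - a ^ 2| * wellPhi V ρ s := by
  have hc : ∀ z, ContinuousAt (fun s => √|s ^ 2 - a ^ 2| * wellPhi V ρ s) (wellU V z) := fun z =>
    (continuous_sqrt_abs_sq_sub a).continuousAt.mul (h.continuousAt_wellPhi z)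
  rw [← intervalIntegral.integral_comp_mul_deriv' (f := wellU V) (f' := deriv (wellU V))
    (g := fun s => √|s ^ 2 - a ^ 2| * wellPhi V ρ s)
    (fun z _ => (h.hasDerivAt_wellU z).1)
    (fun z _ => (h.hasDerivAt_wellU z).2.2.continuousWithinAt)
    (by rintro _ ⟨z, _, rfl⟩; exact (hc z).continuousWithinAt)]
  refine intervalIntegral.integral_congr fun z _ => ?_
  simp only [Function.comp]
  rw [mul_assoc, h.wellPhi_wellU, h.wellD_eq, abs_mul, abs_of_pos (h.factor_pos z),
    Real.sqrt_mul (abs_nonneg _), abs_sub_comm]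

theorem Icc_subset_range (h : Well V ρ a) {s : ℝ} (hs : s ∈ Icc (-a) a) :
    ∃ x ∈ Icc (leftTurningPoint (wellD V ρ a)) (rightTurningPoint (wellD V ρ a)),
      wellU V x = s := by
  obtain ⟨h1, h2⟩ := h.wellU_rightTurningPoint
  obtain ⟨h3, h4⟩ := h.wellU_leftTurningPoint
  exact intermediate_value_Icc (by linarith) h.continuous_wellU.continuousOn
    (by rw [h1, h3]; exact hs)

theorem wellPhi_pos (h : Well V ρ a) (x : ℝ) : 0 < wellPhi V ρ (wellU V x) := by
  rw [wellPhi, h.wellX_wellU]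
  exact mul_pos (Real.sqrt_pos.2 (h.factor_pos x)) (inv_pos.2 (h.hasDerivAt_wellU x).2.1)

theorem continuousOn_wellPhi (h : Well V ρ a) : ContinuousOn (wellPhi V ρ) (Icc (-a) a) := by
  intro s hs
  obtain ⟨x, _, rfl⟩ := h.Icc_subset_range hs
  exact (h.continuousAt_wellPhi x).continuousWithinAt

theorem semiMean_pos (h : Well V ρ a) : 0 < semiMean a (wellPhi V ρ) := by
  have ha := h.energy_pos
  obtain ⟨s0, hs0, hmin⟩ := (isCompact_Icc (a := -a) (b := a)).exists_isMinOn
    (nonempty_Icc.2 (by linarith)) h.continuousOn_wellPhi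
  have h1 : 0 < wellPhi V ρ s0 := by
    obtain ⟨x, _, rfl⟩ := h.Icc_subset_range hs0
    exact h.wellPhi_pos x
  have h2 := semiMean_mono ha continuousOn_const h.continuousOn_wellPhi (fun s hs => hmin hs)
  rw [semiMean_const ha] at h2
  exact h1.trans_le h2

/-- In the coordinate `u` the integral over the well is `π a²/2`, the mass of the semicircle weight,
times the mean of `wellPhi`. -/
theorem weberParam_eq (h : Well V ρ a) :
    weberParam (wellD V ρ a) = -(semiMean a (wellPhi V ρ) * a ^ 2 / 2) := by
  obtain ⟨h1, h2⟩ := h.wellU_rightTurningPoint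
  obtain ⟨h3, h4⟩ := h.wellU_leftTurningPoint
  have h5 : ∫ x in (leftTurningPoint (wellD V ρ a))..(rightTurningPoint (wellD V ρ a)),
      √(wellD V ρ a x) = ∫ x in (leftTurningPoint (wellD V ρ a))..(rightTurningPoint (wellD V ρ a)),
      √|wellD V ρ a x| := by
    refine intervalIntegral.integral_congr fun x hx => ?_
    rw [uIcc_of_le (by linarith)] at hx
    have e1 : -a ≤ wellU V x := by rw [← h3]; exact h.strictMono_wellU.monotone hx.1
    have e2 : wellU V x ≤ a := by rw [← h1]; exact h.strictMono_wellU.monotone hx.2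
    have e3 : 0 ≤ wellD V ρ a x := by
      rw [h.wellD_eq]
      exact mul_nonneg (by nlinarith) (h.factor_pos x).le
    rw [abs_of_nonneg e3]
  rw [weberParam, h5, h.integral_sqrt_wellD, h1, h3, semiMean]
  have := Real.pi_pos
  have := h.energy_pos
  field_simp

theorem two_mul_sqrt_neg_weberParam (h : Well V ρ a) :
    2 * √(-weberParam (wellD V ρ a)) = √(2 * semiMean a (wellPhi V ρ)) * a := by
  have hc := h.semiMean_pos
  have ha := h.energy_pos
  rw [h.weberParam_eq, neg_neg]
  have e1 : semiMean a (wellPhi V ρ) * a ^ 2 / 2 = (2 * semiMean a (wellPhi V ρ)) * (a / 2) ^ 2 := by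
    ring
  rw [e1, Real.sqrt_mul (by positivity), Real.sqrt_sq (by positivity)]
  ring

/-- The scaling `y = √(2c) w` gives `y²/4 + b = (c/2) (w² - a²)`, and `√(2c) √(c/2) = c`. -/
theorem weber_integral (h : Well V ρ a) (w : ℝ) :
    ∫ s in (2 * √(-weberParam (wellD V ρ a)))..(√(2 * semiMean a (wellPhi V ρ)) * w),
      √|s ^ 2 / 4 + weberParam (wellD V ρ a)| = semiMean a (wellPhi V ρ) * actionInt a w := by
  have hc := h.semiMean_pos
  set c := semiMean a (wellPhi V ρ) with hcdef
  rw [h.two_mul_sqrt_neg_weberParam, h.weberParam_eq, ← hcdef, actionInt]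
  have h1 := intervalIntegral.smul_integral_comp_mul_left (a := a) (b := w)
    (fun s => √|s ^ 2 / 4 + -(c * a ^ 2 / 2)|) (√(2 * c))
  rw [← h1, smul_eq_mul]
  have h2 : ∀ s : ℝ, √|(√(2 * c) * s) ^ 2 / 4 + -(c * a ^ 2 / 2)| =
      √(c / 2) * √|s ^ 2 - a ^ 2| := by
    intro s
    rw [mul_pow, Real.sq_sqrt (by positivity)]
    have : 2 * c * s ^ 2 / 4 + -(c * a ^ 2 / 2) = c / 2 * (s ^ 2 - a ^ 2) := by ring
    rw [this, abs_mul, abs_of_pos (by positivity), Real.sqrt_mul (by positivity)]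
  simp_rw [h2]
  rw [intervalIntegral.integral_const_mul, ← mul_assoc, ← Real.sqrt_mul (by positivity)]
  have : 2 * c * (c / 2) = c ^ 2 := by ring
  rw [this, Real.sqrt_sq hc.le]

/-- Surjectivity of the action integral makes `invFun` a genuine solution, so the defining relation
of `langer` becomes the equation solved in `model_unifC`. -/
theorem action_langer (h : Well V ρ a) (x : ℝ) :
    semiMean a (wellPhi V ρ) *
        actionInt a (langer (wellD V ρ a) x / √(2 * semiMean a (wellPhi V ρ))) =
      ∫ s in a..(wellU V x), √|s ^ 2 - a ^ 2| * wellPhi V ρ s := by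
  have hc := h.semiMean_pos
  have hs : 0 < √(2 * semiMean a (wellPhi V ρ)) := Real.sqrt_pos.2 (by positivity)
  have h_int := h.integral_sqrt_wellD (rightTurningPoint (wellD V ρ a)) x
  rw [h.wellU_rightTurningPoint.1] at h_int
  rw [← h_int, ← h.weber_integral, mul_div_cancel₀ _ hs.ne']
  refine Function.invFun_eq (f := fun y : ℝ => ∫ s in (2 * √(-weberParam (wellD V ρ a)))..y,
    √|s ^ 2 / 4 + weberParam (wellD V ρ a)|) ⟨√(2 * semiMean a (wellPhi V ρ)) *
      (actionIso h.energy_pos).symm ((∫ s in (rightTurningPoint (wellD V ρ a))..x,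
        √|wellD V ρ a s|) / semiMean a (wellPhi V ρ)), ?_⟩
  rw [h.weber_integral, actionInt_actionIso_symm, mul_div_cancel₀ _ hc.ne']

end Well

/-- Transport of `model_unifC` through `u`. The bound `a² < V` at `±R` ensures that both turning
points lie in the image interval, so that `a` and `-a` belong to `J`; no lower bound on `a` is
assumed. -/
theorem langer_unifC {ι : Type*} {V ρ : ι → ℝ → ℝ} {a : ι → ℝ} {R m : ℝ}
    (hW : ∀ i, Well (V i) (ρ i) (a i))
    (hV : UnifC 3 (fun _ => Ioo (-R) R) fun i => deriv (deriv (V i)))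
    (hρ : UnifC 3 (fun _ => Ioo (-R) R) ρ) (hm : 0 < m)
    (hZ : ∀ i, ∀ x ∈ Ioo (-R) R, m ≤ wellZ (V i) x) (hρm : ∀ i, ∀ x ∈ Ioo (-R) R, m ≤ ρ i x)
    (hR : 0 < R) (hVR : ∀ i, a i ^ 2 < V i R) (hVR' : ∀ i, a i ^ 2 < V i (-R)) :
    UnifC 3 (fun _ => Ioo (-R) R) (fun i => langer (wellD (V i) (ρ i) (a i))) ∧
      (∃ m', 0 < m' ∧ ∀ i, ∀ x ∈ Ioo (-R) R, m' ≤ deriv (langer (wellD (V i) (ρ i) (a i))) x) ∧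
      ∀ i, ∀ x ∈ Ioo (-R) R, deriv (langer (wellD (V i) (ρ i) (a i))) x ^ 2 *
        (langer (wellD (V i) (ρ i) (a i)) x ^ 2 / 4 + weberParam (wellD (V i) (ρ i) (a i))) =
          -wellD (V i) (ρ i) (a i) x := by
  have hs : ∀ _ : ι, IsOpen (Ioo (-R) R) := fun _ => isOpen_Ioo
  obtain ⟨hU, mU, hmU, hUm⟩ := wellU_unifC (fun i => (hW i).contDiff_two) (fun i => (hW i).zero)
    (fun i => (hW i).deriv_zero) hV hm hZ
  let J : ι → Set ℝ := fun i => wellU (V i) '' Ioo (-R) R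
  have hJeq : ∀ i, J i = Ioo (wellU (V i) (-R)) (wellU (V i) R) := by
    intro i
    ext s
    constructor
    · rintro ⟨x, hx, rfl⟩
      exact ⟨(hW i).strictMono_wellU hx.1, (hW i).strictMono_wellU hx.2⟩
    · rintro ⟨h1, h2⟩
      obtain ⟨x, hx, rfl⟩ := intermediate_value_Icc (by linarith : -R ≤ R)
        (hW i).continuous_wellU.continuousOn ⟨h1.le, h2.le⟩
      exact ⟨x, ⟨(hW i).strictMono_wellU.lt_iff_lt.1 h1, (hW i).strictMono_wellU.lt_iff_lt.1 h2⟩,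
        rfl⟩
  have hJ : ∀ i, IsOpen (J i) := fun i => by rw [hJeq]; exact isOpen_Ioo
  have hJc : ∀ i, OrdConnected (J i) := fun i => by rw [hJeq]; exact ordConnected_Ioo
  obtain ⟨B, hB0, hB⟩ := hU.bdd_pos
  have hJB : ∀ i, ∀ s ∈ J i, |s| ≤ B := by
    rintro i _ ⟨x, hx, rfl⟩
    exact hB i x hx
  have ha : ∀ i, 0 < a i := fun i => (hW i).energy_pos
  have hr : ∀ i, a i < wellU (V i) R := fun i => (hW i).lt_wellU hR (hVR i)
  have hl : ∀ i, wellU (V i) (-R) < -a i := fun i => (hW i).wellU_lt (by linarith) (hVR' i)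
  have haJ : ∀ i, a i ∈ J i := fun i => by
    rw [hJeq]; exact ⟨by linarith [hl i, ha i], hr i⟩
  have haJ' : ∀ i, -a i ∈ J i := fun i => by
    rw [hJeq]; exact ⟨hl i, by linarith [hr i, ha i]⟩
  have hXm : ∀ i, ∀ s ∈ J i, wellX (V i) s ∈ Ioo (-R) R := by
    rintro i _ ⟨x, hx, rfl⟩
    rw [(hW i).wellX_wellU]; exact hx
  have hXd : ∀ i, ∀ s ∈ J i,
      HasDerivAt (wellX (V i)) (deriv (wellU (V i)) (wellX (V i) s))⁻¹ s := by
    rintro i _ ⟨x, hx, rfl⟩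
    rw [(hW i).wellX_wellU]; exact (hW i).hasDerivAt_wellX x
  have hXb : ∃ M, ∀ i, ∀ s ∈ J i, |wellX (V i) s| ≤ M :=
    ⟨R, fun i s hs => abs_le.2 ⟨(hXm i s hs).1.le, (hXm i s hs).2.le⟩⟩
  -- The inverse satisfies `X' = 1/(u' ∘ X)`, so each order of regularity of `X` yields the next.
  have hXstep : ∀ k ≤ 3, UnifC k J (fun i => wellX (V i)) →
      UnifC k J (fun i s => (deriv (wellU (V i)) (wellX (V i) s))⁻¹) := fun k hk hX =>
    (UnifC.comp hJ (hU.deriv.of_le hk) hX hXm).inv hJ hmU fun i s hs => hUm i _ (hXm i s hs)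
  have hX0 : UnifC 0 J (fun i => wellX (V i)) := ⟨hXb, fun i s hs => (hXd i s hs).continuousAt⟩
  have hX1 : UnifC 1 J (fun i => wellX (V i)) :=
    UnifC.of_hasDerivAt hJ hXb hXd (hXstep 0 (by norm_num) hX0)
  have hX2 : UnifC 2 J (fun i => wellX (V i)) :=
    UnifC.of_hasDerivAt hJ hXb hXd (hXstep 1 (by norm_num) hX1)
  have hX3 : UnifC 3 J (fun i => wellX (V i)) :=
    UnifC.of_hasDerivAt hJ hXb hXd (hXstep 2 (by norm_num) hX2)
  have hφ : UnifC 3 J (fun i => wellPhi (V i) (ρ i)) :=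
    ((UnifC.comp hJ hρ hX3 hXm).sqrt hJ hm fun i s hs => hρm i _ (hXm i s hs)).mul hJ
      (hXstep 3 le_rfl hX3)
  obtain ⟨N, hN0, hN⟩ := hU.deriv.bdd_pos
  have hφm : ∀ i, ∀ s ∈ J i, √m * N⁻¹ ≤ wellPhi (V i) (ρ i) s := by
    intro i s hs
    have h1 := hXm i s hs
    have h2 : N⁻¹ ≤ (deriv (wellU (V i)) (wellX (V i) s))⁻¹ :=
      inv_anti₀ (hmU.trans_le (hUm i _ h1)) ((le_abs_self _).trans (hN i _ h1))
    exact mul_le_mul (Real.sqrt_le_sqrt (hρm i _ h1)) h2 (by positivity) (Real.sqrt_nonneg _)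
  have hφm0 : 0 < √m * N⁻¹ := mul_pos (Real.sqrt_pos.2 hm) (inv_pos.2 hN0)
  let c : ι → ℝ := fun i => semiMean (a i) (wellPhi (V i) (ρ i))
  have hc0 : ∀ i, 0 < c i := fun i => (hW i).semiMean_pos
  have haI : ∀ i, Icc (-a i) (a i) ⊆ J i := fun i => (hJc i).out (haJ' i) (haJ i)
  have hcm : ∀ i, √m * N⁻¹ ≤ c i := fun i => by
    have := semiMean_mono (ha i) continuousOn_const (hW i).continuousOn_wellPhi
      (fun s hs => hφm i s (haI i hs))
    rwa [semiMean_const (ha i)] at this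
  obtain ⟨M, hM0, hM⟩ := hφ.bdd_pos
  have hcM : ∀ i, c i ≤ M := fun i => (le_abs_self _).trans
    (abs_semiMean_le (ha i) fun s hs => hM i s (haI i hs))
  let w : ι → ℝ → ℝ := fun i s => langer (wellD (V i) (ρ i) (a i)) (wellX (V i) s) / √(2 * c i)
  obtain ⟨hwU, ⟨m₁, hm₁, hwm⟩, hweq⟩ := model_unifC (w := w) ha hJ hJc hJB haJ haJ' hφ hφm0 hφm
    (by
      rintro i _ ⟨x, hx, rfl⟩
      simp only [w, (hW i).wellX_wellU]
      exact (hW i).action_langer x)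
  have hsc : ∀ i, 0 < √(2 * c i) := fun i => Real.sqrt_pos.2 (by have := hc0 i; positivity)
  have hgw : ∀ i x, langer (wellD (V i) (ρ i) (a i)) x = √(2 * c i) * w i (wellU (V i) x) := by
    intro i x
    simp only [w, (hW i).wellX_wellU]
    rw [mul_div_cancel₀ _ (hsc i).ne']
  have hgU : UnifC 3 (fun _ => Ioo (-R) R) (fun i => langer (wellD (V i) (ρ i) (a i))) := by
    have h1 : UnifC 3 (fun _ => Ioo (-R) R) (fun i x => w i (wellU (V i) x)) :=
      UnifC.comp hs hwU (hU.of_succ) fun i x hx => ⟨x, hx, rfl⟩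
    refine ((UnifC.const hs (c := fun i => √(2 * c i)) (M := √(2 * M)) fun i => ?_).mul hs
      h1).congr hs fun i x _ => hgw i x
    rw [abs_of_pos (hsc i)]
    exact Real.sqrt_le_sqrt (by linarith [hcM i])
  have hgd : ∀ i, ∀ x ∈ Ioo (-R) R, deriv (langer (wellD (V i) (ρ i) (a i))) x =
      √(2 * c i) * (deriv (w i) (wellU (V i) x) * deriv (wellU (V i)) x) := by
    intro i x hx
    have h1 := (HasDerivAt.comp x (hwU.hasDerivAt (i := i) ⟨x, hx, rfl⟩)
      (hU.hasDerivAt (i := i) hx)).const_mul (√(2 * c i))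
    refine HasDerivAt.deriv (h1.congr_of_eventuallyEq ?_)
    exact Eventually.of_forall fun y => hgw i y
  refine ⟨hgU, ⟨√(2 * (√m * N⁻¹)) * (m₁ * mU), by positivity, fun i x hx => ?_⟩, fun i x hx => ?_⟩
  · rw [hgd i x hx]
    have e1 : √(2 * (√m * N⁻¹)) ≤ √(2 * c i) := Real.sqrt_le_sqrt (by linarith [hcm i])
    have e2 := hwm i _ (mem_image_of_mem (wellU (V i)) hx)
    have e3 := hUm i x hx
    have e4 : 0 ≤ deriv (w i) (wellU (V i) x) := hm₁.le.trans e2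
    gcongr
  · rw [hgd i x hx, hgw i x, (hW i).weberParam_eq, (hW i).wellD_eq]
    have e1 := hweq i _ (mem_image_of_mem (wellU (V i)) hx)
    have e2 := (hW i).wellPhi_wellU x
    have e3 : √(2 * c i) ^ 2 = 2 * c i := Real.sq_sqrt (by have := hc0 i; positivity)
    have e4 : √(ρ i x) ^ 2 = ρ i x := Real.sq_sqrt ((hW i).factor_pos x).le
    rw [← e2] at e4
    change c i ^ 2 * _ * _ = _ at e1
    rw [← e4]
    change (√(2 * c i) * _) ^ 2 * ((√(2 * c i) * _) ^ 2 / 4 + -(c i * a i ^ 2 / 2)) = _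
    generalize deriv (w i) (wellU (V i) x) = w' at *
    generalize deriv (wellU (V i)) x = u' at *
    generalize w i (wellU (V i) x) = w₀ at *
    rw [mul_pow, mul_pow, mul_pow, e3]
    linear_combination u' ^ 2 * e1

end Weber

/-! ### The Langer transformation on the whole line -/

namespace Weber

theorem tendsto_integral_atTop {f : ℝ → ℝ} (hf : Continuous f) {R c : ℝ} (hc : 0 < c)
    (h : ∀ x, R ≤ x → c ≤ f x) (x₀ : ℝ) : Tendsto (fun x => ∫ s in x₀..x, f s) atTop atTop := by
  have h1 : Tendsto (fun x : ℝ => (∫ s in x₀..R, f s) + c * (x - R)) atTop atTop :=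
    tendsto_atTop_add_const_left _ _ ((tendsto_atTop_add_const_right _ _ tendsto_id).const_mul_atTop
      hc)
  refine tendsto_atTop_mono' _ ?_ h1
  filter_upwards [eventually_ge_atTop R] with x hx
  rw [← intervalIntegral.integral_add_adjacent_intervals (hf.intervalIntegrable x₀ R)
    (hf.intervalIntegrable R x)]
  have := intervalIntegral.integral_mono_on (μ := volume) hx (f := fun _ => c)
    intervalIntegrable_const (hf.intervalIntegrable _ _) (fun s hs => h s hs.1)
  simp only [intervalIntegral.integral_const, smul_eq_mul] at this
  linarith

theorem surjective_integral {f : ℝ → ℝ} (hf : Continuous f) {R c : ℝ} (hc : 0 < c)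
    (h : ∀ x, R ≤ |x| → c ≤ f x) (x₀ : ℝ) : Function.Surjective (fun x => ∫ s in x₀..x, f s) := by
  refine Continuous.surjective (intervalIntegral.continuous_primitive
    (fun _ _ => hf.intervalIntegrable _ _) x₀)
    (tendsto_integral_atTop hf hc (fun x hx => h x (hx.trans (le_abs_self x))) x₀) ?_
  have h1 := (tendsto_integral_atTop (f := fun x => f (-x)) (by fun_prop) hc (R := R)
    (fun x hx => h (-x) (by rw [abs_neg]; exact hx.trans (le_abs_self x))) (-x₀))
  have h2 := tendsto_neg_atTop_atBot.comp (h1.comp tendsto_neg_atBot_atTop)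
  refine h2.congr fun x => ?_
  simp only [Function.comp, intervalIntegral.integral_comp_neg, neg_neg]
  rw [← intervalIntegral.integral_symm]

namespace Well

variable {V ρ : ℝ → ℝ} {a : ℝ}

theorem langer_local (h : Well V ρ a) (x : ℝ) :
    ContDiffAt ℝ 3 (langer (wellD V ρ a)) x ∧ 0 < deriv (langer (wellD V ρ a)) x ∧
      deriv (langer (wellD V ρ a)) x ^ 2 *
        (langer (wellD V ρ a) x ^ 2 / 4 + weberParam (wellD V ρ a)) = -wellD V ρ a x := by
  obtain ⟨x1, hx1, hV1⟩ := h.exceed_right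
  obtain ⟨x2, hx2, hV2⟩ := h.exceed_left
  have ha := h.energy_pos
  -- As `x2 < 0 < x1`, this interval contains `x`, `x1` and `x2`, hence both turning points.
  set R := |x| + x1 - x2 + 1 with hR
  have hx0 := abs_nonneg x
  have hxR : x ∈ Ioo (-R) R :=
    ⟨by linarith [neg_abs_le x], by linarith [le_abs_self x]⟩
  have e1 : a ^ 2 < V R := by
    have := (h.lt_wellU hx1 hV1).trans (h.strictMono_wellU (show x1 < R by linarith))
    rw [← h.wellU_sq]; nlinarith
  have e2 : a ^ 2 < V (-R) := by
    have := (h.strictMono_wellU (show -R < x2 by linarith)).trans (h.wellU_lt hx2 hV2)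
    rw [← h.wellU_sq]; nlinarith
  obtain ⟨m, hm, hZ⟩ := h.exists_wellZ_ge R
  obtain ⟨y, _, hmin⟩ := (isCompact_Icc (a := -R) (b := R)).exists_isMinOn
    (nonempty_Icc.2 (by linarith)) h.contDiff_factor.continuous.continuousOn
  obtain ⟨h1, ⟨m', hm', h2⟩, h3⟩ := langer_unifC (ι := Unit) (V := fun _ => V) (ρ := fun _ => ρ)
    (a := fun _ => a) (R := R) (m := min m (ρ y)) (fun _ => h) (h.unifC_deriv2 R)
    (UnifC.of_contDiff (by exact_mod_cast h.contDiff_factor) R) (lt_min hm (h.factor_pos y))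
    (fun _ x hx => (min_le_left _ _).trans (hZ x hx))
    (fun _ x hx => (min_le_right _ _).trans (hmin (Ioo_subset_Icc_self hx)))
    (by linarith) (fun _ => e1) (fun _ => e2)
  refine ⟨?_, hm'.trans_le (h2 () x hxR), h3 () x hxR⟩
  have := (h1.contDiffOn (fun _ => isOpen_Ioo) ()).contDiffAt (isOpen_Ioo.mem_nhds hxR)
  exact_mod_cast this

theorem langer_turning {x z : ℝ} (h : Well V ρ a) (hz : actionInt a z =
      (∫ s in a..(wellU V x), √|s ^ 2 - a ^ 2| * wellPhi V ρ s) / semiMean a (wellPhi V ρ)) :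
    langer (wellD V ρ a) x = √(2 * semiMean a (wellPhi V ρ)) * z := by
  have hc := h.semiMean_pos
  have h1 := h.action_langer x
  rw [mul_comm, ← eq_div_iff hc.ne', ← hz] at h1
  have h2 := (strictMono_actionInt a).injective h1
  have hs : 0 < √(2 * semiMean a (wellPhi V ρ)) := Real.sqrt_pos.2 (by positivity)
  rw [← h2, mul_div_cancel₀ _ hs.ne']

/-- Regularity and the equation are local and come from a one-member family on a large interval. The
lower bound at infinity makes `∫ √|D|` diverge in both directions, which gives surjectivity. -/
theorem langerWellDefined (h : Well V ρ a)
    (hfar : ∃ R c, 0 < c ∧ ∀ x, R ≤ |x| → c ≤ |wellD V ρ a x|) :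
    LangerWellDefined (wellD V ρ a) where
  left_neg := h.wellU_leftTurningPoint.2
  right_pos := h.wellU_rightTurningPoint.2
  zeros x := by
    rw [h.wellD_eq_zero_iff]
    have h1 := h.wellU_leftTurningPoint.1
    have h2 := h.wellU_rightTurningPoint.1
    constructor
    · rintro (hx | hx)
      · exact Or.inl (h.strictMono_wellU.injective (hx.trans h1.symm))
      · exact Or.inr (h.strictMono_wellU.injective (hx.trans h2.symm))
    · rintro (hx | hx)
      · exact Or.inl (by rw [hx, h1])
      · exact Or.inr (by rw [hx, h2])
  param_neg := by
    rw [h.weberParam_eq]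
    have := h.semiMean_pos
    have := h.energy_pos
    rw [neg_lt_zero]; positivity
  contDiff := contDiff_iff_contDiffAt.2 fun x => (h.langer_local x).1
  deriv_pos x := (h.langer_local x).2.1
  bijective := by
    refine ⟨(strictMono_of_deriv_pos fun x => (h.langer_local x).2.1).injective, fun y => ?_⟩
    obtain ⟨R, c, hc, hR⟩ := hfar
    have hcD : Continuous fun x => √|wellD V ρ a x| := by
      have h1 := h.contDiff.continuous
      have h2 := h.contDiff_factor.continuous
      unfold wellD
      fun_prop
    have hcc := h.semiMean_pos
    have hs : 0 < √(2 * semiMean a (wellPhi V ρ)) := Real.sqrt_pos.2 (by positivity)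
    obtain ⟨x, hx⟩ := surjective_integral hcD (Real.sqrt_pos.2 hc)
      (fun x hx => Real.sqrt_le_sqrt (hR x hx)) (rightTurningPoint (wellD V ρ a))
      (semiMean a (wellPhi V ρ) * actionInt a (y / √(2 * semiMean a (wellPhi V ρ))))
    beta_reduce at hx
    rw [h.integral_sqrt_wellD, h.wellU_rightTurningPoint.1] at hx
    refine ⟨x, ?_⟩
    rw [h.langer_turning (z := y / √(2 * semiMean a (wellPhi V ρ)))
      (by rw [hx, mul_div_cancel_left₀ _ hcc.ne']), mul_div_cancel₀ _ hs.ne']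
  equation x := (h.langer_local x).2.2
  map_left := by
    rw [h.two_mul_sqrt_neg_weberParam, h.langer_turning (z := -a), mul_neg]
    rw [h.wellU_leftTurningPoint.1, actionInt_neg_self h.energy_pos,
      intervalIntegral.integral_symm, semiMean]
    have h0 := h.semiMean_pos
    rw [semiMean] at h0
    have ha := h.energy_pos
    have hpi := Real.pi_pos
    have hne : (∫ s in (-a)..a, √|s ^ 2 - a ^ 2| * wellPhi V ρ s) ≠ 0 := fun h1 => by
      rw [h1, mul_zero] at h0; exact lt_irrefl _ h0
    field_simp
  map_right := by
    rw [h.two_mul_sqrt_neg_weberParam]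
    refine h.langer_turning ?_
    rw [h.wellU_rightTurningPoint.1, actionInt_self, intervalIntegral.integral_same, zero_div]

end Well

end Weber

/-! ### WKB estimate beyond the turning points -/

namespace Weber

theorem iteratedDeriv_two {𝕜 : Type*} [NontriviallyNormedField 𝕜] (f : 𝕜 → 𝕜) :
    iteratedDeriv 2 f = deriv (deriv f) := by
  rw [iteratedDeriv_succ, iteratedDeriv_one]

theorem iteratedDeriv_three {𝕜 : Type*} [NontriviallyNormedField 𝕜] (f : 𝕜 → 𝕜) :
    iteratedDeriv 3 f = deriv (deriv (deriv f)) := by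
  rw [iteratedDeriv_succ, iteratedDeriv_two]

/-- The data of a solution `g` of `g'² (g² / 4 - β²) = f` with a right turning point `x₀`. -/
structure RightLanger (g f : ℝ → ℝ) (β x₀ : ℝ) : Prop where
  contDiff : ContDiff ℝ 3 g
  deriv_pos : ∀ x, 0 < deriv g x
  equation : ∀ x, deriv g x ^ 2 * (g x ^ 2 / 4 - β ^ 2) = f x
  param_nonneg : 0 ≤ β
  turning_nonneg : 0 ≤ x₀
  map_turning : g x₀ = 2 * β

namespace RightLanger

variable {g f : ℝ → ℝ} {β x₀ : ℝ}

theorem strictMono (h : RightLanger g f β x₀) : StrictMono g := strictMono_of_deriv_pos h.deriv_pos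

theorem hasDerivAt (h : RightLanger g f β x₀) (x : ℝ) : HasDerivAt g (deriv g x) x :=
  (h.contDiff.differentiable (by norm_num) x).hasDerivAt

theorem hasDerivAt_deriv (h : RightLanger g f β x₀) (x : ℝ) :
    HasDerivAt (deriv g) (deriv (deriv g) x) x :=
  ((h.contDiff.deriv' (n := 2)).differentiable (by norm_num) x).hasDerivAt

theorem hasDerivAt_deriv2 (h : RightLanger g f β x₀) (x : ℝ) :
    HasDerivAt (deriv (deriv g)) (deriv (deriv (deriv g)) x) x :=
  (((h.contDiff.deriv' (n := 2)).deriv' (n := 1)).differentiable (by norm_num) x).hasDerivAt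

theorem deriv_eq (h : RightLanger g f β x₀) (x : ℝ) :
    deriv f x = 2 * deriv g x * deriv (deriv g) x * (g x ^ 2 / 4 - β ^ 2) +
      deriv g x ^ 3 * (g x / 2) := by
  rw [← funext h.equation]
  have := ((h.hasDerivAt_deriv x).pow 2).mul ((((h.hasDerivAt x).pow 2).div_const 4).sub_const
    (β ^ 2))
  refine (this.congr_deriv ?_).deriv
  simp only [Pi.pow_apply]
  ring

theorem deriv2_eq (h : RightLanger g f β x₀) (x : ℝ) :
    deriv (deriv f) x = 2 * deriv (deriv g) x ^ 2 * (g x ^ 2 / 4 - β ^ 2) +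
      2 * deriv g x * deriv (deriv (deriv g)) x * (g x ^ 2 / 4 - β ^ 2) +
      5 * deriv g x ^ 2 * deriv (deriv g) x * (g x / 2) + deriv g x ^ 4 / 2 := by
  rw [funext h.deriv_eq]
  have e0 := h.hasDerivAt x
  have e1 := h.hasDerivAt_deriv x
  have e2 := h.hasDerivAt_deriv2 x
  have := (((e1.const_mul 2).mul e2).mul (((e0.pow 2).div_const 4).sub_const (β ^ 2))).add
    ((e1.pow 3).mul (e0.div_const 2))
  refine (this.congr_deriv ?_).deriv
  simp only [Pi.pow_apply, Pi.mul_apply]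
  ring

/-- The Schwarzian-type expression of `g` through the WKB expressions of `f` and of `y² / 4 - β²`. -/
theorem schrodingerQAt_eq (h : RightLanger g f β x₀) {x : ℝ} (hx : 0 < g x ^ 2 / 4 - β ^ 2) :
    schrodingerQAt g x = 1 / deriv g x ^ 2 *
        (deriv (deriv f) x / (4 * f x) - 5 * deriv f x ^ 2 / (16 * f x ^ 2)) -
      (1 / (8 * (g x ^ 2 / 4 - β ^ 2)) -
        5 * g x ^ 2 / (64 * (g x ^ 2 / 4 - β ^ 2) ^ 2)) := by
  rw [schrodingerQAt, iteratedDeriv_two, iteratedDeriv_three, h.deriv2_eq, h.deriv_eq,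
    ← h.equation]
  have hg := (h.deriv_pos x).ne'
  generalize hm : g x ^ 2 / 4 - β ^ 2 = m at *
  have hm' := hx.ne'
  field_simp
  ring

/-- Beyond the turning point `(g - 2β)² ≤ g² - 4β²`, so the derivative `(g - 2β) g'/2` of the left
side is at most `√f`; integrate from `x₀`. This bounds `g` from above. -/
theorem sub_sq_le (h : RightLanger g f β x₀) {x F : ℝ} (hx : x₀ ≤ x)
    (hF : ∀ s ∈ Icc x₀ x, f s ≤ F) : (g x - 2 * β) ^ 2 / 4 ≤ (x - x₀) * √F := by
  have hd : ∀ s, HasDerivAt (fun s => s * √F - (g s - 2 * β) ^ 2 / 4)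
      (√F - (g s - 2 * β) * deriv g s / 2) s := fun s => by
    have := ((hasDerivAt_id s).mul_const √F).sub
      ((((h.hasDerivAt s).sub_const (2 * β)).pow 2).div_const 4)
    refine this.congr_deriv ?_
    simp only [Nat.cast_ofNat, Nat.add_one_sub_one, pow_one]
    ring
  have hm : MonotoneOn (fun s => s * √F - (g s - 2 * β) ^ 2 / 4) (Icc x₀ x) := by
    refine monotoneOn_of_deriv_nonneg (convex_Icc _ _)
      (fun s _ => (hd s).continuousAt.continuousWithinAt)
      (fun s _ => (hd s).differentiableAt.differentiableWithinAt) fun s hs => ?_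
    rw [interior_Icc] at hs
    rw [(hd s).deriv, sub_nonneg]
    refine Real.le_sqrt_of_sq_le ((?_ : _ ≤ f s).trans (hF s (Ioo_subset_Icc_self hs)))
    have h1 : 2 * β ≤ g s := h.map_turning ▸ h.strictMono.monotone hs.1.le
    have h2 : 0 ≤ deriv g s ^ 2 * (β * (g s - 2 * β)) :=
      mul_nonneg (sq_nonneg _) (mul_nonneg h.param_nonneg (by linarith))
    rw [← h.equation]
    nlinarith
  have := hm (left_mem_Icc.2 hx) (right_mem_Icc.2 hx) hx
  simp only [h.map_turning] at this
  linarith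

/-- The derivative `g g'/2` of `g²/4` is at least `√f ≥ √c`, since `g²/4 ≥ g²/4 - β²`; integrate
from `r` and use `g(r) ≥ 2β`. This bounds the model potential from below. -/
theorem le_sq_sub (h : RightLanger g f β x₀) {r x c : ℝ} (hr : x₀ ≤ r) (hx : r ≤ x)
    (hc : ∀ s ∈ Icc r x, c ≤ f s) : (x - r) * √c ≤ g x ^ 2 / 4 - β ^ 2 := by
  have hd : ∀ s, HasDerivAt (fun s => g s ^ 2 / 4 - s * √c)
      (g s * deriv g s / 2 - √c) s := fun s => by
    have := (((h.hasDerivAt s).pow 2).div_const 4).sub ((hasDerivAt_id s).mul_const √c)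
    refine this.congr_deriv ?_
    simp only [Nat.cast_ofNat, Nat.add_one_sub_one, pow_one]
    ring
  have hg : ∀ s, r ≤ s → 2 * β ≤ g s := fun s hs =>
    h.map_turning ▸ h.strictMono.monotone (hr.trans hs)
  have hm : MonotoneOn (fun s => g s ^ 2 / 4 - s * √c) (Icc r x) := by
    refine monotoneOn_of_deriv_nonneg (convex_Icc _ _)
      (fun s _ => (hd s).continuousAt.continuousWithinAt)
      (fun s _ => (hd s).differentiableAt.differentiableWithinAt) fun s hs => ?_
    rw [interior_Icc] at hs
    rw [(hd s).deriv, sub_nonneg]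
    have h1 := hg s hs.1.le
    have h0 := h.param_nonneg
    have h3 := h.deriv_pos s
    refine Real.sqrt_le_iff.2 ⟨by have := h0.trans (by linarith : β ≤ g s); positivity,
      (hc s (Ioo_subset_Icc_self hs)).trans ?_⟩
    rw [← h.equation]
    nlinarith [sq_nonneg (deriv g s * β)]
  have := hm (left_mem_Icc.2 hx) (right_mem_Icc.2 hx) hx
  have h1 := hg r le_rfl
  have h0 := h.param_nonneg
  simp only at this
  nlinarith

end RightLanger

/-- The hypotheses on `f` under which the WKB error is controlled on `[R, ∞)`. -/
structure FarWKB (f : ℝ → ℝ) (r R c K : ℝ) : Prop where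
  lower : ∀ s, r ≤ s → c ≤ f s
  upper : ∀ x, R ≤ x → ∀ s ∈ Icc 0 x, f s ≤ K * f x
  deriv_le : ∀ x, R ≤ x → x * |deriv f x| ≤ K * f x
  deriv2_le : ∀ x, R ≤ x → x ^ 2 * |deriv (deriv f) x| ≤ K * f x

theorem RightLanger.turning_le {g f : ℝ → ℝ} {β x₀ r R c K : ℝ} (h : RightLanger g f β x₀)
    (hf : FarWKB f r R c K) (hc : 0 < c) : x₀ ≤ r := by
  by_contra! hlt
  have h1 := hf.lower x₀ hlt.le
  rw [← h.equation, h.map_turning] at h1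
  have : deriv g x₀ ^ 2 * ((2 * β) ^ 2 / 4 - β ^ 2) = 0 := by ring
  linarith

/-- The scale is `N = x √(f x)`. Upper and lower comparison give `g² ≤ C₁ N` and `1 + g² ≤ κ (g²/4 -
β²)`, while `1/(g'² x²) = (g²/4 - β²)/N²` by the equation. Thus `1/(g' x)²` decays like `1/(1 +
g²)`, as do the model terms of `Q`. -/
theorem exists_wkb_bound {r R c K B : ℝ} (hr : 0 < r) (hR : r < R) (hc : 0 < c) (hK : 0 < K)
    (hB : 0 ≤ B) : ∃ C, 0 < C ∧ ∀ (g f : ℝ → ℝ) (β x₀ x : ℝ), RightLanger g f β x₀ → β ^ 2 ≤ B →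
      R ≤ x → FarWKB f r R c K →
      1 / (deriv g x ^ 2 * x ^ 2) * (1 + g x ^ 2) ≤ C ∧
      |schrodingerQAt g x| * (1 + g x ^ 2) ≤ C := by
  have hR0 : 0 < R := hr.trans hR
  have hsc : 0 < √c := Real.sqrt_pos.2 hc
  set N₀ := R * √c with hN₀
  have hN₀' : 0 < N₀ := by positivity
  set C₁ := 8 * B / N₀ + 8 * √K with hC₁
  have hC₁' : 0 < C₁ := by positivity
  set C₂ := (1 / N₀ + C₁) * C₁ / 4 with hC₂
  have hC₂' : 0 < C₂ := by positivity
  set m₀ := (R - r) * √c with hm₀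
  have hm₀' : 0 < m₀ := mul_pos (by linarith) hsc
  set κ := 4 * (1 + B / m₀) + 1 / m₀ with hκ
  have hκ' : 0 < κ := by positivity
  refine ⟨C₂ + C₂ * (K / 4 + 5 * K ^ 2 / 16) + κ / 8 + 5 * κ ^ 2 / 64, by positivity,
    fun g f β x₀ x h hβ hx hf => ?_⟩
  have hx0 : 0 < x := hR0.trans_le hx
  have hx₀ := h.turning_le hf hc
  have hfx : c ≤ f x := hf.lower x (by linarith)
  have hfx0 : 0 < f x := hc.trans_le hfx
  have hmx : m₀ ≤ g x ^ 2 / 4 - β ^ 2 :=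
    (mul_le_mul_of_nonneg_right (by linarith) hsc.le).trans
      (h.le_sq_sub hx₀ (by linarith) fun s hs => hf.lower s hs.1)
  have hup := h.sub_sq_le (hx₀.trans (by linarith))
    fun s hs => hf.upper x hx s ⟨h.turning_nonneg.trans hs.1, hs.2⟩
  set N := x * √(f x) with hN
  have hNN : N₀ ≤ N := mul_le_mul hx (Real.sqrt_le_sqrt hfx) hsc.le hx0.le
  have hN0 : 0 < N := hN₀'.trans_le hNN
  have hNsq : N ^ 2 = x ^ 2 * f x := by rw [hN, mul_pow, Real.sq_sqrt hfx0.le]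
  have hg2 : g x ^ 2 ≤ C₁ * N := by
    have h1 : (x - x₀) * √(K * f x) ≤ √K * N := by
      rw [Real.sqrt_mul hK.le, hN]
      have : (x - x₀) * (√K * √(f x)) ≤ x * (√K * √(f x)) :=
        mul_le_mul_of_nonneg_right (by linarith [h.turning_nonneg]) (by positivity)
      linarith
    have h2 : 8 * B ≤ 8 * B / N₀ * N := by
      calc 8 * B = 8 * B / N₀ * N₀ := by field_simp
        _ ≤ _ := mul_le_mul_of_nonneg_left hNN (by positivity)
    rw [hC₁, add_mul]
    -- The square encodes `g² ≤ 2 (g - 2β)² + 8 β²`.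
    nlinarith [sq_nonneg (g x - 4 * β)]
  have hP : 1 / (deriv g x ^ 2 * x ^ 2) * (1 + g x ^ 2) ≤ C₂ := by
    have hg := h.deriv_pos x
    have e : 1 / (deriv g x ^ 2 * x ^ 2) = (g x ^ 2 / 4 - β ^ 2) / N ^ 2 := by
      rw [hNsq, ← h.equation]
      have : g x ^ 2 / 4 - β ^ 2 ≠ 0 := (hm₀'.trans_le hmx).ne'
      generalize g x ^ 2 / 4 - β ^ 2 = m at this
      field_simp
    have h3 : (1 + g x ^ 2) ≤ (1 / N₀ + C₁) * N := by
      have : 1 ≤ 1 / N₀ * N := by rw [one_div, inv_mul_eq_div, one_le_div hN₀']; exact hNN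
      linarith
    rw [e, div_mul_eq_mul_div, div_le_iff₀ (by positivity)]
    calc (g x ^ 2 / 4 - β ^ 2) * (1 + g x ^ 2) ≤ (C₁ * N / 4) * ((1 / N₀ + C₁) * N) :=
          mul_le_mul (by nlinarith) h3 (by positivity) (by positivity)
      _ = C₂ * N ^ 2 := by rw [hC₂]; ring
  refine ⟨hP.trans (by have : 0 ≤ C₂ * (K / 4 + 5 * K ^ 2 / 16) + κ / 8 + 5 * κ ^ 2 / 64 := by
                         positivity
                       linarith), ?_⟩
  have hm0 : 0 < g x ^ 2 / 4 - β ^ 2 := hm₀'.trans_le hmx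
  have hκm : 1 + g x ^ 2 ≤ κ * (g x ^ 2 / 4 - β ^ 2) := by
    have h1 : 1 ≤ 1 / m₀ * (g x ^ 2 / 4 - β ^ 2) := by
      rw [one_div, inv_mul_eq_div, one_le_div hm₀']; exact hmx
    have h2 : B ≤ B / m₀ * (g x ^ 2 / 4 - β ^ 2) := by
      calc B = B / m₀ * m₀ := by field_simp
        _ ≤ _ := mul_le_mul_of_nonneg_left hmx (by positivity)
    rw [hκ]; linarith
  rw [h.schrodingerQAt_eq hm0]
  generalize g x ^ 2 / 4 - β ^ 2 = m at *
  have t1 : |1 / deriv g x ^ 2 *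
      (deriv (deriv f) x / (4 * f x) - 5 * deriv f x ^ 2 / (16 * f x ^ 2))| ≤
      1 / (deriv g x ^ 2 * x ^ 2) * (K / 4 + 5 * K ^ 2 / 16) := by
    have hg := h.deriv_pos x
    have e : 1 / deriv g x ^ 2 *
      (deriv (deriv f) x / (4 * f x) - 5 * deriv f x ^ 2 / (16 * f x ^ 2)) =
      1 / (deriv g x ^ 2 * x ^ 2) * ((x ^ 2 * deriv (deriv f) x / f x) / 4 -
        5 * (x * deriv f x / f x) ^ 2 / 16) := by
      field_simp
    rw [e, abs_mul, abs_of_pos (by positivity : 0 < 1 / (deriv g x ^ 2 * x ^ 2))]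
    refine mul_le_mul_of_nonneg_left ?_ (by positivity)
    have a1 : |x ^ 2 * deriv (deriv f) x / f x| ≤ K := by
      rw [abs_div, abs_mul, abs_of_pos hfx0, abs_of_pos (by positivity : 0 < x ^ 2),
        div_le_iff₀ hfx0]
      exact hf.deriv2_le x hx
    have a2 : |x * deriv f x / f x| ≤ K := by
      rw [abs_div, abs_mul, abs_of_pos hfx0, abs_of_pos hx0, div_le_iff₀ hfx0]
      exact hf.deriv_le x hx
    have a3 := sq_le_sq' (abs_le.1 a2).1 (abs_le.1 a2).2
    have a4 := sq_nonneg (x * deriv f x / f x)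
    rw [abs_le] at a1 ⊢
    constructor <;> linarith
  have t2 : |1 / (8 * m) - 5 * g x ^ 2 / (64 * m ^ 2)| * (1 + g x ^ 2) ≤
      κ / 8 + 5 * κ ^ 2 / 64 := by
    have u : (1 + g x ^ 2) / m ≤ κ := (div_le_iff₀ hm0).2 hκm
    have u0 : 0 ≤ (1 + g x ^ 2) / m := by positivity
    calc _ ≤ (1 / (8 * m) + 5 * (1 + g x ^ 2) / (64 * m ^ 2)) * (1 + g x ^ 2) := by
          refine mul_le_mul_of_nonneg_right ((abs_sub _ _).trans ?_) (by positivity)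
          rw [abs_of_pos (by positivity), abs_of_nonneg (by positivity)]
          gcongr
          linarith
      _ = ((1 + g x ^ 2) / m) / 8 + 5 * ((1 + g x ^ 2) / m) ^ 2 / 64 := by field_simp
      _ ≤ _ := by gcongr
  have hpos : 0 < 1 + g x ^ 2 := by positivity
  calc _ ≤ (1 / (deriv g x ^ 2 * x ^ 2) * (K / 4 + 5 * K ^ 2 / 16) +
        |1 / (8 * m) - 5 * g x ^ 2 / (64 * m ^ 2)|) * (1 + g x ^ 2) := by
        refine mul_le_mul_of_nonneg_right ((abs_sub _ _).trans ?_) hpos.le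
        gcongr
    _ = (1 / (deriv g x ^ 2 * x ^ 2) * (1 + g x ^ 2)) * (K / 4 + 5 * K ^ 2 / 16) +
        |1 / (8 * m) - 5 * g x ^ 2 / (64 * m ^ 2)| * (1 + g x ^ 2) := by ring
    _ ≤ C₂ * (K / 4 + 5 * K ^ 2 / 16) + (κ / 8 + 5 * κ ^ 2 / 64) := by gcongr
    _ ≤ _ := by linarith

end Weber

/-! ### Joining the turning-point region with the far field -/

namespace Weber

theorem LangerWellDefined.rightLanger {D : ℝ → ℝ} (h : LangerWellDefined D) :
    RightLanger (langer D) (fun x => -D x) √(-weberParam D) (rightTurningPoint D) where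
  contDiff := h.contDiff
  deriv_pos := h.deriv_pos
  equation x := by
    rw [Real.sq_sqrt (by linarith [h.param_neg]), sub_neg_eq_add, h.equation]
  param_nonneg := Real.sqrt_nonneg _
  turning_nonneg := h.right_pos.le
  map_turning := h.map_right

theorem deriv_reflect (g : ℝ → ℝ) : deriv (fun x => -g (-x)) = fun x => deriv g (-x) := by
  funext x
  rw [deriv.fun_neg, deriv_comp_neg, neg_neg]

/-- The reflection `x ↦ -x`, `g ↦ -g` preserves the expression, so the left half-line reduces to the
right one. -/
theorem schrodingerQAt_reflect (g : ℝ → ℝ) (x : ℝ) :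
    schrodingerQAt (fun x => -g (-x)) x = schrodingerQAt g (-x) := by
  have h2 : deriv (fun x => deriv g (-x)) = fun x => -deriv (deriv g) (-x) := by
    funext x; rw [deriv_comp_neg]
  simp only [schrodingerQAt, iteratedDeriv_two, iteratedDeriv_three, deriv_reflect, h2, neg_sq]

theorem LangerWellDefined.leftLanger {D : ℝ → ℝ} (h : LangerWellDefined D) :
    RightLanger (fun x => -langer D (-x)) (fun x => -D (-x)) √(-weberParam D)
      (-leftTurningPoint D) where
  contDiff := (h.contDiff.comp contDiff_neg).neg
  deriv_pos x := by rw [deriv_reflect]; exact h.deriv_pos _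
  equation x := by
    rw [Real.sq_sqrt (by linarith [h.param_neg]), sub_neg_eq_add, deriv_reflect, neg_sq, h.equation]
  param_nonneg := Real.sqrt_nonneg _
  turning_nonneg := by linarith [h.left_neg]
  map_turning := by rw [neg_neg, h.map_left, neg_neg]

/-- Uniform control of the perturbing potential for a family of wells: the expansion near the
turning points on `(-R₂, R₂)` and the WKB estimate for `|x| ≥ R₁`. -/
theorem exists_langer_bound {ι : Type*} {V ρ : ι → ℝ → ℝ} {a : ι → ℝ} {r R₁ R₂ m c K : ℝ}
    (hW : ∀ i, Well (V i) (ρ i) (a i))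
    (hV : UnifC 3 (fun _ => Ioo (-R₂) R₂) fun i => deriv (deriv (V i)))
    (hρ : UnifC 3 (fun _ => Ioo (-R₂) R₂) ρ) (hm : 0 < m)
    (hZ : ∀ i, ∀ x ∈ Ioo (-R₂) R₂, m ≤ wellZ (V i) x)
    (hρm : ∀ i, ∀ x ∈ Ioo (-R₂) R₂, m ≤ ρ i x)
    (hr : 0 < r) (hR₁ : r < R₁) (hR₂ : R₁ < R₂) (hc : 0 < c) (hK : 0 < K)
    (hright : ∀ i, FarWKB (fun x => -wellD (V i) (ρ i) (a i) x) r R₁ c K)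
    (hleft : ∀ i, FarWKB (fun x => -wellD (V i) (ρ i) (a i) (-x)) r R₁ c K) :
    ∃ C, 0 < C ∧ ∀ i, LangerWellDefined (wellD (V i) (ρ i) (a i)) ∧ ∀ x,
      1 / (deriv (langer (wellD (V i) (ρ i) (a i))) x ^ 2 * (1 + x ^ 2)) *
        (1 + langer (wellD (V i) (ρ i) (a i)) x ^ 2) ≤ C ∧
      |schrodingerQAt (langer (wellD (V i) (ρ i) (a i))) x| *
        (1 + langer (wellD (V i) (ρ i) (a i)) x ^ 2) ≤ C := by
  have hR₂0 : 0 < R₂ := by linarith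
  have hneg : ∀ i x, r ≤ |x| → c ≤ -wellD (V i) (ρ i) (a i) x := fun i x hx => by
    rcases le_abs.1 hx with hx | hx
    · exact (hright i).lower x hx
    · have := (hleft i).lower (-x) hx
      rwa [neg_neg] at this
  have hlt : ∀ i x, r ≤ |x| → a i ^ 2 < V i x := fun i x hx => by
    have h1 := hneg i x hx
    have h2 := (hW i).factor_pos x
    rw [wellD] at h1
    nlinarith
  have hLW : ∀ i, LangerWellDefined (wellD (V i) (ρ i) (a i)) := fun i =>
    (hW i).langerWellDefined ⟨r, c, hc, fun x hx => (hneg i x hx).trans (neg_le_abs _)⟩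
  obtain ⟨hg, ⟨m', hm', hg'⟩, -⟩ := langer_unifC hW hV hρ hm hZ hρm hR₂0
    (fun i => hlt i _ (by rw [abs_of_pos hR₂0]; linarith))
    (fun i => hlt i _ (by rw [abs_neg, abs_of_pos hR₂0]; linarith))
  obtain ⟨M₀, hM₀, hb₀⟩ := hg.bdd_pos
  obtain ⟨M₂, hM₂, hb₂⟩ := hg.deriv.deriv.bdd_pos
  obtain ⟨M₃, hM₃, hb₃⟩ := hg.deriv.deriv.deriv.bdd_pos
  -- The right turning point lies below `r`, inside the region of uniform bounds, and `g` takes the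
  -- value `2β` there.
  have hβ : ∀ i, √(-weberParam (wellD (V i) (ρ i) (a i))) ^ 2 ≤ M₀ ^ 2 := fun i => by
    have h1 := (hLW i).rightLanger.turning_le (hright i) hc
    have h2 := hb₀ i (rightTurningPoint (wellD (V i) (ρ i) (a i)))
      ⟨by linarith [(hLW i).right_pos], by linarith⟩
    rw [(hLW i).map_right] at h2
    have h3 := le_abs_self (2 * √(-weberParam (wellD (V i) (ρ i) (a i))))
    have h4 := Real.sqrt_nonneg (-weberParam (wellD (V i) (ρ i) (a i)))
    exact pow_le_pow_left₀ h4 (by linarith) 2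
  obtain ⟨C, hC, hout⟩ := exists_wkb_bound hr hR₁ hc hK (sq_nonneg M₀)
  have hfar : ∀ i x, R₁ ≤ |x| →
      1 / (deriv (langer (wellD (V i) (ρ i) (a i))) x ^ 2 * x ^ 2) *
        (1 + langer (wellD (V i) (ρ i) (a i)) x ^ 2) ≤ C ∧
      |schrodingerQAt (langer (wellD (V i) (ρ i) (a i))) x| *
        (1 + langer (wellD (V i) (ρ i) (a i)) x ^ 2) ≤ C := fun i x hx => by
    rcases le_abs.1 hx with hx | hx
    · exact hout _ _ _ _ x (hLW i).rightLanger (hβ i) hx (hright i)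
    · have := hout _ _ _ _ (-x) (hLW i).leftLanger (hβ i) hx (hleft i)
      rw [deriv_reflect, schrodingerQAt_reflect] at this
      simpa only [neg_neg, neg_sq] using this
  refine ⟨C + 1 / m' ^ 2 * (1 + M₀ ^ 2) +
    (3 * M₂ ^ 2 / (4 * m' ^ 4) + M₃ / (2 * m' ^ 3)) * (1 + M₀ ^ 2), by positivity,
    fun i => ⟨hLW i, fun x => ?_⟩⟩
  have hd := (hLW i).deriv_pos x
  -- For `|x| ≥ R₁` the WKB estimate applies. For `|x| < R₁ < R₂` all of `g`, `g''`, `g'''` are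
  -- bounded and `g'` is bounded below, and boundedness of `g` also absorbs the weight `1 + g²`.
  rcases le_or_gt R₁ |x| with hx | hx
  · obtain ⟨h1, h2⟩ := hfar i x hx
    have hC' : C ≤ C + 1 / m' ^ 2 * (1 + M₀ ^ 2) +
      (3 * M₂ ^ 2 / (4 * m' ^ 4) + M₃ / (2 * m' ^ 3)) * (1 + M₀ ^ 2) := by
      rw [add_assoc]; exact le_add_of_nonneg_right (by positivity)
    refine ⟨(le_trans ?_ h1).trans hC', h2.trans hC'⟩
    have hx0 : 0 < x ^ 2 := by rw [← sq_abs]; exact pow_pos (by linarith) 2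
    gcongr
    linarith
  · have hx2 : x ∈ Ioo (-R₂) R₂ := by
      have := abs_lt.1 hx
      exact ⟨by linarith, by linarith⟩
    have hm1 := hg' i x hx2
    have e0 : langer (wellD (V i) (ρ i) (a i)) x ^ 2 ≤ M₀ ^ 2 := by
      rw [← sq_abs]; exact pow_le_pow_left₀ (abs_nonneg _) (hb₀ i x hx2) 2
    have e2 : deriv (deriv (langer (wellD (V i) (ρ i) (a i)))) x ^ 2 ≤ M₂ ^ 2 := by
      rw [← sq_abs]; exact pow_le_pow_left₀ (abs_nonneg _) (hb₂ i x hx2) 2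
    have e3 := hb₃ i x hx2
    have p1 : 1 / (deriv (langer (wellD (V i) (ρ i) (a i))) x ^ 2 * (1 + x ^ 2)) *
        (1 + langer (wellD (V i) (ρ i) (a i)) x ^ 2) ≤ 1 / m' ^ 2 * (1 + M₀ ^ 2) := by
      gcongr
      calc m' ^ 2 = m' ^ 2 * 1 := (mul_one _).symm
        _ ≤ _ := by gcongr; linarith [sq_nonneg x]
    have p2 : |schrodingerQAt (langer (wellD (V i) (ρ i) (a i))) x| *
        (1 + langer (wellD (V i) (ρ i) (a i)) x ^ 2) ≤
        (3 * M₂ ^ 2 / (4 * m' ^ 4) + M₃ / (2 * m' ^ 3)) * (1 + M₀ ^ 2) := by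
      gcongr
      rw [schrodingerQAt, iteratedDeriv_two, iteratedDeriv_three]
      refine (abs_add_le _ _).trans ?_
      rw [neg_div, abs_neg, abs_div, abs_div, abs_of_nonneg (by positivity : 0 ≤
        3 * deriv (deriv (langer (wellD (V i) (ρ i) (a i)))) x ^ 2),
        abs_of_pos (by positivity : 0 < 4 * deriv (langer (wellD (V i) (ρ i) (a i))) x ^ 4),
        abs_of_pos (by positivity : 0 < 2 * deriv (langer (wellD (V i) (ρ i) (a i))) x ^ 3)]
      gcongr
    have q1 : 0 ≤ 1 / m' ^ 2 * (1 + M₀ ^ 2) := by positivity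
    have q2 : 0 ≤ (3 * M₂ ^ 2 / (4 * m' ^ 4) + M₃ / (2 * m' ^ 3)) * (1 + M₀ ^ 2) := by positivity
    constructor <;> linarith

theorem LangerWellDefined.langer_invFun {D : ℝ → ℝ} (h : LangerWellDefined D) (y : ℝ) :
    langer D (Function.invFun (langer D) y) = y :=
  Function.rightInverse_invFun h.bijective.2 y

end Weber

/-! ### The Zakharov–Shabat system -/

namespace Weber

theorem exists_forall_abs_ge_of_cocompact {P : ℝ → Prop} (h : ∀ᶠ x in cocompact ℝ, P x) :
    ∃ R, 0 < R ∧ ∀ x, R ≤ |x| → P x := by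
  obtain ⟨t, ht, hP⟩ := mem_cocompact.1 h
  obtain ⟨R, hR, hsub⟩ := ht.isBounded.subset_ball_lt 0 0
  refine ⟨R, hR, fun x hx => hP fun hxt => ?_⟩
  have := hsub hxt
  rw [mem_ball_zero_iff, Real.norm_eq_abs] at this
  linarith

theorem exists_one_add_sq_mul_le {h : ℝ → ℝ} (hc : Continuous h)
    (hO : h =O[cocompact ℝ] fun x => |x| ^ (-2 : ℝ)) :
    ∃ M, 0 < M ∧ ∀ x, (1 + x ^ 2) * |h x| ≤ M := by
  obtain ⟨K, hK, hO⟩ := hO.exists_pos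
  obtain ⟨R, hR, hfar⟩ := exists_forall_abs_ge_of_cocompact hO.bound
  have hcont : Continuous fun x => (1 + x ^ 2) * |h x| := by fun_prop
  obtain ⟨B, hB⟩ := (isCompact_Icc (a := -(R + 1)) (b := R + 1)).exists_bound_of_continuousOn
    hcont.continuousOn
  refine ⟨max B (2 * K), lt_max_of_lt_right (by positivity), fun x => ?_⟩
  rcases le_or_gt |x| (R + 1) with hx | hx
  · exact (le_abs_self _).trans ((hB x (abs_le.1 hx)).trans (le_max_left _ _))
  · have h1 : (0 : ℝ) < |x| := by linarith
    have h2 := hfar x (by linarith)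
    rw [Real.norm_eq_abs, Real.norm_eq_abs, abs_of_pos (Real.rpow_pos_of_pos h1 _),
      Real.rpow_neg h1.le, Real.rpow_two, sq_abs] at h2
    refine le_trans ?_ (le_max_right _ _)
    have hx2 : 1 ≤ x ^ 2 := by
      rw [← sq_abs]; nlinarith
    calc (1 + x ^ 2) * |h x| ≤ (2 * x ^ 2) * (K * (x ^ 2)⁻¹) := by gcongr; linarith
      _ = 2 * K := by
        have : x ^ 2 ≠ 0 := by positivity
        generalize x ^ 2 = t at this
        field_simp

theorem isBigO_sq_of_rpow_neg_one {h : ℝ → ℝ} (hO : h =O[cocompact ℝ] fun x => |x| ^ (-1 : ℝ)) :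
    (fun x => h x ^ 2) =O[cocompact ℝ] fun x => |x| ^ (-2 : ℝ) := by
  refine (hO.pow 2).congr_right fun x => ?_
  rw [← Real.rpow_natCast, ← Real.rpow_mul (abs_nonneg x)]
  norm_num

/-- Far-field control of the product `(p - l) (l - q)`. -/
theorem farWKB_mul {p q : ℝ → ℝ} {l r R c M : ℝ} (hp : ContDiff ℝ 2 p) (hq : ContDiff ℝ 2 q)
    (hc : 0 < c) (hrR : r ≤ R) (hr : 0 < r) (hM : 0 < M) (hpl : ∀ x, |p x - l| ≤ 2)
    (hlq : ∀ x, |l - q x| ≤ 2) (hlow : ∀ x, r ≤ |x| → c ≤ (p x - l) * (l - q x))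
    (hp1 : ∀ x, (1 + x ^ 2) * |deriv p x ^ 2| ≤ M) (hq1 : ∀ x, (1 + x ^ 2) * |deriv q x ^ 2| ≤ M)
    (hp2 : ∀ x, (1 + x ^ 2) * |deriv (deriv p) x| ≤ M)
    (hq2 : ∀ x, (1 + x ^ 2) * |deriv (deriv q) x| ≤ M) :
    FarWKB (fun x => (p x - l) * (l - q x)) r R c ((8 + 10 * M) / c) := by
  have hd : ∀ f : ℝ → ℝ, ContDiff ℝ 2 f → ∀ x, HasDerivAt f (deriv f x) x ∧
      HasDerivAt (deriv f) (deriv (deriv f) x) x := fun f hf x =>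
    ⟨(hf.differentiable (by norm_num) x).hasDerivAt,
      ((hf.deriv' (n := 1)).differentiable (by norm_num) x).hasDerivAt⟩
  have e1 : deriv (fun x => (p x - l) * (l - q x)) =
      fun x => deriv p x * (l - q x) + (p x - l) * (-deriv q x) := by
    funext x
    exact (((hd p hp x).1.sub_const l).mul ((hd q hq x).1.const_sub l)).deriv
  have e2 : ∀ x, deriv (deriv (fun x => (p x - l) * (l - q x))) x =
      deriv (deriv p) x * (l - q x) - 2 * (deriv p x * deriv q x) -
        (p x - l) * deriv (deriv q) x := by
    intro x
    rw [e1]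
    have h1 := ((hd p hp x).2.mul ((hd q hq x).1.const_sub l)).add
      (((hd p hp x).1.sub_const l).mul (hd q hq x).2.neg)
    refine (h1.congr_deriv ?_).deriv
    rw [Pi.neg_apply]
    ring
  -- Each quantity to be bounded turns out to be at most `8 + 10 M`: at most 4 for the product, `4 +
  -- 4M` and `6M` for the weighted derivatives. Since `f ≥ c`, this is at most `K f`.
  have hK : ∀ x, R ≤ x → 8 + 10 * M ≤ (8 + 10 * M) / c * ((p x - l) * (l - q x)) := by
    intro x hx
    have h1 := hlow x ((hrR.trans hx).trans (le_abs_self x))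
    calc 8 + 10 * M = (8 + 10 * M) / c * c := by field_simp
      _ ≤ _ := by gcongr
  have hx1 : ∀ f : ℝ → ℝ, (∀ x, (1 + x ^ 2) * |deriv f x ^ 2| ≤ M) → ∀ x,
      (x * deriv f x) ^ 2 ≤ M := fun f hf x => by
    have := hf x
    rw [abs_of_nonneg (sq_nonneg _)] at this
    nlinarith [sq_nonneg (deriv f x)]
  have hx2 : ∀ f : ℝ → ℝ, (∀ x, (1 + x ^ 2) * |deriv (deriv f) x| ≤ M) → ∀ x,
      |x ^ 2 * deriv (deriv f) x| ≤ M := fun f hf x => by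
    have := hf x
    rw [abs_mul, abs_of_nonneg (sq_nonneg _)]
    nlinarith [abs_nonneg (deriv (deriv f) x)]
  have habs : ∀ t : ℝ, |t| ≤ 1 + t ^ 2 := fun t => by
    rw [← sq_abs]; nlinarith [sq_nonneg (|t| - 1)]
  refine ⟨fun s hs => hlow s (hs.trans (le_abs_self s)), fun x hx s _ => le_trans ?_ (hK x hx),
    fun x hx => le_trans ?_ (hK x hx), fun x hx => le_trans ?_ (hK x hx)⟩
  · refine (le_abs_self _).trans ?_
    rw [abs_mul]
    have := mul_le_mul (hpl s) (hlq s) (abs_nonneg _) (by norm_num)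
    linarith
  · have hx0 : 0 < x := by linarith
    rw [← abs_of_pos hx0, ← abs_mul, abs_of_pos hx0, e1]
    have a1 := (habs (x * deriv p x)).trans (add_le_add le_rfl (hx1 p hp1 x))
    have a2 := (habs (x * deriv q x)).trans (add_le_add le_rfl (hx1 q hq1 x))
    have b1 := mul_le_mul a1 (hlq x) (abs_nonneg _) (by positivity)
    have b2 := mul_le_mul a2 (hpl x) (abs_nonneg _) (by positivity)
    rw [← abs_mul] at b1 b2
    calc _ = |x * deriv p x * (l - q x) - x * deriv q x * (p x - l)| := by ring_nf
      _ ≤ (1 + M) * 2 + (1 + M) * 2 := (abs_sub _ _).trans (add_le_add b1 b2)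
      _ ≤ _ := by linarith
  · rw [← abs_of_nonneg (sq_nonneg x), ← abs_mul, e2]
    have b1 := mul_le_mul (hx2 p hp2 x) (hlq x) (abs_nonneg _) (by positivity)
    have b2 := mul_le_mul (hx2 q hq2 x) (hpl x) (abs_nonneg _) (by positivity)
    have b3 : |2 * (x * deriv p x) * (x * deriv q x)| ≤ 2 * M := by
      have h1 := hx1 p hp1 x
      have h2 := hx1 q hq1 x
      rw [abs_le]
      constructor <;> nlinarith [sq_nonneg (x * deriv p x + x * deriv q x),
        sq_nonneg (x * deriv p x - x * deriv q x)]
    rw [← abs_mul] at b1 b2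
    calc _ = |x ^ 2 * deriv (deriv p) x * (l - q x) - 2 * (x * deriv p x) * (x * deriv q x) -
          x ^ 2 * deriv (deriv q) x * (p x - l)| := by ring_nf
      _ ≤ M * 2 + 2 * M + M * 2 := (abs_sub _ _).trans
          (add_le_add ((abs_sub _ _).trans (add_le_add b1 b3)) b2)
      _ ≤ _ := by linarith

theorem detFun_zakharovShabatB (A S : ℝ → ℝ) (l x : ℝ) :
    detFun (zakharovShabatB A S l) x = (l - rPlus A S x) * (l - rMinus A S x) := by
  have : (zakharovShabatB A S l x).det =
      (((l - rPlus A S x) * (l - rMinus A S x) : ℝ) : ℂ) := by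
    rw [zakharovShabatB, Matrix.det_fin_two_of, rPlus, rMinus]
    push_cast
    linear_combination (-((l : ℂ) + deriv S x / 2) ^ 2) * Complex.I_sq
  rw [detFun, this, Complex.ofReal_re]

theorem deriv_comp_neg_fun (f : ℝ → ℝ) : deriv (fun x => f (-x)) = fun x => -deriv f (-x) :=
  funext fun x => deriv_comp_neg f x

theorem deriv2_comp_neg (f : ℝ → ℝ) :
    deriv (deriv fun x => f (-x)) = fun x => deriv (deriv f) (-x) := by
  funext x
  rw [deriv_comp_neg_fun, deriv.fun_neg, deriv_comp_neg, neg_neg]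

namespace ZakharovShabatHypotheses

variable {A S : ℝ → ℝ}

theorem plus_zero_lt (h : ZakharovShabatHypotheses A S) {x : ℝ} (hx : x ≠ 0) :
    rPlus A S 0 < rPlus A S x := by
  have hc := h.contDiff_plus.continuous.continuousOn (s := univ)
  rcases lt_or_gt_of_ne hx with hx | hx
  · have := strictAntiOn_of_deriv_neg (convex_Iic 0) (hc.mono (subset_univ _))
      (fun y hy => h.deriv_neg y (by simpa using hy))
    exact this hx.le (mem_Iic.2 le_rfl) hx
  · have := strictMonoOn_of_deriv_pos (convex_Ici 0) (hc.mono (subset_univ _))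
      (fun y hy => h.deriv_pos y (by simpa using hy))
    exact this (mem_Ici.2 le_rfl) hx.le hx

theorem iInf_plus (h : ZakharovShabatHypotheses A S) : ⨅ x, rPlus A S x = rPlus A S 0 :=
  le_antisymm (ciInf_le h.bddBelow_plus 0) (le_ciInf fun x => by
    rcases eq_or_ne x 0 with rfl | hx
    · exact le_rfl
    · exact (h.plus_zero_lt hx).le)

/-- The well of the Zakharov-Shabat system at energy `l`. -/
theorem well (h : ZakharovShabatHypotheses A S) {l : ℝ} (hl : rPlus A S 0 < l) (hl1 : l < 1) :
    Well (fun x => rPlus A S x - rPlus A S 0) (fun x => l - rMinus A S x)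
      √(l - rPlus A S 0) := by
  have hd : deriv (fun x => rPlus A S x - rPlus A S 0) = deriv (rPlus A S) := by
    funext x; rw [deriv_sub_const]
  obtain ⟨R, hR, hfar⟩ := exists_forall_abs_ge_of_cocompact
    (h.tendsto_plus.eventually (lt_mem_nhds hl1))
  have hsq : √(l - rPlus A S 0) ^ 2 = l - rPlus A S 0 := Real.sq_sqrt (by linarith)
  have hgap := h.gap
  rw [h.iInf_plus] at hgap
  exact
  { contDiff := h.contDiff_plus.sub contDiff_const
    zero := sub_self _
    deriv_zero := by rw [hd]; exact h.deriv_zero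
    deriv2_zero := by rw [hd, ← iteratedDeriv_two]; exact h.deriv2_zero
    deriv_pos := by rw [hd]; exact h.deriv_pos
    deriv_neg := by rw [hd]; exact h.deriv_neg
    contDiff_factor := (contDiff_const.sub h.contDiff_minus).of_le (by norm_num)
    factor_pos := fun x => by linarith [le_ciSup h.bddAbove_minus x]
    energy_pos := Real.sqrt_pos.2 (by linarith)
    exceed_right := ⟨R, hR, by rw [hsq]; linarith [hfar R (le_abs_self R)]⟩
    exceed_left := ⟨-R, by linarith, by
      rw [hsq]; linarith [hfar (-R) (by rw [abs_neg]; exact le_abs_self R)]⟩ }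

theorem detFun_eq_wellD {l : ℝ} (hl : rPlus A S 0 < l) :
    detFun (zakharovShabatB A S l) = wellD (fun x => rPlus A S x - rPlus A S 0)
      (fun x => l - rMinus A S x) √(l - rPlus A S 0) := by
  funext x
  rw [detFun_zakharovShabatB, wellD, Real.sq_sqrt (by linarith)]
  ring

/-- The well `r₊ - r₊(0)` does not depend on the energy; only `a` and the smooth factor `λ - r₋ ≥ γ`
do. The additional `R₊` term of `Q` is `O(1/(1 + x²))` over `g'²`, which the first bound of
`exists_langer_bound` turns into `O(1/(1 + y²))`. -/
theorem exists_bound (h : ZakharovShabatHypotheses A S) {lmax : ℝ}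
    (hl0 : (⨅ x, rPlus A S x) < lmax) (hl1 : lmax < 1) :
    ∃ C : ℝ, 0 < C ∧ ∀ l : ℝ, (⨅ x, rPlus A S x) < l → l ≤ lmax →
      LangerWellDefined (detFun (zakharovShabatB A S l)) ∧
      ∀ y : ℝ, |zakharovShabatQ A S l y| ≤ C / (1 + y ^ 2) := by
  have hgap := h.gap
  rw [h.iInf_plus] at hl0 hgap ⊢
  set p := rPlus A S with hp
  set q := rMinus A S with hq
  set γ := p 0 - ⨆ x, q x with hγ
  have hγ0 : 0 < γ := by linarith
  have hqle : ∀ x, q x ≤ p 0 - γ := fun x => by linarith [le_ciSup h.bddAbove_minus x]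
  have hpge : ∀ x, p 0 ≤ p x := fun x => by
    have := ciInf_le h.bddBelow_plus x
    rwa [h.iInf_plus] at this
  have hp5 : ContDiff ℝ 5 p := h.contDiff_plus
  have hq5 : ContDiff ℝ 5 q := h.contDiff_minus
  have hcd : ∀ f : ℝ → ℝ, ContDiff ℝ 5 f → Continuous (deriv f) ∧ Continuous (deriv (deriv f)) :=
    fun f hf => ⟨(hf.of_le (by norm_num : (1 : WithTop ℕ∞) ≤ 5)).continuous_deriv le_rfl,
      ((hf.of_le (by norm_num : (1 + 1 : WithTop ℕ∞) ≤ 5)).deriv').continuous_deriv le_rfl⟩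
  have hO2p : deriv (deriv p) =O[cocompact ℝ] fun x => |x| ^ (-2 : ℝ) :=
    iteratedDeriv_two p ▸ h.deriv2_plus
  have hO2q : deriv (deriv q) =O[cocompact ℝ] fun x => |x| ^ (-2 : ℝ) :=
    iteratedDeriv_two q ▸ h.deriv2_minus
  obtain ⟨M₁, -, hM₁⟩ := exists_one_add_sq_mul_le ((hcd p hp5).1.pow 2)
    (isBigO_sq_of_rpow_neg_one h.deriv_plus)
  obtain ⟨M₂, -, hM₂⟩ := exists_one_add_sq_mul_le ((hcd q hq5).1.pow 2)
    (isBigO_sq_of_rpow_neg_one h.deriv_minus)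
  obtain ⟨M₃, hM₃0, hM₃⟩ := exists_one_add_sq_mul_le (hcd p hp5).2 hO2p
  obtain ⟨M₄, -, hM₄⟩ := exists_one_add_sq_mul_le (hcd q hq5).2 hO2q
  obtain ⟨M, hM0, h1M, h2M, h3M, h4M⟩ : ∃ M, 0 < M ∧ M₁ ≤ M ∧ M₂ ≤ M ∧ M₃ ≤ M ∧ M₄ ≤ M :=
    ⟨max (max M₁ M₂) (max M₃ M₄), lt_max_of_lt_right (lt_max_of_lt_left hM₃0), by simp, by simp,
      by simp, by simp⟩
  replace hM₁ := fun x => (hM₁ x).trans h1M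
  replace hM₂ := fun x => (hM₂ x).trans h2M
  replace hM₃ := fun x => (hM₃ x).trans h3M
  replace hM₄ := fun x => (hM₄ x).trans h4M
  obtain ⟨r, hr, hfar⟩ := exists_forall_abs_ge_of_cocompact
    (h.tendsto_plus.eventually (lt_mem_nhds (show (1 + lmax) / 2 < 1 by linarith)))
  -- For `|x| ≥ r` one has `r₊ > (1 + lmax)/2`, so `r₊ - λ` exceeds `(1 - lmax)/2`; the other factor
  -- is at least `γ`.
  set c := (1 - lmax) / 2 * γ with hc
  have hc0 : 0 < c := mul_pos (by linarith) hγ0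
  let ι := {l : ℝ // p 0 < l ∧ l ≤ lmax}
  have hWell : ∀ i : ι, Well (fun x => p x - p 0) (fun x => i.1 - q x) √(i.1 - p 0) :=
    fun i => h.well i.2.1 (by linarith [i.2.2])
  have hopen : ∀ i : ι, IsOpen (Ioo (-(r + 2)) (r + 2)) := fun _ => isOpen_Ioo
  obtain ⟨m, hm, hZ⟩ := (hWell ⟨lmax, hl0, le_rfl⟩).exists_wellZ_ge (r + 2)
  have hlow : ∀ (i : ι) x, r ≤ |x| → c ≤ (p x - i.1) * (i.1 - q x) := fun i x hx =>
    mul_le_mul (by linarith [hfar x hx, i.2.2]) (by linarith [hqle x, i.2.1]) hγ0.le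
      (by linarith [hfar x hx, i.2.2])
  have hq0 : -1 ≤ q 0 := h.minus_ge 0
  have hp2 : ∀ (i : ι) x, |p x - i.1| ≤ 2 := fun i x => by
    have := h.plus_le x
    rw [abs_le]
    constructor <;> linarith [hpge x, i.2.1, i.2.2, hqle 0]
  have hq2 : ∀ (i : ι) x, |i.1 - q x| ≤ 2 := fun i x => by
    have := h.minus_ge x
    rw [abs_le]
    constructor <;> linarith [hqle x, i.2.1, i.2.2]
  have hcd2 : ∀ f : ℝ → ℝ, ContDiff ℝ 5 f → ContDiff ℝ 2 f := fun f hf => hf.of_le (by norm_num)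
  have hneg : ∀ (i : ι) x, -wellD (fun x => p x - p 0) (fun x => i.1 - q x) √(i.1 - p 0) x =
      (p x - i.1) * (i.1 - q x) := fun i x => by
    rw [wellD, Real.sq_sqrt (by linarith [i.2.1])]; ring
  have hright : ∀ i : ι, FarWKB (fun x => -wellD (fun x => p x - p 0) (fun x => i.1 - q x)
      √(i.1 - p 0) x) r (r + 1) c ((8 + 10 * M) / c) := fun i => by
    simp only [hneg]
    exact farWKB_mul (hcd2 p hp5) (hcd2 q hq5) hc0 (by linarith) hr hM0 (hp2 i) (hq2 i) (hlow i)
      hM₁ hM₂ hM₃ hM₄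
  have hleft : ∀ i : ι, FarWKB (fun x => -wellD (fun x => p x - p 0) (fun x => i.1 - q x)
      √(i.1 - p 0) (-x)) r (r + 1) c ((8 + 10 * M) / c) := fun i => by
    simp only [hneg]
    refine farWKB_mul (p := fun x => p (-x)) (q := fun x => q (-x))
      ((hcd2 p hp5).comp contDiff_neg) ((hcd2 q hq5).comp contDiff_neg) hc0 (by linarith) hr hM0
      (fun x => hp2 i _) (fun x => hq2 i _) (fun x hx => hlow i _ (by rwa [abs_neg])) ?_ ?_ ?_ ?_
    · intro x; rw [deriv_comp_neg, neg_sq, ← neg_sq x]; exact hM₁ (-x)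
    · intro x; rw [deriv_comp_neg, neg_sq, ← neg_sq x]; exact hM₂ (-x)
    · intro x; rw [deriv2_comp_neg, ← neg_sq x]; exact hM₃ (-x)
    · intro x; rw [deriv2_comp_neg, ← neg_sq x]; exact hM₄ (-x)
  obtain ⟨C, hC, hmain⟩ := exists_langer_bound (ι := ι) (V := fun _ x => p x - p 0)
    (ρ := fun i x => i.1 - q x) (a := fun i => √(i.1 - p 0)) (r := r) (R₁ := r + 1) (R₂ := r + 2)
    (m := min m γ) hWell
    (((hWell ⟨lmax, hl0, le_rfl⟩).unifC_deriv2 (r + 2)).reindex fun _ => ())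
    (UnifC.sub hopen (UnifC.const hopen (c := fun i : ι => i.1) (M := |p 0| + |lmax|) fun i => by
        rw [abs_le]
        constructor <;> linarith [neg_abs_le (p 0), i.2.1, i.2.2, le_abs_self lmax,
          abs_nonneg lmax, abs_nonneg (p 0)])
      ((UnifC.of_contDiff (k := 3) (f := q) (hq5.of_le (by norm_num)) (r + 2)).reindex
        fun _ => ()))
    (lt_min hm hγ0) (fun _ x hx => (min_le_left _ _).trans (hZ x hx))
    (fun i x _ => (min_le_right _ _).trans (by linarith [hqle x, i.2.1])) hr (by linarith)
    (by linarith) hc0 (by positivity) hright hleft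
  refine ⟨C + C * (3 * M / (4 * γ ^ 2) + M / (2 * γ)), by positivity, fun l hl hl' => ?_⟩
  obtain ⟨hLW, hb⟩ := hmain ⟨l, hl, hl'⟩
  simp only at hLW hb
  rw [← detFun_eq_wellD hl] at hLW hb
  refine ⟨hLW, fun y => ?_⟩
  rw [le_div_iff₀ (by positivity), zakharovShabatQ]
  obtain ⟨hb1, hb2⟩ := hb (Function.invFun (langer (detFun (zakharovShabatB A S l))) y)
  have hgd := hLW.deriv_pos (Function.invFun (langer (detFun (zakharovShabatB A S l))) y)
  rw [hLW.langer_invFun] at hb1 hb2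
  generalize Function.invFun (langer (detFun (zakharovShabatB A S l))) y = x at *
  generalize langer (detFun (zakharovShabatB A S l)) = g at *
  have hR1 : deriv (fun x => l - q x) = fun x => -deriv q x := by
    funext x; rw [deriv_const_sub]
  have hR2 : iteratedDeriv 2 (fun x => l - q x) x = -deriv (deriv q) x := by
    rw [iteratedDeriv_two, hR1, deriv.fun_neg]
  have hRγ : γ ≤ l - q x := by linarith [hqle x]
  have hR0 : 0 < l - q x := hγ0.trans_le hRγ
  set E := -(3 * deriv (fun x => l - q x) x ^ 2) / (4 * (l - q x) ^ 2) +
    iteratedDeriv 2 (fun x => l - q x) x / (2 * (l - q x)) with hE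
  have hEle : (1 + x ^ 2) * |E| ≤ 3 * M / (4 * γ ^ 2) + M / (2 * γ) := by
    have u1 : (1 + x ^ 2) * |deriv q x ^ 2| ≤ M := hM₂ x
    have u2 := hM₄ x
    rw [abs_of_nonneg (sq_nonneg _)] at u1
    rw [hE, hR1, hR2, neg_sq]
    have : |-(3 * deriv q x ^ 2) / (4 * (l - q x) ^ 2) + -deriv (deriv q) x / (2 * (l - q x))| ≤
        3 * deriv q x ^ 2 / (4 * γ ^ 2) + |deriv (deriv q) x| / (2 * γ) := by
      refine (abs_add_le _ _).trans (add_le_add ?_ ?_)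
      · rw [neg_div, abs_neg, abs_of_nonneg (by positivity)]
        gcongr
      · rw [abs_div, abs_neg, abs_of_pos (by positivity : 0 < 2 * (l - q x))]
        gcongr
    calc _ ≤ (1 + x ^ 2) * (3 * deriv q x ^ 2 / (4 * γ ^ 2) + |deriv (deriv q) x| / (2 * γ)) := by
          gcongr
      _ = 3 * ((1 + x ^ 2) * deriv q x ^ 2) / (4 * γ ^ 2) +
          ((1 + x ^ 2) * |deriv (deriv q) x|) / (2 * γ) := by ring
      _ ≤ _ := by gcongr
  have hQ : zakharovShabatQAt g (fun x => l - q x) x =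
      schrodingerQAt g x - 1 / deriv g x ^ 2 * E := rfl
  have hpos : 0 < 1 + x ^ 2 := by positivity
  calc |zakharovShabatQAt g (fun x => l - q x) x| * (1 + y ^ 2)
      ≤ (|schrodingerQAt g x| + |1 / deriv g x ^ 2 * E|) * (1 + y ^ 2) := by
        rw [hQ]; gcongr; exact abs_sub _ _
    -- Multiplying and dividing by `1 + x²` pairs `1/g'²` with its far-field decay and `E` with its
    -- own.
    _ = |schrodingerQAt g x| * (1 + y ^ 2) +
        (1 / (deriv g x ^ 2 * (1 + x ^ 2)) * (1 + y ^ 2)) * ((1 + x ^ 2) * |E|) := by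
        rw [abs_mul, abs_of_pos (by positivity : 0 < 1 / deriv g x ^ 2)]
        field_simp
    _ ≤ _ := by gcongr

end ZakharovShabatHypotheses

end Weber

/-! ### The Schrödinger equation -/

namespace Weber

theorem wellZ_ge {V : ℝ → ℝ} {R m : ℝ} (hV : ContDiff ℝ 2 V)
    (hm : ∀ x ∈ Ioo (-R) R, m ≤ deriv (deriv V) x) {x : ℝ} (hx : x ∈ Ioo (-R) R) :
    m ≤ wellZ V x := by
  have hc : Continuous (deriv (deriv V)) :=
    (hV.deriv' (n := 1)).continuous_deriv le_rfl
  have hR : 0 < R := by linarith [hx.1, hx.2]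
  have := intervalIntegral.integral_mono_on (μ := volume) zero_le_one (f := fun _ => m)
    (g := fun t => deriv (deriv V) (t * x)) intervalIntegrable_const
    ((by fun_prop : Continuous fun t => deriv (deriv V) (t * x)).intervalIntegrable _ _)
    (fun t ht => hm _ (by
      rw [mem_Ioo, ← abs_lt, abs_mul, abs_of_nonneg ht.1]
      have h1 := abs_lt.2 hx
      have h2 := ht.2
      nlinarith [abs_nonneg x]))
  simpa [wellZ] using this

/-- Power growth, uniform in the parameter, turns bounds on the first two derivatives by powers
into bounds by the function itself. -/
theorem exists_deriv_le_self {U : ℝ → ℝ → ℝ} {I : Set ℝ} {UPlus : ℝ → ℝ} {p r v : ℝ}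
    (hr : 0 < r) (hv : 0 < v) (hp : 0 ≤ p) (hUP : ∀ l ∈ I, 0 < UPlus l)
    (hmono : ∀ l ∈ I, MonotoneOn (fun x => U x l) (Ici 0)) (hvU : ∀ l ∈ I, v ≤ U r l)
    (hgrowth : TendstoUniformlyOn (fun x l => U x l / (UPlus l * |x| ^ p)) (fun _ => 1) atTop I)
    (hbound : ∃ c : ℝ, ∀ l ∈ I, ∀ x, r ≤ x →
      |deriv (fun x => U x l) x| ≤ c * |x| ^ (p - 1) ∧
      |deriv (deriv (fun x => U x l)) x| ≤ c * |x| ^ (p - 2)) :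
    ∃ K, 0 < K ∧ ∀ l ∈ I, ∀ x, r ≤ x → x * |deriv (fun x => U x l) x| ≤ K * U x l ∧
      x ^ 2 * |deriv (deriv (fun x => U x l)) x| ≤ K * U x l := by
  obtain ⟨c, hc⟩ := hbound
  obtain ⟨x₁, hx₁⟩ := eventually_atTop.1 (Metric.tendstoUniformlyOn_iff.1 hgrowth (1 / 2)
    (by norm_num))
  set x₀ := max x₁ r with hx₀
  have hx₀r : r ≤ x₀ := le_max_right _ _
  have hx₀0 : 0 < x₀ := hr.trans_le hx₀r
  have hgr : ∀ l ∈ I, ∀ x, x₀ ≤ x → UPlus l * x ^ p / 2 ≤ U x l ∧ U x l ≤ 2 * (UPlus l * x ^ p) := by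
    intro l hl x hx
    have hx0 : 0 < x := hx₀0.trans_le hx
    have h1 := hx₁ x ((le_max_left _ _).trans hx) l hl
    rw [Real.dist_eq, abs_of_pos hx0, abs_lt] at h1
    have h2 : 0 < UPlus l * x ^ p := mul_pos (hUP l hl) (Real.rpow_pos_of_pos hx0 p)
    have h3 : U x l / (UPlus l * x ^ p) * (UPlus l * x ^ p) = U x l := div_mul_cancel₀ _ h2.ne'
    constructor <;> nlinarith
  have hx₀p : 0 < x₀ ^ p := Real.rpow_pos_of_pos hx₀0 p
  -- The leading coefficient is only assumed positive at each energy. Evaluating the growth law at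
  -- `x₀`, where `v ≤ U ≤ 2 UPlus x₀^p`, bounds it below uniformly, so that `w ≤ UPlus/2`; between
  -- `r` and `x₀` monotonicity gives `U ≥ v`.
  set w := v / (4 * x₀ ^ p) with hw
  have hw0 : 0 < w := by positivity
  have hlow : ∀ l ∈ I, ∀ x, r ≤ x → w * x ^ p ≤ U x l := by
    intro l hl x hx
    have hx0 : 0 < x := hr.trans_le hx
    have hvx : ∀ z, r ≤ z → v ≤ U z l := fun z hz =>
      (hvU l hl).trans (hmono l hl hr.le (hr.le.trans hz) hz)
    rcases le_total x₀ x with h1 | h1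
    · have h2 := (hgr l hl x₀ le_rfl).2
      have h3 := (hgr l hl x h1).1
      have h4 : w ≤ UPlus l / 2 := by
        rw [hw, div_le_iff₀ (by positivity)]
        linarith [hvx x₀ hx₀r]
      have h5 := mul_le_mul_of_nonneg_right h4 (Real.rpow_nonneg hx0.le p)
      linarith
    · have h2 : x ^ p ≤ x₀ ^ p := Real.rpow_le_rpow hx0.le h1 hp
      calc w * x ^ p ≤ w * x₀ ^ p := by gcongr
        _ = v / 4 := by rw [hw]; field_simp
        _ ≤ U x l := by linarith [hvx x hx]
  refine ⟨(|c| + 1) / w, by positivity, fun l hl x hx => ?_⟩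
  have hx0 : 0 < x := hr.trans_le hx
  obtain ⟨h1, h2⟩ := hc l hl x hx
  rw [abs_of_pos hx0] at h1 h2
  have hxp := Real.rpow_pos_of_pos hx0 p
  have hfin : |c| * x ^ p ≤ (|c| + 1) / w * U x l := by
    calc |c| * x ^ p ≤ (|c| + 1) * x ^ p := by gcongr; linarith
      _ = (|c| + 1) / w * (w * x ^ p) := by field_simp
      _ ≤ _ := by gcongr; exact hlow l hl x hx
  have hcle : ∀ t : ℝ, 0 ≤ t → c * t ≤ |c| * t := fun t ht =>
    mul_le_mul_of_nonneg_right (le_abs_self c) ht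
  constructor
  · calc x * |deriv (fun x => U x l) x| ≤ x * (|c| * x ^ (p - 1)) := by
          gcongr; exact h1.trans (hcle _ (Real.rpow_nonneg hx0.le _))
      _ = |c| * x ^ p := by
          rw [Real.rpow_sub_one hx0.ne']; field_simp
      _ ≤ _ := hfin
  · calc x ^ 2 * |deriv (deriv (fun x => U x l)) x| ≤ x ^ 2 * (|c| * x ^ (p - 2)) := by
          gcongr; exact h2.trans (hcle _ (Real.rpow_nonneg hx0.le _))
      _ = |c| * x ^ p := by
          rw [Real.rpow_sub hx0, Real.rpow_two]; field_simp
      _ ≤ _ := hfin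

/-- The energy is at most half of `U` on `[r, ∞)`, hence `U ≤ 2 (U - l)` there and bounds by `U`
become bounds by `U - l`. -/
theorem farWKB_sub {U : ℝ → ℝ} {l r v K : ℝ} (hr : 0 < r) (hv : 0 < v) (hK : 0 < K)
    (hlv : l ≤ v / 2) (hmono : MonotoneOn U (Ici 0)) (hvU : v ≤ U r)
    (h1 : ∀ x, r ≤ x → x * |deriv U x| ≤ K * U x)
    (h2 : ∀ x, r ≤ x → x ^ 2 * |deriv (deriv U) x| ≤ K * U x) :
    FarWKB (fun x => U x - l) r (2 * r) (v / 2) (2 * K + 2) := by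
  have hd : deriv (fun x => U x - l) = deriv U := by
    funext x; rw [deriv_sub_const]
  have hvx : ∀ z, r ≤ z → v ≤ U z := fun z hz => hvU.trans (hmono hr.le (hr.le.trans hz) hz)
  refine ⟨fun s hs => by linarith [hvx s hs], fun x hx s hs => ?_, fun x hx => ?_, fun x hx => ?_⟩
  · have := hmono hs.1 (hs.1.trans hs.2) hs.2
    nlinarith [hvx x (by linarith)]
  · rw [hd]
    have := h1 x (by linarith)
    nlinarith [hvx x (by linarith)]
  · rw [hd]
    have := h2 x (by linarith)
    nlinarith [hvx x (by linarith)]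

theorem detFun_schrodingerB (V : ℝ → ℝ → ℝ) (l x : ℝ) :
    detFun (schrodingerB V l) x = l - V x l := by
  rw [detFun, schrodingerB, Matrix.det_fin_two_of]
  simp

namespace SchrodingerHypotheses

variable {V : ℝ → ℝ → ℝ} {Λ δ pPlus pMinus : ℝ} {VPlus VMinus : ℝ → ℝ}

theorem continuousOn_iteratedDeriv (h : SchrodingerHypotheses V Λ δ pPlus pMinus VPlus VMinus)
    {n : ℕ} (hn : n ≤ 5) : ContinuousOn
      (fun q : ℝ × ℝ => iteratedDeriv n (fun x => V x q.2) q.1) (Ioo (-δ) δ ×ˢ Icc 0 Λ) := by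
  simpa using h.mixed_continuous 0 (by norm_num) n hn

theorem exists_iteratedDeriv_le (h : SchrodingerHypotheses V Λ δ pPlus pMinus VPlus VMinus)
    {n : ℕ} (hn : n ≤ 5) {r : ℝ} (hr : r < δ) :
    ∃ M, ∀ l ∈ Icc 0 Λ, ∀ x ∈ Icc (-r) r, |iteratedDeriv n (fun x => V x l) x| ≤ M := by
  obtain ⟨M, hM⟩ := ((isCompact_Icc (a := -r) (b := r)).prod
    (isCompact_Icc (a := 0) (b := Λ))).exists_bound_of_continuousOn
    ((h.continuousOn_iteratedDeriv hn).mono (prod_mono (fun x hx => ⟨by linarith [hx.1],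
      by linarith [hx.2]⟩) subset_rfl))
  exact ⟨M, fun l hl x hx => hM (x, l) ⟨hx, hl⟩⟩

theorem exists_pos_le (h : SchrodingerHypotheses V Λ δ pPlus pMinus VPlus VMinus) {n : ℕ}
    (hn : n ≤ 5) {x : ℝ} (hx : x ∈ Ioo (-δ) δ)
    (hpos : ∀ l ∈ Icc 0 Λ, 0 < iteratedDeriv n (fun x => V x l) x) :
    ∃ m, 0 < m ∧ ∀ l ∈ Icc 0 Λ, m ≤ iteratedDeriv n (fun x => V x l) x := by
  have hc : ContinuousOn (fun l => iteratedDeriv n (fun x => V x l) x) (Icc 0 Λ) :=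
    (h.continuousOn_iteratedDeriv hn).comp (f := fun l : ℝ => (x, l)) (by fun_prop)
      fun l hl => ⟨hx, hl⟩
  obtain ⟨l, hl, hmin⟩ := isCompact_Icc.exists_isMinOn (nonempty_Icc.2 h.Λ_pos.le) hc
  exact ⟨_, hpos l hl, fun l' hl' => hmin hl'⟩

/-- The second derivative at 0 is bounded below over the compact energy interval, and uniform
continuity in `(x, l)` spreads half of this bound to a neighbourhood independent of `l`. -/
theorem exists_convex_near_zero (h : SchrodingerHypotheses V Λ δ pPlus pMinus VPlus VMinus) :
    ∃ r m, 0 < r ∧ r < δ ∧ 0 < m ∧ ∀ l ∈ Icc 0 Λ, ∀ x ∈ Ioo (-r) r,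
      m ≤ deriv (deriv fun x => V x l) x := by
  have hδ := h.δ_pos
  obtain ⟨m, hm, hmin⟩ := h.exists_pos_le (n := 2) (by norm_num) (x := 0)
    ⟨by linarith, hδ⟩ h.deriv2_zero
  have huc := ((isCompact_Icc (a := -(δ / 2)) (b := δ / 2)).prod
    (isCompact_Icc (a := 0) (b := Λ))).uniformContinuousOn_of_continuous
    ((h.continuousOn_iteratedDeriv (n := 2) (by norm_num)).mono (prod_mono (fun x hx =>
      ⟨by linarith [hx.1], by linarith [hx.2]⟩) subset_rfl))
  obtain ⟨η, hη, hclose⟩ := Metric.uniformContinuousOn_iff.1 huc (m / 2) (by positivity)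
  refine ⟨min η (δ / 2), m / 2, by positivity, (min_le_right _ _).trans_lt (by linarith),
    by positivity, fun l hl x hx => ?_⟩
  have h1 := min_le_right η (δ / 2)
  have h2 := min_le_left η (δ / 2)
  have h3 := hclose (x, l) ⟨⟨by linarith [hx.1], by linarith [hx.2]⟩, hl⟩ (0, l)
    ⟨⟨by linarith, by linarith⟩, hl⟩ (by
      rw [Prod.dist_eq, dist_self, max_eq_left dist_nonneg, Real.dist_eq, sub_zero, abs_lt]
      exact ⟨by linarith [hx.1], by linarith [hx.2]⟩)
  rw [Real.dist_eq, abs_lt] at h3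
  have h4 := hmin l hl
  rw [← iteratedDeriv_two]
  linarith [h3.1]

theorem strictMonoOn (h : SchrodingerHypotheses V Λ δ pPlus pMinus VPlus VMinus) {l : ℝ}
    (hl : l ∈ Icc 0 Λ) : StrictMonoOn (fun x => V x l) (Ici 0) :=
  strictMonoOn_of_deriv_pos (convex_Ici 0) (h.contDiff l hl).continuous.continuousOn
    fun y hy => h.deriv_pos l hl y (by simpa using hy)

theorem strictAntiOn (h : SchrodingerHypotheses V Λ δ pPlus pMinus VPlus VMinus) {l : ℝ}
    (hl : l ∈ Icc 0 Λ) : StrictAntiOn (fun x => V x l) (Iic 0) :=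
  strictAntiOn_of_deriv_neg (convex_Iic 0) (h.contDiff l hl).continuous.continuousOn
    fun y hy => h.deriv_neg l hl y (by simpa using hy)

/-- The well of the Schrödinger equation at energy `l`. -/
theorem well (h : SchrodingerHypotheses V Λ δ pPlus pMinus VPlus VMinus) {l x : ℝ}
    (hl : l ∈ Icc 0 Λ) (hl0 : 0 < l) (hx : 0 < x) (hr : l < V x l) (hl' : l < V (-x) l) :
    Well (fun x => V x l) (fun _ => 1) √l where
  contDiff := h.contDiff l hl
  zero := h.zero l hl
  deriv_zero := h.deriv_zero l hl
  deriv2_zero := by rw [← iteratedDeriv_two]; exact h.deriv2_zero l hl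
  deriv_pos := h.deriv_pos l hl
  deriv_neg := h.deriv_neg l hl
  contDiff_factor := contDiff_const
  factor_pos _ := one_pos
  energy_pos := Real.sqrt_pos.2 hl0
  exceed_right := ⟨x, hx, by rwa [Real.sq_sqrt hl0.le]⟩
  exceed_left := ⟨-x, by linarith, by rwa [Real.sq_sqrt hl0.le]⟩

/-- Only small energies are treated, so that the turning points lie in the fixed neighbourhood of 0
where `V` is uniformly smooth and convex. Beyond it, power growth supplies the WKB hypotheses on
each side. -/
theorem exists_bound (h : SchrodingerHypotheses V Λ δ pPlus pMinus VPlus VMinus) :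
    ∃ l₀ : ℝ, 0 < l₀ ∧ l₀ ≤ Λ ∧ ∃ C : ℝ, 0 < C ∧ ∀ l : ℝ, 0 < l → l ≤ l₀ →
      LangerWellDefined (detFun (schrodingerB V l)) ∧
      ∀ y : ℝ, |schrodingerQ V l y| ≤ C / (1 + y ^ 2) := by
  have hΛ := h.Λ_pos
  obtain ⟨R, m, hR, hRδ, hm, hconv⟩ := h.exists_convex_near_zero
  -- This leaves room for `r < 2r < R`: the far field starts at `2r`, and the region of uniform
  -- bounds extends to `R = 4r`.
  set r := R / 4 with hr
  have hr0 : 0 < r := by positivity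
  obtain ⟨v₁, hv₁, hvr⟩ := h.exists_pos_le (n := 0) (by norm_num) (x := r)
    ⟨by linarith, by linarith⟩ fun l hl => by
      have := h.strictMonoOn hl (mem_Ici.2 le_rfl) hr0.le hr0
      simpa [h.zero l hl] using this
  obtain ⟨v₂, hv₂, hvl⟩ := h.exists_pos_le (n := 0) (by norm_num) (x := -r)
    ⟨by linarith, by linarith⟩ fun l hl => by
      have := h.strictAntiOn hl (show -r ≤ 0 by linarith) (mem_Iic.2 le_rfl) (show -r < 0 by linarith)
      simpa [h.zero l hl] using this
  simp only [iteratedDeriv_zero] at hvr hvl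
  set v := min v₁ v₂ with hv
  have hv0 : 0 < v := lt_min hv₁ hv₂
  replace hvr : ∀ l ∈ Icc 0 Λ, v ≤ V r l := fun l hl => (min_le_left _ _).trans (hvr l hl)
  replace hvl : ∀ l ∈ Icc 0 Λ, v ≤ V (-r) l := fun l hl => (min_le_right _ _).trans (hvl l hl)
  have hanti : ∀ l ∈ Icc 0 Λ, MonotoneOn (fun x => V (-x) l) (Ici 0) := fun l hl x hx y hy hxy =>
    (h.strictAntiOn hl).antitoneOn (show -y ≤ 0 from neg_nonpos.2 hy)
      (show -x ≤ 0 from neg_nonpos.2 hx) (neg_le_neg hxy)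
  obtain ⟨K₁, hK₁, hright⟩ := exists_deriv_le_self hr0 hv0 h.pPlus_nonneg h.VPlus_pos
    (fun l hl => (h.strictMonoOn hl).monotoneOn) hvr h.growth_top
    (by simpa only [iteratedDeriv_two] using h.bound_top r hr0)
  obtain ⟨K₂, hK₂, hleft⟩ := exists_deriv_le_self (U := fun x l => V (-x) l) hr0 hv0
    h.pMinus_nonneg h.VMinus_pos hanti hvl
    (fun u hu => (tendsto_neg_atTop_atBot.eventually (h.growth_bot u hu)).mono fun x hx => by
      simpa only [abs_neg] using hx)
    (by
      obtain ⟨c, hc⟩ := h.bound_bot r hr0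
      refine ⟨c, fun l hl x hx => ?_⟩
      have := hc l hl (-x) (by linarith)
      rw [deriv2_comp_neg (fun x => V x l), deriv_comp_neg (fun x => V x l), abs_neg]
      rwa [abs_neg, iteratedDeriv_two] at this)
  set K := max K₁ K₂ with hK
  have hK0 : 0 < K := lt_max_of_lt_left hK₁
  -- Energies below `v/2` are exceeded by `V` at `±r`, which confines the turning points to `(-r,
  -- r)` and makes `farWKB_sub` applicable.
  set l₀ := min Λ (v / 2) with hl₀
  have hl₀0 : 0 < l₀ := lt_min hΛ (by positivity)
  refine ⟨l₀, hl₀0, min_le_left _ _, ?_⟩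
  let ι := {l : ℝ // 0 < l ∧ l ≤ l₀}
  have hI : ∀ i : ι, i.1 ∈ Icc 0 Λ := fun i => ⟨i.2.1.le, i.2.2.trans (min_le_left _ _)⟩
  have hiv : ∀ i : ι, i.1 ≤ v / 2 := fun i => i.2.2.trans (min_le_right _ _)
  have hopen : ∀ i : ι, IsOpen (Ioo (-R) R) := fun _ => isOpen_Ioo
  have hneg : ∀ (i : ι) x, -wellD (fun x => V x i.1) (fun _ => 1) √i.1 x = V x i.1 - i.1 :=
    fun i x => by rw [wellD, Real.sq_sqrt i.2.1.le]; ring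
  have hVpos : ∀ l ∈ Icc 0 Λ, ∀ x, 0 ≤ V x l := fun l hl x => by
    rw [← h.zero l hl]
    rcases le_total 0 x with hx | hx
    · exact (h.strictMonoOn hl).monotoneOn (mem_Ici.2 le_rfl) hx hx
    · exact (h.strictAntiOn hl).antitoneOn hx (mem_Iic.2 le_rfl) hx
  obtain ⟨C, hC, hmain⟩ := exists_langer_bound (ι := ι) (V := fun i x => V x i.1)
    (ρ := fun _ _ => 1) (a := fun i => √i.1) (r := r) (R₁ := 2 * r) (R₂ := R)
    (m := min m 1) (c := v / 2) (K := 2 * K + 2)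
    (fun i => h.well (hI i) i.2.1 hr0 (by linarith [hvr _ (hI i), hiv i])
      (by linarith [hvl _ (hI i), hiv i]))
    (UnifC.deriv (UnifC.deriv (UnifC.of_iteratedDeriv (k := 5)
      (fun i => by exact_mod_cast h.contDiff _ (hI i)) fun n hn => by
        obtain ⟨M, hM⟩ := h.exists_iteratedDeriv_le hn hRδ
        exact ⟨M, fun i x hx => hM _ (hI i) x (Ioo_subset_Icc_self hx)⟩)))
    (UnifC.const' hopen 1) (lt_min hm one_pos)
    (fun i x hx => (min_le_left _ _).trans
      (wellZ_ge ((h.contDiff _ (hI i)).of_le (by norm_num)) (hconv _ (hI i)) hx))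
    (fun _ _ _ => min_le_right _ _) hr0 (by linarith) (by linarith) (by positivity) (by positivity)
    (fun i => by
      simp only [hneg]
      exact farWKB_sub hr0 hv0 hK0 (hiv i) (h.strictMonoOn (hI i)).monotoneOn
        (hvr _ (hI i))
        (fun x hx => (hright _ (hI i) x hx).1.trans
          (mul_le_mul_of_nonneg_right (le_max_left _ _) (hVpos _ (hI i) _)))
        (fun x hx => (hright _ (hI i) x hx).2.trans
          (mul_le_mul_of_nonneg_right (le_max_left _ _) (hVpos _ (hI i) _))))
    (fun i => by
      simp only [hneg]
      exact farWKB_sub (U := fun x => V (-x) i.1) hr0 hv0 hK0 (hiv i) (hanti _ (hI i))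
        (hvl _ (hI i))
        (fun x hx => (hleft _ (hI i) x hx).1.trans
          (mul_le_mul_of_nonneg_right (le_max_right _ _) (hVpos _ (hI i) _)))
        (fun x hx => (hleft _ (hI i) x hx).2.trans
          (mul_le_mul_of_nonneg_right (le_max_right _ _) (hVpos _ (hI i) _))))
  refine ⟨C, hC, fun l hl hl' => ?_⟩
  obtain ⟨hLW, hb⟩ := hmain ⟨l, hl, hl'⟩
  have hdet : wellD (fun x => V x l) (fun _ => 1) √l = detFun (schrodingerB V l) := by
    funext x
    rw [detFun_schrodingerB, wellD, Real.sq_sqrt hl.le, mul_one]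
  simp only [hdet] at hLW hb
  refine ⟨hLW, fun y => ?_⟩
  have := (hb (Function.invFun (langer (detFun (schrodingerB V l))) y)).2
  rw [hLW.langer_invFun] at this
  rw [le_div_iff₀ (by positivity), schrodingerQ]
  exact this

end SchrodingerHypotheses

end Weber

theorem mainTheorem3 :
    (∀ (V : ℝ → ℝ → ℝ) (Λ δ pPlus pMinus : ℝ) (VPlus VMinus : ℝ → ℝ),
      Weber.SchrodingerHypotheses V Λ δ pPlus pMinus VPlus VMinus →
      ∃ l₀ : ℝ, 0 < l₀ ∧ l₀ ≤ Λ ∧ ∀ lmax : ℝ, 0 < lmax → lmax ≤ l₀ →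
        ∃ C : ℝ, 0 < C ∧ ∀ l : ℝ, 0 < l → l ≤ lmax →
          Weber.LangerWellDefined (Weber.detFun (Weber.schrodingerB V l)) ∧
          ∀ y : ℝ, |Weber.schrodingerQ V l y| ≤ C / (1 + y ^ 2)) ∧
    (∀ A S : ℝ → ℝ, Weber.ZakharovShabatHypotheses A S →
      ∀ lmax : ℝ, (⨅ x, Weber.rPlus A S x) < lmax → lmax < 1 →
        ∃ C : ℝ, 0 < C ∧ ∀ l : ℝ, (⨅ x, Weber.rPlus A S x) < l → l ≤ lmax →
          Weber.LangerWellDefined (Weber.detFun (Weber.zakharovShabatB A S l)) ∧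
          ∀ y : ℝ, |Weber.zakharovShabatQ A S l y| ≤ C / (1 + y ^ 2)) := by
  refine ⟨fun V Λ δ pPlus pMinus VPlus VMinus h => ?_, fun A S h lmax h0 h1 => h.exists_bound h0 h1⟩
  obtain ⟨l₀, hl₀, hΛ, C, hC, hmain⟩ := h.exists_bound
  exact ⟨l₀, hl₀, hΛ, fun lmax _ hlmax => ⟨C, hC, fun l hl hl' => hmain l hl (hl'.trans hlmax)⟩⟩
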